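/- **Setting.** Let $N$ be a stratified group: a simply connected real Lie group whose Lie algebra $\mathfrak n$ has a derivation $D$ such that the eigenspace $\{x : Dx = x\}$ (the first layer) generates $\mathfrak n$ as a Lie algebra. Assume $Q=\operatorname{tr} D\ge 2$. Identify $N$ with $\mathfrak n$ by the exponential map, and let $|\cdot|$ be a Lebesgue measure on $\mathfrak n$. Let $X_1,\dots,X_n$ be left-invariant vector fields forming a basis of the first layer. Let $G=N\rtimes\mathbb R$ with product $(z,u)(z',u')=(z\cdot e^{uD}z',u+u')$, right Haar measure $d\mu(z,u)=dz\,du$, and left-invariant vector fields $\partial_u,\ e^uX_1,\dots,e^uX_n$. Let $\varrho^N$ and $\varrho$ be the Carnot–Carathéodory distances on $N$ and $G$ for which $X_1,\dots,X_n$, respectively $\partial_u,e^uX_1,\dots,e^uX_n$, are orthonormal, i.e. the infimum of the lengths of the absolutely continuous horizontal curves joining two points. $B_N$ denotes balls of $\varrho^N$. **Dyadic systems.** A dyadic system on $N$ consists of $\eta,C_N>1$, an integer $J\ge2$, countable index sets $I_k$ ($k\in\mathbb Z$), Borel sets $Q^k_\alpha\subset N$ and points $n^k_\alpha\in N$ ($\alpha\in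 I_k$) such that, for all $k$: 1. $|N\setminus\bigcup_{\alpha} Q^k_\alpha|=0$; 2. $B_N(n^k_\alpha,C_N^{-1}\eta^k)\subset Q^k_\alpha\subset B_N(n^k_\alpha,C_N\eta^k)$; 3. $Q^k_\alpha\cap Q^k_\beta=\emptyset$ if $\alpha\ne\beta$; 4. for each $\alpha\in I_k$ there are at most $J$ indices $\beta\in I_{k-1}$ with $Q^{k-1}_\beta\subset Q^k_\alpha$; 5. for $\ell\le k$ and $\beta\in I_\ell$ there is a unique $\alpha\in I_k$ with $Q^\ell_\beta\subset Q^k_\alpha$; 6. for $\ell\le k$, $\alpha\in I_k$, $\beta\in I_\ell$, either $Q^k_\alpha\cap Q^\ell_\beta=\emptyset$ or $Q^\ell_\beta\subset Q^k_\alpha$. **Admissible sets.** Given such a system, let $M,r_0$ be constants with $$1<r_0<2\log2,\quad M>1,\quad e^{r_0}e^{2M}r_0\le e^{2Mr_0},\quad 6M>\log\eta-\log2+\tfrac{r_0}2,$$ $$\eta e^{4Mr_0}<2e^{8M}\inf_{r_0<r\le2r_0}re^{-r/2},\qquad \eta<4e^{(4M-1)r_0}.$$ The family $\mathcal R$ of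 admissible sets consists of the sets $Q^k_\alpha\times(u_0-r,u_0+r)$ with $k\in\mathbb Z$, $\alpha\in I_k$, $u_0\in\mathbb R$, $r>0$ such that $$re^{2M}e^{u_0}\le\eta^k<4re^{8M}e^{u_0}\ \text{ if } r\le r_0,\qquad e^{2Mr}e^{u_0}\le\eta^k<4e^{8Mr}e^{u_0}\ \text{ if } r>r_0 .$$ **Definition.** A metric measure space $(X,d,\mu)$ is a CZ-space with family $\mathcal R$ of measurable sets if there is a constant $\kappa_0>0$ such that: - for each $R\in\mathcal R$ there are $x\in X$, $r>0$ with $R\subset B(x,\kappa_0r)$ and $\mu(\{y: d(y,R)<r\})\le\kappa_0\mu(R)$; - for each $f\in L^1(X)$ (complex valued) and each $\alpha>\kappa_0\|f\|_1/\mu(X)$ (each $\alpha>0$ if $\mu(X)=\infty$) there are a measurable $g$ and an at most countable (possibly empty) family of $b_i\in L^1(X)$ and $R_i\in\mathcal R$ such that $f=g+\sum_ib_i$ almost everywhere, $\|g\|_\infty\le\kappa_0\alpha$, $b_i=0$ off $R_i$, $\int b_i\,d\mu=0$, $\sum_i\mu(R_i)\le\kappa_0\|f\|_1/\alpha$ and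 $\sum_i\|b_i\|_1\le\kappa_0\|f\|_1$. It satisfies condition (C) if there is $\mathcal R'\subset\mathcal R$ such that any two sets of $\mathcal R'$ that intersect are nested, and every $R\in\mathcal R$ is contained in some $R'\in\mathcal R'$. **Theorem.** Dyadic systems on $N$ exist, and for each of them constants $M,r_0$ as above exist. For every dyadic system on $N$ and all such $M,r_0$, the space $(G,\varrho,\mu)$ with the family $\mathcal R$ of admissible sets is a CZ-space which satisfies condition (C). -/

import Mathlib

open MeasureTheory Set
open scoped Manifold ContDiff ENNReal

/-- A smooth real Lie group has the regularity that Mathlib asks for in order to put the Lie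
bracket on the tangent space at the identity. -/
instance instLEInftyMinSmoothness : ENat.LEInfty (minSmoothness ℝ 3) :=
  ⟨by rw [minSmoothness_of_isRCLikeNormedField]; exact ENat.LEInfty.out⟩

noncomputable section

/-! ### Abstract Calderón–Zygmund spaces -/

section CZ

variable {X : Type*}

/-- The open ball of a distance function. -/
def distBall (d : X → X → ℝ≥0∞) (x : X) (r : ℝ) : Set X := {y | d y x < ENNReal.ofReal r}

/-- `{x | d(x, R) < r}`, where `d(x, R)` is the infimum of `d x y` over `y ∈ R`. -/
def distThickening (d : X → X → ℝ≥0∞) (r : ℝ) (R : Set X) : Set X :=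
  {x | (⨅ y ∈ R, d x y) < ENNReal.ofReal r}

/-- `d` is a (finite, separated) metric on `X` all of whose open sets are measurable, so that a
measure on `X` makes `X` a metric measure space. -/
structure IsMetricMeasurable [MeasurableSpace X] (d : X → X → ℝ≥0∞) : Prop where
  ne_top : ∀ x y, d x y ≠ ⊤
  eq_zero_iff : ∀ x y, d x y = 0 ↔ x = y
  symm : ∀ x y, d x y = d y x
  triangle : ∀ x y z, d x z ≤ d x y + d y z
  measurableSet_of_open : ∀ U : Set X,
    (∀ x ∈ U, ∃ r : ℝ, 0 < r ∧ distBall d x r ⊆ U) → MeasurableSet U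

/-- A Calderón–Zygmund decomposition `f = g + ∑ b i` at height `α`, with constant `κ` and with
the functions `b i` supported in the sets `R i`. The equality holds almost everywhere (and then,
by `sum_norm_le`, also in `L¹`). -/
structure IsCZDecomposition [MeasurableSpace X] (μ : Measure X) (κ α : ℝ) (f : X → ℂ)
    {ι : Type} (g : X → ℂ) (b : ι → X → ℂ) (R : ι → Set X) : Prop where
  measurable_good : AEStronglyMeasurable g μ
  integrable_bad : ∀ i, Integrable (b i) μ
  hasSum : ∀ᵐ x ∂μ, HasSum (fun i => b i x) (f x - g x)
  good_le : eLpNorm g ∞ μ ≤ ENNReal.ofReal (κ * α)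
  support_subset : ∀ i, Function.support (b i) ⊆ R i
  integral_eq_zero : ∀ i, ∫ x, b i x ∂μ = 0
  sum_measure_le : ∑' i, μ (R i) ≤ ENNReal.ofReal κ * (eLpNorm f 1 μ / ENNReal.ofReal α)
  sum_norm_le : ∑' i, eLpNorm (b i) 1 μ ≤ ENNReal.ofReal κ * eLpNorm f 1 μ

/-- `(X, d, μ)` is a CZ-space with CZ-constant `κ` and family `Rs` of admissible sets. The heights
are those with `α > κ ‖f‖₁ / μ(X)`; if `μ(X) = ∞` this means `α > 0`. -/
structure IsCZSpaceWith [MeasurableSpace X] (d : X → X → ℝ≥0∞) (μ : Measure X)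
    (Rs : Set (Set X)) (κ : ℝ) : Prop where
  const_pos : 0 < κ
  measurableSet : ∀ R ∈ Rs, MeasurableSet R
  center_radius : ∀ R ∈ Rs, ∃ (x : X) (r : ℝ), 0 < r ∧ R ⊆ distBall d x (κ * r) ∧
    μ (distThickening d r R) ≤ ENNReal.ofReal κ * μ R
  decomposition : ∀ f : X → ℂ, Integrable f μ → ∀ α : ℝ,
    ENNReal.ofReal κ * (eLpNorm f 1 μ / μ univ) < ENNReal.ofReal α →
    ∃ (ι : Type) (_ : Countable ι) (g : X → ℂ) (b : ι → X → ℂ) (R : ι → Set X),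
      (∀ i, R i ∈ Rs) ∧ IsCZDecomposition μ κ α f g b R

/-- The metric measure space `(X, d, μ)` is a CZ-space with family `Rs` of admissible sets. -/
def IsCZSpace [MeasurableSpace X] (d : X → X → ℝ≥0∞) (μ : Measure X) (Rs : Set (Set X)) : Prop :=
  IsMetricMeasurable d ∧ ∃ κ : ℝ, IsCZSpaceWith d μ Rs κ

/-- Condition (C) on a family of admissible sets. -/
def ConditionC (Rs : Set (Set X)) : Prop :=
  ∃ Rs' ⊆ Rs,
    (∀ R₁ ∈ Rs', ∀ R₂ ∈ Rs', (R₂ ∩ R₁).Nonempty → R₁ ⊆ R₂ ∨ R₂ ⊆ R₁) ∧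
    (∀ R ∈ Rs, ∃ R' ∈ Rs', R ⊆ R')

end CZ

/-! ### Carnot–Carathéodory distances -/

section CC

variable {E ι : Type*} [NormedAddCommGroup E] [NormedSpace ℝ E] [Fintype ι]

/-- `γ : [a, b] → E` is an absolutely continuous curve which is horizontal for the frame `F`,
i.e. `γ'(t) = ∑ j, c_j(t) F_j(γ(t))` for almost every `t`. -/
structure IsHorizontalCurve (F : ι → E → E) (a b : ℝ) (γ : ℝ → E)
    (c : ℝ → EuclideanSpace ℝ ι) : Prop where
  le : a ≤ b
  absolutelyContinuous : AbsolutelyContinuousOnInterval γ a b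
  deriv : ∀ᵐ t : ℝ, t ∈ Icc a b → HasDerivAt γ (∑ j, c t j • F j (γ t)) t

/-- The Carnot–Carathéodory distance of the sub-Riemannian structure for which the frame `F` is
orthonormal: the infimum of the lengths `∫ |c(t)| dt` of the horizontal curves from `p` to `q`
(infinite if there is none). -/
def ccDist (F : ι → E → E) (p q : E) : ℝ≥0∞ :=
  ⨅ (a : ℝ) (b : ℝ) (γ : ℝ → E) (c : ℝ → EuclideanSpace ℝ ι)
    (_ : IsHorizontalCurve F a b γ c ∧ γ a = p ∧ γ b = q), ∫⁻ t in Icc a b, ‖c t‖ₑ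

end CC

/-! ### The groups `N` and `G = N ⋊ A` -/

section Group

variable {V : Type*} [NormedAddCommGroup V] [NormedSpace ℝ V] [Group V]

/-- The left-invariant vector fields on `N` determined by a family `X` of elements of its
Lie algebra. Here `N` is `V` as a manifold. -/
def frameN {n : ℕ} (X : Fin n → GroupLieAlgebra 𝓘(ℝ, V) V) : Fin n → V → V :=
  fun j z => mulInvariantVectorField (I := 𝓘(ℝ, V)) (X j) z

/-- The left-invariant vector fields `∂_u` and `e^u X_j` (for `X_j` in the first layer) on
`G = N ⋊ ℝ`, whose points are the pairs `(z, u)`. -/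
def frameG {n : ℕ} (X : Fin n → GroupLieAlgebra 𝓘(ℝ, V) V) : Fin (n + 1) → V × ℝ → V × ℝ :=
  Fin.cons (fun _ => (0, 1)) (fun j p => (Real.exp p.2 • frameN X j p.1, 0))

end Group

/-! ### Dyadic sets and admissible sets -/

section Dyadic

variable {V : Type*} [MeasurableSpace V]

/-- A system of Christ dyadic sets on a space `V` with distance `d` and measure `ν`. -/
structure DyadicSystem (d : V → V → ℝ≥0∞) (ν : Measure V) where
  /-- the ratio of consecutive scales -/
  η : ℝ
  /-- the constant in the comparison with balls -/
  C : ℝ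
  /-- the bound for the number of children -/
  J : ℕ
  one_lt_η : 1 < η
  one_lt_C : 1 < C
  two_le_J : 2 ≤ J
  /-- the index set of the generation `k` -/
  I : ℤ → Type
  countable_I : ∀ k, Countable (I k)
  /-- the dyadic sets -/
  Q : ∀ k, I k → Set V
  /-- their centers -/
  center : ∀ k, I k → V
  measurableSet : ∀ k α, MeasurableSet (Q k α)
  cover : ∀ k, ν (⋃ α, Q k α)ᶜ = 0
  ball_subset : ∀ k α, distBall d (center k α) (C⁻¹ * η ^ k) ⊆ Q k α
  subset_ball : ∀ k α, Q k α ⊆ distBall d (center k α) (C * η ^ k)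
  disjoint : ∀ k (α β : I k), α ≠ β → Q k α ∩ Q k β = ∅
  children_le : ∀ k (α : I k), {β : I (k - 1) | Q (k - 1) β ⊆ Q k α}.encard ≤ J
  existsUnique_ancestor : ∀ l k, l ≤ k → ∀ β : I l, ∃! α : I k, Q l β ⊆ Q k α
  nested : ∀ l k, l ≤ k → ∀ (α : I k) (β : I l), Q k α ∩ Q l β = ∅ ∨ Q l β ⊆ Q k α

/-- The conditions on the constants `M` and `r₀` that enter the definition of admissible sets. -/
structure ScaleConditions (η M r₀ : ℝ) : Prop where
  one_lt_r₀ : 1 < r₀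
  r₀_lt : r₀ < 2 * Real.log 2
  one_lt_M : 1 < M
  cond₁ : Real.exp r₀ * Real.exp (2 * M) * r₀ ≤ Real.exp (2 * M * r₀)
  cond₂ : Real.log η - Real.log 2 + r₀ / 2 < 6 * M
  cond₃ : η * Real.exp (4 * M * r₀) <
    2 * Real.exp (8 * M) * sInf ((fun r : ℝ => r * Real.exp (-r / 2)) '' Ioc r₀ (2 * r₀))
  cond₄ : η < 4 * Real.exp ((4 * M - 1) * r₀)

/-- The relation between the scale `η ^ k`, the radius `r` and the height `u₀` of an admissible
set. -/
def ScaleAdmissible (η M r₀ : ℝ) (k : ℤ) (u₀ r : ℝ) : Prop :=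
  (r ≤ r₀ → r * Real.exp (2 * M) * Real.exp u₀ ≤ η ^ k ∧
    η ^ k < 4 * r * Real.exp (8 * M) * Real.exp u₀) ∧
  (r₀ < r → Real.exp (2 * M * r) * Real.exp u₀ ≤ η ^ k ∧
    η ^ k < 4 * Real.exp (8 * M * r) * Real.exp u₀)

/-- The family of admissible sets `Q × (u₀ - r, u₀ + r)` in `G`. -/
def admissibleSets {d : V → V → ℝ≥0∞} {ν : Measure V} (S : DyadicSystem d ν) (M r₀ : ℝ) :
    Set (Set (V × ℝ)) :=
  {R | ∃ (k : ℤ) (α : S.I k) (u₀ r : ℝ), 0 < r ∧ ScaleAdmissible S.η M r₀ k u₀ r ∧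
    R = S.Q k α ×ˢ Ioo (u₀ - r) (u₀ + r)}

end Dyadic

end

/-!
# Calderón–Zygmund spaces and condition (C) on `N ⋊ ℝ`

The proof separates the sub-Riemannian geometry of `N` from the covering arguments on `G`.

**Geometry of `N`.** All that is used about the Carnot–Carathéodory distance of `N` is that it is a
homogeneous distance (`IsHomogeneousDist`): a metric with the usual topology whose balls of equal radius
have equal measure and for which `|B(x, m r)|` is a fixed multiple of `|B(x, r)|`. In exponential
coordinates the automorphisms of the Lie algebra are automorphisms of the group
(`IsExpGroup.map_mul_of_map_bracket`). So the derivation integrates to dilations `exp (s D)`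
(`isDilation_exp`), whose eigenvalues tend to zero as `s → -∞` because the first layer generates.
Dilations and left translations scale and preserve distance and measure, respectively, and Chow's
theorem (`IsExpGroup.ccDist_bounded_near_zero`, `IsDilation.tendsto_ccDist`) shows that the distance is
finite and induces the topology.

**Dyadic systems.** A homogeneous distance is doubling, so nested nets with a choice of parents exist.
The cubes are the closures of the sets of descendants, with the overlaps removed according to a
lexicographic order that is compatible with the passage to parents; this makes them exactly nested
(`nonempty_dyadicSystem_of_card_le`).

**Decomposition.** An admissible set `Q × (u₀ - r, u₀ + r)` is split by replacing `Q` by its children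
if the results are admissible, and by halving the interval otherwise. The conditions on `M` and `r₀`
ensure that the halves are then admissible (`ScaleConditions.scaleAdmissible_half`). The measure
drops by a bounded factor only, and repeated splitting shrinks to points since a dyadic set cannot be
split indefinitely at a fixed height. Also `G` is partitioned into admissible sets of measure as large
as desired (`AdmissibleIndex.exists_partition`). Hence the stopping time argument of Calderón and
Zygmund works (`SplittingFamily.exists_decomposition`).

**Geometry of `G`.** The distance of `G` is compared with that of `N` by moving at a fixed height and
vertically, and by projecting curves (`ccDist_semidirectFrame_le`, `lt_of_ccDist_semidirectFrame_lt`).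
The points of an admissible set with `r` large are joined by going up to the height `u₀ + 8 M r`,
where the set has bounded diameter; this puts it in a ball of radius `O(r)`.

**Condition (C).** The admissible sets at height `u₀ = 0` with `r > r₀` whose scale is the least possible
one are nested and exhaust `G` (`ScaleConditions.conditionC`).
-/


/-! ### Absolutely continuous curves -/

section AbsolutelyContinuous

open AbsolutelyContinuousOnInterval

variable {X : Type*} [PseudoMetricSpace X]

theorem disjoint_uIoc_iff {x y x' y' : ℝ} :
    Disjoint (uIoc x y) (uIoc x' y') ↔ min (max x y) (max x' y') ≤ max (min x y) (min x' y') := by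
  rw [uIoc, uIoc, Ioc_disjoint_Ioc]

/-- A change of variables which does not increase distances and keeps disjoint intervals disjoint
preserves absolute continuity. -/
theorem AbsolutelyContinuousOnInterval.comp_of_disjoint {f : ℝ → X} {a b a' b' : ℝ}
    (hf : AbsolutelyContinuousOnInterval f a b) {φ : ℝ → ℝ}
    (hmaps : ∀ t ∈ uIcc a' b', φ t ∈ uIcc a b) (hlip : ∀ s t, dist (φ s) (φ t) ≤ dist s t)
    (hdisj : ∀ x y x' y', Disjoint (uIoc x y) (uIoc x' y') →
      Disjoint (uIoc (φ x) (φ y)) (uIoc (φ x') (φ y'))) :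
    AbsolutelyContinuousOnInterval (fun t => f (φ t)) a' b' := by
  rw [absolutelyContinuousOnInterval_iff] at hf ⊢
  intro ε hε
  obtain ⟨δ, hδ, h⟩ := hf ε hε
  refine ⟨δ, hδ, fun E hE hlen => ?_⟩
  refine h (E.1, fun i => (φ (E.2 i).1, φ (E.2 i).2)) ⟨fun i hi => ?_, fun i hi j hj hij => ?_⟩ ?_
  · exact ⟨hmaps _ (hE.1 i hi).1, hmaps _ (hE.1 i hi).2⟩
  · exact hdisj _ _ _ _ (hE.2 hi hj hij)
  · exact (Finset.sum_le_sum fun i _ => hlip _ _).trans_lt hlen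

theorem AbsolutelyContinuousOnInterval.comp_monotone {f : ℝ → X} {a b a' b' : ℝ}
    (hf : AbsolutelyContinuousOnInterval f a b) {φ : ℝ → ℝ} (hφ : Monotone φ)
    (hmaps : ∀ t ∈ uIcc a' b', φ t ∈ uIcc a b) (hlip : ∀ s t, dist (φ s) (φ t) ≤ dist s t) :
    AbsolutelyContinuousOnInterval (fun t => f (φ t)) a' b' := by
  refine hf.comp_of_disjoint hmaps hlip fun x y x' y' h => ?_
  rw [disjoint_uIoc_iff] at h ⊢
  simp only [← hφ.map_max, ← hφ.map_min]
  exact hφ h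

theorem AbsolutelyContinuousOnInterval.comp_neg {f : ℝ → X} {a b : ℝ}
    (hf : AbsolutelyContinuousOnInterval f a b) :
    AbsolutelyContinuousOnInterval (fun t => f (-t)) (-b) (-a) := by
  refine hf.comp_of_disjoint (fun t ht => ?_) (fun s t => by rw [dist_neg_neg])
    fun x y x' y' h => ?_
  · rw [mem_uIcc] at ht ⊢
    rcases ht with h | h
    · exact Or.inl ⟨by linarith [h.2], by linarith [h.1]⟩
    · exact Or.inr ⟨by linarith [h.2], by linarith [h.1]⟩
  · rw [disjoint_uIoc_iff] at h ⊢
    simp only [max_neg_neg, min_neg_neg]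
    exact neg_le_neg h

theorem AbsolutelyContinuousOnInterval.lipschitz_comp {Y : Type*} [PseudoMetricSpace Y]
    {f : ℝ → X} {a b : ℝ} (hf : AbsolutelyContinuousOnInterval f a b) {Φ : X → Y} {K : NNReal}
    {s : Set X} (hΦ : LipschitzOnWith K Φ s) (hmaps : ∀ t ∈ uIcc a b, f t ∈ s) :
    AbsolutelyContinuousOnInterval (fun t => Φ (f t)) a b := by
  rw [absolutelyContinuousOnInterval_iff] at hf ⊢
  intro ε hε
  obtain ⟨δ, hδ, h⟩ := hf (ε / (K + 1)) (by positivity)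
  refine ⟨δ, hδ, fun E hE hlen => ?_⟩
  have h1 : ∑ i ∈ Finset.range E.1, dist (Φ (f (E.2 i).1)) (Φ (f (E.2 i).2)) ≤
      (K + 1) * ∑ i ∈ Finset.range E.1, dist (f (E.2 i).1) (f (E.2 i).2) := by
    rw [Finset.mul_sum]
    refine Finset.sum_le_sum fun i hi => ?_
    refine (hΦ.dist_le_mul _ (hmaps _ (hE.1 i hi).1) _ (hmaps _ (hE.1 i hi).2)).trans ?_
    gcongr
    linarith
  have h2 := h E hE hlen
  rw [lt_div_iff₀ (by positivity)] at h2
  linarith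

theorem AbsolutelyContinuousOnInterval.contDiff_comp {E F : Type*} [NormedAddCommGroup E]
    [NormedSpace ℝ E] [NormedAddCommGroup F] [NormedSpace ℝ F] [FiniteDimensional ℝ E]
    {f : ℝ → E} {a b : ℝ} (hf : AbsolutelyContinuousOnInterval f a b) {Φ : E → F}
    (hΦ : ContDiff ℝ 1 Φ) : AbsolutelyContinuousOnInterval (fun t => Φ (f t)) a b := by
  obtain ⟨R, hR⟩ := (isCompact_uIcc.image_of_continuousOn hf.continuousOn).isBounded.subset_closedBall 0
  obtain ⟨K, hK⟩ := hΦ.locallyLipschitz.locallyLipschitzOn.exists_lipschitzOnWith_of_compact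
    (isCompact_closedBall (0 : E) R)
  exact hf.lipschitz_comp hK fun t ht => hR (mem_image_of_mem f ht)

/-- The displacement of an absolutely continuous curve in a normed space, which need not be complete,
is at most its length: compose the curve with a norming functional. -/
theorem AbsolutelyContinuousOnInterval.enorm_sub_le_lintegral {E : Type*} [NormedAddCommGroup E]
    [NormedSpace ℝ E] {f f' : ℝ → E} {a b : ℝ} (hab : a ≤ b)
    (hf : AbsolutelyContinuousOnInterval f a b)
    (hf' : ∀ᵐ t : ℝ, t ∈ Icc a b → HasDerivAt f (f' t) t) :
    ‖f b - f a‖ₑ ≤ ∫⁻ t in Icc a b, ‖f' t‖ₑ := by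
  obtain ⟨g, hg, hgf⟩ := exists_dual_vector'' ℝ (f b - f a)
  have hac : AbsolutelyContinuousOnInterval (fun t => g (f t)) a b :=
    hf.lipschitz_comp (g.lipschitz.lipschitzOnWith (s := univ)) (fun _ _ => mem_univ _)
  have h1 := hac.integral_deriv_eq_sub
  rw [← map_sub, hgf] at h1
  have h2 : ‖f b - f a‖ₑ = ‖∫ t in a..b, deriv (fun t => g (f t)) t‖ₑ := by
    rw [h1]; simp
  rw [h2, intervalIntegral.integral_of_le hab]
  refine (enorm_integral_le_lintegral_enorm _).trans ?_
  rw [← restrict_Ioc_eq_restrict_Icc]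
  refine lintegral_mono_ae ?_
  rw [ae_restrict_iff' measurableSet_Ioc]
  filter_upwards [hf'] with t ht hmem
  have h3 : HasDerivAt (fun t => g (f t)) (g (f' t)) t :=
    g.hasFDerivAt.comp_hasDerivAt t (ht (Ioc_subset_Icc_self hmem))
  rw [h3.deriv, enorm_le_iff_norm_le]
  exact (g.le_opNorm _).trans (mul_le_of_le_one_left (norm_nonneg _) hg)

end AbsolutelyContinuous

/-! ### Carnot–Carathéodory distances -/

section CarnotCaratheodory

variable {E ι : Type*} [NormedAddCommGroup E] [NormedSpace ℝ E] [Fintype ι] {F : ι → E → E}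

theorem IsHorizontalCurve.ccDist_le {a b : ℝ} {γ : ℝ → E} {c : ℝ → EuclideanSpace ℝ ι}
    (h : IsHorizontalCurve F a b γ c) : ccDist F (γ a) (γ b) ≤ ∫⁻ t in Icc a b, ‖c t‖ₑ :=
  iInf_le_of_le a <| iInf_le_of_le b <| iInf_le_of_le γ <| iInf_le_of_le c <|
    iInf_le_of_le ⟨h, rfl, rfl⟩ le_rfl

theorem exists_curve_of_ccDist_lt {p q : E} {L : ℝ≥0∞} (h : ccDist F p q < L) :
    ∃ (a b : ℝ) (γ : ℝ → E) (c : ℝ → EuclideanSpace ℝ ι),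
      IsHorizontalCurve F a b γ c ∧ γ a = p ∧ γ b = q ∧ ∫⁻ t in Icc a b, ‖c t‖ₑ < L := by
  simp only [ccDist, iInf_lt_iff] at h
  obtain ⟨a, b, γ, c, ⟨h1, h2, h3⟩, h4⟩ := h
  exact ⟨a, b, γ, c, h1, h2, h3, h4⟩

theorem ccDist_self (p : E) : ccDist F p p = 0 := by
  have h : IsHorizontalCurve F 0 0 (fun _ => p) 0 :=
    { le := le_rfl
      absolutelyContinuous :=
        ((LipschitzWith.const p).lipschitzOnWith (s := uIcc 0 0)).absolutelyContinuousOnInterval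
      deriv := .of_forall fun t _ => by simpa using hasDerivAt_const t p }
  simpa using h.ccDist_le

theorem IsHorizontalCurve.reverse {a b : ℝ} {γ : ℝ → E} {c : ℝ → EuclideanSpace ℝ ι}
    (h : IsHorizontalCurve F a b γ c) :
    IsHorizontalCurve F (-b) (-a) (fun t => γ (-t)) (fun t => -c (-t)) where
  le := neg_le_neg h.le
  absolutelyContinuous := h.absolutelyContinuous.comp_neg
  deriv := by
    have h1 := (Measure.measurePreserving_neg (volume : Measure ℝ)).quasiMeasurePreserving.ae h.deriv
    filter_upwards [h1] with t ht hmem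
    have h2 := ht ⟨by linarith [hmem.2], by linarith [hmem.1]⟩
    have h3 := h2.scomp t (hasDerivAt_neg t)
    refine HasDerivAt.congr_deriv (f := fun t => γ (-t)) h3 ?_
    simp

theorem ccDist_comm_le (p q : E) : ccDist F q p ≤ ccDist F p q := by
  refine le_of_forall_gt fun L hL => ?_
  obtain ⟨a, b, γ, c, h, rfl, rfl, hlen⟩ := exists_curve_of_ccDist_lt hL
  have h1 := h.reverse.ccDist_le
  simp only [neg_neg, enorm_neg] at h1
  refine (h1.trans_eq ?_).trans_lt hlen
  have h2 := (Measure.measurePreserving_neg (volume : Measure ℝ)).setLIntegral_comp_preimage_emb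
    (MeasurableEquiv.neg ℝ).measurableEmbedding (fun t => ‖c t‖ₑ) (Icc a b)
  rw [← h2]
  simp

theorem ccDist_comm (p q : E) : ccDist F p q = ccDist F q p :=
  le_antisymm (ccDist_comm_le _ _) (ccDist_comm_le _ _)

open Classical in
/-- Concatenation of horizontal curves. The second curve is translated in time so that it starts
when the first one ends. -/
theorem IsHorizontalCurve.concat {a b a' b' : ℝ} {γ γ' : ℝ → E} {c c' : ℝ → EuclideanSpace ℝ ι}
    (h : IsHorizontalCurve F a b γ c) (h' : IsHorizontalCurve F a' b' γ' c') (hγ : γ b = γ' a') :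
    IsHorizontalCurve F a (b' + (b - a'))
      (fun t => γ (min t b) + (γ' (max t b + (a' - b)) - γ b))
      (fun t => if t ≤ b then c t else c' (t + (a' - b))) where
  le := by linarith [h.le, h'.le]
  absolutelyContinuous := by
    have hab := h.le
    have hab' := h'.le
    have e : uIcc a (b' + (b - a')) = Icc a (b' + (b - a')) := uIcc_of_le (by linarith)
    refine AbsolutelyContinuousOnInterval.add ?_ (AbsolutelyContinuousOnInterval.sub ?_ ?_)
    · refine h.absolutelyContinuous.comp_monotone (φ := fun t => min t b)
        (fun s t hst => min_le_min_right _ hst) (fun t ht => ?_) fun s t => ?_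
      · rw [e] at ht
        rw [uIcc_of_le hab]
        exact ⟨le_min ht.1 hab, min_le_right _ _⟩
      · simpa [Real.dist_eq] using abs_min_sub_min_le_max s b t b
    · refine h'.absolutelyContinuous.comp_monotone (φ := fun t => max t b + (a' - b))
        (fun s t hst => add_le_add_left (max_le_max_right _ hst) _) (fun t ht => ?_) fun s t => ?_
      · rw [e] at ht
        rw [uIcc_of_le hab']
        have := le_max_right t b
        have : max t b ≤ b' + (b - a') := max_le ht.2 (by linarith)
        constructor <;> linarith
      · simpa [Real.dist_eq] using abs_max_sub_max_le_max s b t b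
    · exact ((LipschitzWith.const (γ b)).lipschitzOnWith (s := _)).absolutelyContinuousOnInterval
  deriv := by
    have h1 := (measurePreserving_add_right (volume : Measure ℝ)
      (a' - b)).quasiMeasurePreserving.ae h'.deriv
    filter_upwards [h.deriv, h1, Measure.ae_ne volume b] with t ht ht' hne hmem
    rcases lt_or_gt_of_ne hne with hlt | hgt
    · rw [if_pos hlt.le]
      have e : (fun t => γ (min t b) + (γ' (max t b + (a' - b)) - γ b)) =ᶠ[nhds t] γ := by
        filter_upwards [Iio_mem_nhds hlt] with s hs
        rw [min_eq_left (le_of_lt hs), max_eq_right (le_of_lt hs), add_sub_cancel, hγ]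
        simp
      refine HasDerivAt.congr_of_eventuallyEq ?_ e
      rw [min_eq_left hlt.le, max_eq_right hlt.le, add_sub_cancel, hγ, sub_self, add_zero]
      exact ht ⟨hmem.1, hlt.le⟩
    · rw [if_neg (not_le.2 hgt)]
      have e : (fun t => γ (min t b) + (γ' (max t b + (a' - b)) - γ b)) =ᶠ[nhds t]
          fun t => γ' (t + (a' - b)) := by
        filter_upwards [Ioi_mem_nhds hgt] with s hs
        rw [min_eq_right (le_of_lt hs), max_eq_left (le_of_lt hs)]
        abel
      refine HasDerivAt.congr_of_eventuallyEq ?_ e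
      rw [min_eq_right hgt.le, max_eq_left hgt.le, add_sub_cancel]
      refine HasDerivAt.comp_add_const t (a' - b) (ht' ⟨by linarith, by linarith [hmem.2]⟩)

theorem ccDist_triangle (p q r : E) : ccDist F p r ≤ ccDist F p q + ccDist F q r := by
  refine ENNReal.le_of_forall_pos_le_add fun ε hε hlt => ?_
  have hε' : (ε : ℝ≥0∞) / 2 ≠ 0 := by simpa using hε.ne'
  have hne := ENNReal.add_ne_top.1 hlt.ne
  obtain ⟨a, b, γ, c, h, hp, hq, hlen⟩ :=
    exists_curve_of_ccDist_lt (ENNReal.lt_add_right hne.1 hε')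
  obtain ⟨a', b', γ', c', h', hq', hr', hlen'⟩ :=
    exists_curve_of_ccDist_lt (ENNReal.lt_add_right hne.2 hε')
  have hγ : γ b = γ' a' := by rw [hq, hq']
  have h1 := (h.concat h' hγ).ccDist_le
  have hab := h.le
  have hab' := h'.le
  have e1 : γ (min a b) + (γ' (max a b + (a' - b)) - γ b) = p := by
    rw [min_eq_left hab, max_eq_right hab, add_sub_cancel, hγ, sub_self, add_zero, hp]
  have e2 : γ (min (b' + (b - a')) b) + (γ' (max (b' + (b - a')) b + (a' - b)) - γ b) = r := by
    rw [min_eq_right (by linarith), max_eq_left (by linarith), ← hr']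
    have : b' + (b - a') + (a' - b) = b' := by ring
    rw [this]; abel
  rw [e1, e2] at h1
  refine h1.trans ?_
  have e3 : Icc a (b' + (b - a')) = Icc a b ∪ Ioc b (b' + (b - a')) :=
    (Icc_union_Ioc_eq_Icc hab (by linarith)).symm
  rw [e3]
  refine (lintegral_union_le _ _ _).trans ?_
  have e4 : ∫⁻ t in Icc a b, ‖if t ≤ b then c t else c' (t + (a' - b))‖ₑ =
      ∫⁻ t in Icc a b, ‖c t‖ₑ :=
    setLIntegral_congr_fun measurableSet_Icc fun t ht => by simp only [if_pos ht.2]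
  have e5 : ∫⁻ t in Ioc b (b' + (b - a')), ‖if t ≤ b then c t else c' (t + (a' - b))‖ₑ ≤
      ∫⁻ t in Icc a' b', ‖c' t‖ₑ := by
    rw [setLIntegral_congr_fun (g := fun t => ‖c' (t + (a' - b))‖ₑ) measurableSet_Ioc
      fun t ht => by simp only [if_neg (not_le.2 ht.1)]]
    rw [← (measurePreserving_add_right (volume : Measure ℝ)
      (a' - b)).setLIntegral_comp_preimage_emb (measurableEmbedding_addRight _)
      (fun t => ‖c' t‖ₑ) (Icc a' b')]
    refine lintegral_mono_set fun t ht => ⟨?_, ?_⟩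
    · show a' ≤ t + (a' - b)
      linarith [ht.1]
    · show t + (a' - b) ≤ b'
      linarith [ht.2]
  rw [e4]
  calc _ ≤ (ccDist F p q + ε / 2) + (ccDist F q r + ε / 2) :=
        add_le_add hlen.le (e5.trans hlen'.le)
    _ = ccDist F p q + ccDist F q r + ε := by
        rw [add_add_add_comm, ENNReal.add_halves]

theorem IsHorizontalCurve.hasDerivAt_comp {E' : Type*} [NormedAddCommGroup E'] [NormedSpace ℝ E']
    {Φ : E → E'} (hΦ : ContDiff ℝ 1 Φ) {a b : ℝ} {γ : ℝ → E} {c : ℝ → EuclideanSpace ℝ ι}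
    (h : IsHorizontalCurve F a b γ c) :
    ∀ᵐ t : ℝ, t ∈ Icc a b →
      HasDerivAt (fun t => Φ (γ t)) (∑ j, c t j • fderiv ℝ Φ (γ t) (F j (γ t))) t := by
  filter_upwards [h.deriv] with t ht hmem
  have h1 := ((hΦ.differentiable one_ne_zero) (γ t)).hasFDerivAt.comp_hasDerivAt t (ht hmem)
  simp only [map_sum, map_smul] at h1
  exact h1

/-- A `C¹` map which multiplies the frame by a constant multiplies distances by at most that
constant. -/
theorem ccDist_map_le {E' : Type*} [NormedAddCommGroup E'] [NormedSpace ℝ E']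
    [FiniteDimensional ℝ E] {F' : ι → E' → E'} {Φ : E → E'} (hΦ : ContDiff ℝ 1 Φ) {m : ℝ}
    (hm : m ≠ 0) (hF : ∀ j p, fderiv ℝ Φ p (F j p) = m • F' j (Φ p)) (p q : E) :
    ccDist F' (Φ p) (Φ q) ≤ ‖m‖ₑ * ccDist F p q := by
  have hm' : ‖m‖ₑ ≠ 0 := by simpa using hm
  rw [mul_comm, ← ENNReal.div_le_iff hm' enorm_ne_top]
  refine le_of_forall_gt fun L hL => ?_
  obtain ⟨a, b, γ, c, h, rfl, rfl, hlen⟩ := exists_curve_of_ccDist_lt hL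
  have h1 : IsHorizontalCurve F' a b (fun t => Φ (γ t)) (fun t => m • c t) :=
    { le := h.le
      absolutelyContinuous := h.absolutelyContinuous.contDiff_comp hΦ
      deriv := by
        filter_upwards [h.hasDerivAt_comp hΦ] with t ht hmem
        have h2 := ht hmem
        simp only [hF] at h2
        convert h2 using 2 with j
        rw [PiLp.smul_apply, smul_eq_mul, smul_smul, mul_comm] }
  refine lt_of_le_of_lt ?_ hlen
  rw [ENNReal.div_le_iff hm' enorm_ne_top, mul_comm]
  refine h1.ccDist_le.trans_eq ?_
  simp only [enorm_smul]
  exact lintegral_const_mul' _ _ enorm_ne_top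

end CarnotCaratheodory

/-! ### Calculus on a Lie group in exponential coordinates -/

section GroupCalculus

/-- The vector space `V` carries a smooth group law for which the lines `t ↦ t • x` are
one-parameter subgroups. -/
structure IsExpGroup (V : Type*) [NormedAddCommGroup V] [NormedSpace ℝ V] [Group V] : Prop where
  contDiff_mul : ContDiff ℝ ∞ fun p : V × V => p.1 * p.2
  smul_mul_smul : ∀ (s t : ℝ) (x : V), (s • x) * (t • x) = (s + t) • x

variable {V : Type*} [NormedAddCommGroup V] [NormedSpace ℝ V] [Group V]

/-- The differential at the identity of the left translation by `p`, so that `p ↦ leftDeriv p v` is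
the left-invariant vector field with value `v` at the identity. -/
noncomputable def leftDeriv (p : V) : V →L[ℝ] V := fderiv ℝ (fun x => p * x) 0

/-- The differential at `p` of the left translation by `p⁻¹`, i.e. the Maurer–Cartan form. -/
noncomputable def maurerCartan (p : V) : V →L[ℝ] V := fderiv ℝ (fun x => p⁻¹ * x) p

namespace IsExpGroup

variable (h : IsExpGroup V)
include h

theorem one_eq_zero : (1 : V) = 0 := by
  have := h.smul_mul_smul 0 0 0
  simp only [smul_zero] at this
  exact (mul_eq_left.1 this).symm

theorem inv_eq_neg (x : V) : x⁻¹ = -x := by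
  have := h.smul_mul_smul 1 (-1) x
  rw [add_neg_cancel, zero_smul, one_smul, neg_one_smul, ← h.one_eq_zero] at this
  exact inv_eq_of_mul_eq_one_right this

theorem zero_mul' (x : V) : 0 * x = x := by rw [← h.one_eq_zero, one_mul]

theorem mul_zero' (x : V) : x * 0 = x := by rw [← h.one_eq_zero, mul_one]

theorem contDiff_mul_left (p : V) : ContDiff ℝ ∞ fun x : V => p * x :=
  h.contDiff_mul.comp (contDiff_const.prodMk contDiff_id)

theorem contDiff_mul_right (p : V) : ContDiff ℝ ∞ fun x : V => x * p :=
  h.contDiff_mul.comp (contDiff_id.prodMk contDiff_const)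

theorem contDiff_inv : ContDiff ℝ ∞ fun x : V => x⁻¹ := by
  simp only [h.inv_eq_neg]
  exact contDiff_neg

theorem contDiff_leftDeriv : ContDiff ℝ ∞ (leftDeriv : V → V →L[ℝ] V) :=
  ContDiff.fderiv (f := fun p x : V => p * x) (n := ∞) (m := ∞) h.contDiff_mul contDiff_const le_rfl

theorem contDiff_maurerCartan : ContDiff ℝ ∞ (maurerCartan : V → V →L[ℝ] V) :=
  ContDiff.fderiv (f := fun p x : V => p⁻¹ * x) (n := ∞) (m := ∞)
    (h.contDiff_mul.comp ((h.contDiff_inv.comp contDiff_fst).prodMk contDiff_snd)) contDiff_id le_rfl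

theorem hasFDerivAt_mul_left (p x : V) :
    HasFDerivAt (fun y => p * y) (fderiv ℝ (fun y => p * y) x) x :=
  ((h.contDiff_mul_left p).differentiable (by simp) x).hasFDerivAt

/-- Left-invariance of the vector fields `leftDeriv · v`. -/
theorem fderiv_mul_left (p x v : V) :
    fderiv ℝ (fun y => p * y) x (leftDeriv x v) = leftDeriv (p * x) v := by
  have h1 := h.hasFDerivAt_mul_left x 0
  have h2 := h.hasFDerivAt_mul_left p (x * 0)
  have h3 := h2.comp 0 h1
  have h4 : (fun y => p * y) ∘ (fun y => x * y) = fun y => (p * x) * y := by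
    ext y; simp [mul_assoc]
  rw [h4] at h3
  rw [leftDeriv, leftDeriv, h3.fderiv, h.mul_zero']
  rfl

theorem leftDeriv_zero : leftDeriv (0 : V) = ContinuousLinearMap.id ℝ V := by
  rw [leftDeriv]
  simp only [h.zero_mul']
  exact fderiv_fun_id

theorem maurerCartan_leftDeriv (p v : V) : maurerCartan p (leftDeriv p v) = v := by
  rw [maurerCartan, h.fderiv_mul_left, inv_mul_cancel, h.one_eq_zero, h.leftDeriv_zero]
  rfl

theorem leftDeriv_maurerCartan (p v : V) : leftDeriv p (maurerCartan p v) = v := by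
  have h1 := h.hasFDerivAt_mul_left p⁻¹ p
  have h2 := h.hasFDerivAt_mul_left p (p⁻¹ * p)
  have h3 := h2.comp p h1
  have h4 : (fun y => p * y) ∘ (fun y => p⁻¹ * y) = id := by ext y; simp
  rw [h4] at h3
  have h5 := h3.unique (hasFDerivAt_id p)
  rw [inv_mul_cancel, h.one_eq_zero] at h5
  exact congrArg (fun L : V →L[ℝ] V => L v) h5

theorem hasDerivAt_mul_smul (p x : V) (t : ℝ) :
    HasDerivAt (fun s : ℝ => p * (s • x)) (leftDeriv (p * (t • x)) x) t := by
  have h1 : HasDerivAt (fun s : ℝ => (s - t) • x) x t := by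
    simpa using ((hasDerivAt_id t).sub_const t).smul_const x
  have h2 := h.hasFDerivAt_mul_left (p * (t • x)) 0
  have h3 : HasFDerivAt (fun y => p * (t • x) * y) (leftDeriv (p * (t • x))) ((t - t) • x) := by
    rw [sub_self, zero_smul]; exact h2
  have h4 := h3.comp_hasDerivAt t h1
  convert h4 using 1
  ext s
  simp only [Function.comp]
  rw [mul_assoc, h.smul_mul_smul, add_sub_cancel]

theorem leftDeriv_smul_self (t : ℝ) (x : V) : leftDeriv (t • x) x = x := by
  have h1 := h.hasDerivAt_mul_smul 0 x t
  simp only [h.zero_mul'] at h1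
  have h2 : HasDerivAt (fun s : ℝ => s • x) x t := by simpa using (hasDerivAt_id t).smul_const x
  exact h1.unique h2

theorem leftDeriv_self (x : V) : leftDeriv x x = x := by
  simpa using h.leftDeriv_smul_self 1 x

end IsExpGroup

/-- `br` is the bracket of left-invariant vector fields: the commutator of `leftDeriv · v` and
`leftDeriv · w` is the left-invariant vector field of `br v w`. -/
def IsInvariantBracket (br : V →ₗ[ℝ] V →ₗ[ℝ] V) : Prop :=
  ∀ v w p : V, fderiv ℝ (leftDeriv : V → V →L[ℝ] V) p (leftDeriv p v) w -
    fderiv ℝ (leftDeriv : V → V →L[ℝ] V) p (leftDeriv p w) v = leftDeriv p (br v w)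

namespace IsExpGroup

variable (h : IsExpGroup V)
include h

theorem hasFDerivAt_leftDeriv (p : V) : HasFDerivAt (leftDeriv : V → V →L[ℝ] V)
    (fderiv ℝ (leftDeriv : V → V →L[ℝ] V) p) p :=
  (h.contDiff_leftDeriv.differentiable (by simp) p).hasFDerivAt

theorem hasDerivAt_leftDeriv_smul (x : V) (t : ℝ) :
    HasDerivAt (fun s : ℝ => leftDeriv (s • x)) (fderiv ℝ (leftDeriv : V → V →L[ℝ] V) (t • x) x) t := by
  have h2 : HasDerivAt (fun s : ℝ => s • x) x t := by simpa using (hasDerivAt_id t).smul_const x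
  exact (h.hasFDerivAt_leftDeriv (t • x)).comp_hasDerivAt t h2

theorem fderiv_leftDeriv_apply_self (x w : V) :
    fderiv ℝ (leftDeriv : V → V →L[ℝ] V) x w x + leftDeriv x w = w := by
  have h1 := (h.hasFDerivAt_leftDeriv x).clm_apply (hasFDerivAt_id x)
  have h2 : (fun y : V => leftDeriv y (id y)) = id := by ext y; simp [h.leftDeriv_self]
  rw [h2] at h1
  have h3 := congrArg (fun L : V →L[ℝ] V => L w) (h1.unique (hasFDerivAt_id x))
  simpa [add_comm] using h3

/-- The Maurer–Cartan form along a one-parameter subgroup: `f t = t • maurerCartan (t • x) v` solves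
`f' = v - [x, f]`. This linear equation and `f 0 = 0` determine the Maurer–Cartan form, and thus the
group law, in terms of the bracket. -/
theorem hasDerivAt_maurerCartan {br : V →ₗ[ℝ] V →ₗ[ℝ] V} (hbr : IsInvariantBracket br) (x v : V)
    (t : ℝ) :
    HasDerivAt (fun s : ℝ => s • maurerCartan (s • x) v)
      (v - br x (t • maurerCartan (t • x) v)) t := by
  set A' := fderiv ℝ (leftDeriv : V → V →L[ℝ] V) (t • x) with hA'
  have h2 : HasDerivAt (fun s : ℝ => s • x) x t := by simpa using (hasDerivAt_id t).smul_const x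
  obtain ⟨B', hB'⟩ : ∃ B' : V →L[ℝ] V,
      HasDerivAt (fun s : ℝ => maurerCartan (s • x)) B' t := by
    have h3 := (h.contDiff_maurerCartan.differentiable (by simp) (t • x)).hasFDerivAt
    have h4 := h3.comp_hasDerivAt t h2
    exact ⟨_, h4⟩
  have hBv : HasDerivAt (fun s : ℝ => maurerCartan (s • x) v) (B' v) t := by
    simpa using hB'.clm_apply (hasDerivAt_const t v)
  -- differentiate `A B v = v`
  set b := maurerCartan (t • x) v with hb
  have e1 : A' x b + leftDeriv (t • x) (B' v) = 0 := by
    have h3 := (h.hasDerivAt_leftDeriv_smul x t).clm_apply hBv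
    simp only [h.leftDeriv_maurerCartan] at h3
    simpa using h3.unique (hasDerivAt_const t v)
  have e2 := hbr x b (t • x)
  rw [h.leftDeriv_smul_self, hb, h.leftDeriv_maurerCartan, ← hb, ← hA'] at e2
  have e3 := h.fderiv_leftDeriv_apply_self (t • x) v
  rw [map_smul, ← hA'] at e3
  -- now `t B' v = v - b - [x, t b]`
  have e4 : leftDeriv (t • x) (t • B' v) = leftDeriv (t • x) (v - b - t • br x b) := by
    have e5 : leftDeriv (t • x) b = v := h.leftDeriv_maurerCartan _ _
    rw [map_smul, map_sub, map_sub, map_smul, ← e2, e5]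
    have e6 : leftDeriv (t • x) (B' v) = - A' x b := by
      rw [eq_neg_iff_add_eq_zero, add_comm]; exact e1
    have e7 : leftDeriv (t • x) v = v - t • A' v x := eq_sub_of_add_eq' e3
    rw [e6, e7]
    module
  have e7 : t • B' v = v - b - t • br x b := by
    have := congrArg (maurerCartan (t • x)) e4
    rwa [h.maurerCartan_leftDeriv, h.maurerCartan_leftDeriv] at this
  have h5 := (hasDerivAt_id t).smul hBv
  refine h5.congr_deriv ?_
  simp only [id, one_smul, e7, map_smul, ← hb]
  abel

/-- Automorphisms of the Lie algebra intertwine the Maurer–Cartan form. -/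
theorem maurerCartan_map [FiniteDimensional ℝ V] {br : V →ₗ[ℝ] V →ₗ[ℝ] V}
    (hbr : IsInvariantBracket br) {φ : V →L[ℝ] V} (hφ : ∀ v w, φ (br v w) = br (φ v) (φ w))
    (x v : V) : maurerCartan (φ x) (φ v) = φ (maurerCartan x v) := by
  set L : V →L[ℝ] V := (br (φ x)).toContinuousLinearMap with hL
  have hLa : ∀ w, L w = br (φ x) w := fun _ => rfl
  have key : (fun s : ℝ => s • maurerCartan (s • φ x) (φ v)) =
      fun s : ℝ => φ (s • maurerCartan (s • x) v) := by
    refine ODE_solution_unique_univ (v := fun _ w => φ v - L w) (s := fun _ => univ)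
      (K := ‖L‖₊) (t₀ := 0) (fun t => ?_) (fun t => ⟨?_, mem_univ _⟩) (fun t => ⟨?_, mem_univ _⟩) ?_
    · refine LipschitzWith.lipschitzOnWith ?_
      refine LipschitzWith.of_dist_le_mul fun a b => ?_
      rw [dist_sub_left]
      exact L.lipschitz.dist_le_mul a b
    · exact h.hasDerivAt_maurerCartan hbr (φ x) (φ v) t
    · have h1 := φ.hasFDerivAt.comp_hasDerivAt t (h.hasDerivAt_maurerCartan hbr x v t)
      refine h1.congr_deriv ?_
      rw [map_sub, hφ, hLa]
    · simp
  simpa using congrFun key 1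

theorem leftDeriv_map [FiniteDimensional ℝ V] {br : V →ₗ[ℝ] V →ₗ[ℝ] V}
    (hbr : IsInvariantBracket br) {φ : V →L[ℝ] V} (hφ : ∀ v w, φ (br v w) = br (φ v) (φ w))
    (x v : V) : leftDeriv (φ x) (φ v) = φ (leftDeriv x v) := by
  have h1 := h.maurerCartan_map hbr hφ x (leftDeriv x v)
  rw [h.maurerCartan_leftDeriv] at h1
  rw [← h1, h.leftDeriv_maurerCartan]

/-- Integral curves of a left-invariant vector field are determined by their initial point. -/
theorem integralCurve_unique [FiniteDimensional ℝ V] {w : V} {f g : ℝ → V}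
    (hf : ∀ t, HasDerivAt f (leftDeriv (f t) w) t) (hg : ∀ t, HasDerivAt g (leftDeriv (g t) w) t)
    (h0 : f 0 = g 0) : f 1 = g 1 := by
  have hfc : Continuous f := continuous_iff_continuousAt.2 fun t => (hf t).continuousAt
  have hgc : Continuous g := continuous_iff_continuousAt.2 fun t => (hg t).continuousAt
  obtain ⟨R, hR⟩ := ((isCompact_Icc (a := (0 : ℝ)) (b := 1)).image hfc).union
    ((isCompact_Icc (a := (0 : ℝ)) (b := 1)).image hgc) |>.isBounded.subset_closedBall 0
  have hw : ContDiff ℝ 1 fun p : V => leftDeriv p w :=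
    (h.contDiff_leftDeriv.clm_apply contDiff_const).of_le (by simp)
  obtain ⟨K, hK⟩ := hw.locallyLipschitz.locallyLipschitzOn.exists_lipschitzOnWith_of_compact
    (isCompact_closedBall (0 : V) R)
  refine ODE_solution_unique_of_mem_Icc_right (v := fun _ p => leftDeriv p w)
    (s := fun _ => Metric.closedBall 0 R) (a := 0) (b := 1) (fun _ _ => hK) hfc.continuousOn
    (fun t _ => (hf t).hasDerivWithinAt) (fun t ht => ?_) hgc.continuousOn
    (fun t _ => (hg t).hasDerivWithinAt) (fun t ht => ?_) h0 (right_mem_Icc.2 zero_le_one)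
  · exact hR (Or.inl (mem_image_of_mem f (Ico_subset_Icc_self ht)))
  · exact hR (Or.inr (mem_image_of_mem g (Ico_subset_Icc_self ht)))

/-- In exponential coordinates automorphisms of the Lie algebra are automorphisms of the group. -/
theorem map_mul_of_map_bracket [FiniteDimensional ℝ V] {br : V →ₗ[ℝ] V →ₗ[ℝ] V}
    (hbr : IsInvariantBracket br) {φ : V →L[ℝ] V} (hφ : ∀ v w, φ (br v w) = br (φ v) (φ w))
    (x y : V) : φ (x * y) = φ x * φ y := by
  have h1 := h.integralCurve_unique (w := φ y) (f := fun t => φ (x * (t • y)))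
    (g := fun t => φ x * (t • φ y)) (fun t => ?_) (fun t => h.hasDerivAt_mul_smul _ _ t) ?_
  · simpa using h1
  · rw [h.leftDeriv_map hbr hφ]
    exact φ.hasFDerivAt.comp_hasDerivAt t (h.hasDerivAt_mul_smul _ _ t)
  · simp [h.mul_zero']

/-- Conjugations are linear in exponential coordinates: they map one-parameter subgroups to
one-parameter subgroups. -/
theorem conj_eq_fderiv [FiniteDimensional ℝ V] (g x : V) :
    g * x * g⁻¹ = fderiv ℝ (fun y => g * y * g⁻¹) 0 x := by
  set Ad := fderiv ℝ (fun y => g * y * g⁻¹) 0 with hAd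
  have hd : HasFDerivAt (fun y => g * y * g⁻¹) Ad 0 :=
    (((h.contDiff_mul_right g⁻¹).comp (h.contDiff_mul_left g)).differentiable (by simp) 0).hasFDerivAt
  have h1 := h.integralCurve_unique (w := Ad x) (f := fun t => g * (t • x) * g⁻¹)
    (g := fun t => 0 * (t • Ad x)) (fun t => ?_) (fun t => h.hasDerivAt_mul_smul _ _ t) ?_
  · simpa [h.zero_mul'] using h1
  · have h2 : HasDerivAt (fun s : ℝ => (s - t) • x) x t := by
      simpa using ((hasDerivAt_id t).sub_const t).smul_const x
    have h3 : HasFDerivAt (fun y => g * y * g⁻¹) Ad ((t - t) • x) := by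
      rw [sub_self, zero_smul]; exact hd
    have h4 := h3.comp_hasDerivAt t h2
    have h5 : HasFDerivAt (fun y => g * (t • x) * g⁻¹ * y) (leftDeriv (g * (t • x) * g⁻¹))
        (g * ((t - t) • x) * g⁻¹) := by
      rw [sub_self, zero_smul, h.mul_zero', mul_inv_cancel, h.one_eq_zero]
      exact h.hasFDerivAt_mul_left _ 0
    have h6 := h5.comp_hasDerivAt t h4
    convert h6 using 1
    ext s
    simp only [Function.comp]
    have h7 : s • x = (t • x) * ((s - t) • x) := by rw [h.smul_mul_smul, add_sub_cancel]
    rw [h7]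
    group
  · simp [h.mul_zero', h.one_eq_zero]

/-- The derivative of `leftDeriv` at the identity is alternating, because `leftDeriv (t • x) x = x`
for all `t`. -/
theorem fderiv_leftDeriv_zero_antisymm (v w : V) :
    fderiv ℝ (leftDeriv : V → V →L[ℝ] V) 0 v w = - fderiv ℝ (leftDeriv : V → V →L[ℝ] V) 0 w v := by
  have hz : ∀ x, fderiv ℝ (leftDeriv : V → V →L[ℝ] V) 0 x x = 0 := by
    intro x
    have h1 := (h.hasDerivAt_leftDeriv_smul x 0).clm_apply (hasDerivAt_const 0 x)
    simp only [h.leftDeriv_smul_self, zero_smul] at h1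
    simpa using h1.unique (hasDerivAt_const 0 x)
  have h1 := hz (v + w)
  simp only [map_add, add_apply, hz, zero_add, add_zero] at h1
  rw [eq_neg_iff_add_eq_zero, add_comm]
  exact h1

/-- The derivative of the adjoint action is the bracket. For each `y` the derivative of
`s ↦ (s • w) * y * (s • w)⁻¹` at `0` is `leftDeriv (-y) w - leftDeriv y w`. It is linear in `y`, since
conjugations are linear, hence it agrees with its own linearization at `y = 0`, which is the
bracket. -/
theorem hasDerivAt_conj [FiniteDimensional ℝ V] {br : V →ₗ[ℝ] V →ₗ[ℝ] V}
    (hbr : IsInvariantBracket br) (w x : V) :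
    HasDerivAt (fun s : ℝ => (s • w) * x * (s • w)⁻¹) (br w x) 0 := by
  have hK : ∀ y : V, HasDerivAt (fun s : ℝ => (s • w) * y * (s • w)⁻¹)
      (leftDeriv (-y) w - leftDeriv y w) 0 := by
    intro y
    have hm : HasFDerivAt (fun p : V × V => p.1 * p.2)
        (fderiv ℝ (fun p : V × V => p.1 * p.2) (y, 0)) (y, 0) :=
      (h.contDiff_mul.differentiable (by simp) (y, 0)).hasFDerivAt
    have hsm' : HasDerivAt (fun s : ℝ => s • (-w)) (-w) 0 := by
      simpa using (hasDerivAt_id (0 : ℝ)).smul_const (-w)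
    have e1 : HasDerivAt (fun s : ℝ => (s • w) * y) (leftDeriv (-y) w) 0 := by
      have e2 := (h.hasDerivAt_mul_smul (-y) (-w) 0).neg
      simp only [zero_smul, h.mul_zero', map_neg, neg_neg] at e2
      convert e2 using 1
      ext s
      rw [Pi.neg_apply, ← h.inv_eq_neg, mul_inv_rev, ← h.inv_eq_neg y, inv_inv, h.inv_eq_neg, smul_neg,
        neg_neg]
    -- the partial derivatives of the multiplication at `(y, 0)`
    have p1 : ∀ u, fderiv ℝ (fun p : V × V => p.1 * p.2) (y, 0) (u, 0) = u := by
      intro u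
      have hc : HasDerivAt (fun s : ℝ => ((y + s • u, 0) : V × V)) (u, 0) 0 := by
        have : HasDerivAt (fun s : ℝ => y + s • u) u 0 := by
          simpa using ((hasDerivAt_id (0 : ℝ)).smul_const u).const_add y
        exact this.prodMk (hasDerivAt_const _ _)
      have hm0 : HasFDerivAt (fun p : V × V => p.1 * p.2)
          (fderiv ℝ (fun p : V × V => p.1 * p.2) (y, 0)) (y + (0 : ℝ) • u, 0) := by simpa using hm
      have := hm0.comp_hasDerivAt 0 hc
      have e : (fun p : V × V => p.1 * p.2) ∘ (fun s : ℝ => ((y + s • u, 0) : V × V)) =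
          fun s : ℝ => y + s • u := by ext s; simp [h.mul_zero']
      rw [e] at this
      refine this.unique ?_
      simpa using ((hasDerivAt_id (0 : ℝ)).smul_const u).const_add y
    have p2 : ∀ u, fderiv ℝ (fun p : V × V => p.1 * p.2) (y, 0) (0, u) = leftDeriv y u := by
      intro u
      have hc : HasFDerivAt (fun z : V => ((y, z) : V × V)) (ContinuousLinearMap.inr ℝ V V) 0 :=
        hasFDerivAt_prodMk_right y 0
      have := hm.comp (0 : V) hc
      have e := this.unique (h.hasFDerivAt_mul_left y 0)
      have := congrArg (fun L : V →L[ℝ] V => L u) e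
      simpa [leftDeriv] using this
    have e5 : HasDerivAt (fun s : ℝ => (((s • w) * y, s • (-w)) : V × V)) (leftDeriv (-y) w, -w) 0 :=
      e1.prodMk hsm'
    have hm1 : HasFDerivAt (fun p : V × V => p.1 * p.2)
        (fderiv ℝ (fun p : V × V => p.1 * p.2) (y, 0)) (((0 : ℝ) • w) * y, (0 : ℝ) • (-w)) := by
      simpa [h.zero_mul'] using hm
    have e6 := hm1.comp_hasDerivAt 0 e5
    have e7 : fderiv ℝ (fun p : V × V => p.1 * p.2) (y, 0) (leftDeriv (-y) w, -w) =
        leftDeriv (-y) w - leftDeriv y w := by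
      have : ((leftDeriv (-y) w, -w) : V × V) = (leftDeriv (-y) w, 0) + (0, -w) := by simp
      rw [this, map_add, p1, p2, map_neg, sub_eq_add_neg]
    rw [e7] at e6
    convert e6 using 1
    ext s
    simp [h.inv_eq_neg]
  -- it is linear in `y`
  have hlin : ∀ t : ℝ, leftDeriv (-(t • x)) w - leftDeriv (t • x) w =
      t • (leftDeriv (-x) w - leftDeriv x w) := by
    intro t
    refine (hK (t • x)).unique ?_
    have := (hK x).const_smul t
    convert this using 1
    ext s
    rw [Pi.smul_apply, h.conj_eq_fderiv, map_smul, ← h.conj_eq_fderiv]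
  have hd : HasDerivAt (fun t : ℝ => leftDeriv (-(t • x)) w - leftDeriv (t • x) w)
      (br w x) 0 := by
    have e1 := (h.hasDerivAt_leftDeriv_smul (-x) 0).clm_apply (hasDerivAt_const 0 w)
    have e2 := (h.hasDerivAt_leftDeriv_smul x 0).clm_apply (hasDerivAt_const 0 w)
    have e3 := e1.sub e2
    have e4 := hbr w x 0
    simp only [h.leftDeriv_zero, ContinuousLinearMap.id_apply] at e4
    rw [h.fderiv_leftDeriv_zero_antisymm w x] at e4
    simp only [zero_smul, map_neg, neg_apply, map_zero, add_zero, e4] at e3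
    simp only [smul_neg] at e3
    exact e3
  have hd' : HasDerivAt (fun t : ℝ => leftDeriv (-(t • x)) w - leftDeriv (t • x) w)
      (leftDeriv (-x) w - leftDeriv x w) 0 := by
    simp only [hlin]
    simpa using (hasDerivAt_id (0 : ℝ)).smul_const (leftDeriv (-x) w - leftDeriv x w)
  rw [hd.unique hd']
  exact hK x

end IsExpGroup

end GroupCalculus

/-! ### Generation of Lie algebras -/

section LieGeneration

variable {L : Type*} [LieRing L] [LieAlgebra ℝ L]

/-- A subspace which contains a set of generators and is stable under the brackets with these
generators is the whole Lie algebra: its normalizer is a subalgebra, so it is an ideal. -/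
theorem eq_top_of_lieSpan_eq_top {S : Set L} (hS : LieSubalgebra.lieSpan ℝ L S = ⊤)
    (U : Submodule ℝ L) (hSU : S ⊆ U) (hU : ∀ s ∈ S, ∀ u ∈ U, ⁅s, u⁆ ∈ U) : U = ⊤ := by
  let K : LieSubalgebra ℝ L :=
    { carrier := {x | ∀ u ∈ U, ⁅x, u⁆ ∈ U}
      add_mem' := fun {a b} ha hb u hu => by
        rw [add_lie]; exact U.add_mem (ha u hu) (hb u hu)
      zero_mem' := fun u _ => by rw [zero_lie]; exact U.zero_mem
      smul_mem' := fun c x hx u hu => by rw [smul_lie]; exact U.smul_mem c (hx u hu)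
      lie_mem' := fun {a b} ha hb u hu => by
        rw [lie_lie]
        exact U.sub_mem (ha _ (hb u hu)) (hb _ (ha u hu)) }
  have hK : K = ⊤ := by
    rw [eq_top_iff, ← hS, LieSubalgebra.lieSpan_le]
    exact hU
  have hK' : ∀ x u, u ∈ U → ⁅x, u⁆ ∈ U := fun x u hu => by
    have : x ∈ K := hK ▸ LieSubalgebra.mem_top x
    exact this u hu
  let U' : LieSubalgebra ℝ L := { U with lie_mem' := fun {a b} _ hb => hK' a b hb }
  have hU' : U' = ⊤ := by
    rw [eq_top_iff, ← hS, LieSubalgebra.lieSpan_le]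
    exact hSU
  rw [eq_top_iff]
  intro x _
  have : x ∈ U' := hU' ▸ LieSubalgebra.mem_top x
  exact this

/-- If the first layer generates, the Lie algebra is spanned by the eigenvectors of the derivation
with positive integer eigenvalues. -/
theorem span_eigenvectors_eq_top {D : LieDerivation ℝ L L}
    (hgen : LieSubalgebra.lieSpan ℝ L (Module.End.eigenspace D.toLinearMap (1 : ℝ) : Set L) = ⊤) :
    Submodule.span ℝ {x : L | ∃ k : ℕ, 1 ≤ k ∧ D x = (k : ℝ) • x} = ⊤ := by
  refine eq_top_of_lieSpan_eq_top hgen _ (fun x hx => ?_) fun s hs u hu => ?_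
  · refine Submodule.subset_span ⟨1, le_rfl, ?_⟩
    simpa using Module.End.mem_eigenspace_iff.1 hx
  · have hs' : D s = s := by simpa using Module.End.mem_eigenspace_iff.1 hs
    induction hu using Submodule.span_induction with
    | mem x hx =>
      obtain ⟨k, hk, hx⟩ := hx
      refine Submodule.subset_span ⟨k + 1, by omega, ?_⟩
      rw [LieDerivation.apply_lie_eq_add, hx, hs', lie_smul]
      push_cast
      module
    | zero => rw [lie_zero]; exact Submodule.zero_mem _
    | add x y _ _ hx hy => rw [lie_add]; exact Submodule.add_mem _ hx hy
    | smul a x _ hx => rw [lie_smul]; exact Submodule.smul_mem _ _ hx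

end LieGeneration

/-! ### The dilations of a stratified group -/

section Dilations

variable {V : Type*} [NormedAddCommGroup V] [NormedSpace ℝ V] [Group V]

/-- `δ s` is the automorphic dilation of a stratified group by the factor `e ^ s`, where the family
`X` spans the first layer. -/
structure IsDilation {n : ℕ} (X : Fin n → V) (δ : ℝ → V →L[ℝ] V) : Prop where
  zero : δ 0 = ContinuousLinearMap.id ℝ V
  add : ∀ s t x, δ (s + t) x = δ s (δ t x)
  map_mul : ∀ s x y, δ s (x * y) = δ s x * δ s y
  map_layer : ∀ s j, δ s (X j) = Real.exp s • X j
  tendsto : ∀ x, Filter.Tendsto (fun s => δ s x) Filter.atBot (nhds 0)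

omit [Group V] in
theorem exp_smul_apply_eigenvector [CompleteSpace V] (D : V →L[ℝ] V) {x : V} {k : ℝ}
    (hx : D x = k • x) (s : ℝ) : NormedSpace.exp (s • D) x = Real.exp (s * k) • x := by
  have h1 : ∀ t : ℝ, HasDerivAt (fun t : ℝ => Real.exp (-(t * k)) • NormedSpace.exp (t • D) x) 0 t := by
    intro t
    have e1 : HasDerivAt (fun t : ℝ => NormedSpace.exp (t • D) x)
        ((NormedSpace.exp (t • D) * D) x) t := by
      simpa using (hasDerivAt_exp_smul_const (𝕂 := ℝ) D t).clm_apply (hasDerivAt_const t x)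
    have e2 : HasDerivAt (fun t : ℝ => Real.exp (-(t * k))) (Real.exp (-(t * k)) * (-k)) t := by
      have := ((hasDerivAt_id t).mul_const k).neg.exp
      simpa using this
    refine (e2.smul e1).congr_deriv ?_
    rw [mul_apply_eq_comp, hx, map_smul]
    module
  have h2 := is_const_of_deriv_eq_zero (fun t => (h1 t).differentiableAt) (fun t => (h1 t).deriv) s 0
  simp only [zero_mul, neg_zero, Real.exp_zero, zero_smul, NormedSpace.exp_zero, one_smul] at h2
  replace h2 : Real.exp (-(s * k)) • NormedSpace.exp (s • D) x = x := h2
  conv_rhs => rw [← h2]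
  rw [smul_smul, ← Real.exp_add, add_neg_cancel, Real.exp_zero, one_smul]

omit [Group V] in
/-- The exponential of a derivation is an automorphism. -/
theorem exp_smul_map_bracket [FiniteDimensional ℝ V] [CompleteSpace V] (D : V →L[ℝ] V)
    (br : V →ₗ[ℝ] V →ₗ[ℝ] V) (hD : ∀ v w, D (br v w) = br (D v) w + br v (D w)) (s : ℝ) (v w : V) :
    NormedSpace.exp (s • D) (br v w) = br (NormedSpace.exp (s • D) v) (NormedSpace.exp (s • D) w) := by
  set B : V →L[ℝ] V →L[ℝ] V :=
    ((LinearMap.toContinuousLinearMap (𝕜 := ℝ) (E := V) (F' := V)).toLinearMap ∘ₗ br).toContinuousLinearMap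
    with hB
  have hBa : ∀ a b, B a b = br a b := fun _ _ => rfl
  have hE : ∀ x t, HasDerivAt (fun t : ℝ => NormedSpace.exp (t • D) x)
      (D (NormedSpace.exp (t • D) x)) t := by
    intro x t
    simpa using (hasDerivAt_exp_smul_const' (𝕂 := ℝ) D t).clm_apply (hasDerivAt_const t x)
  have key : (fun t : ℝ => NormedSpace.exp (t • D) (br v w)) =
      fun t : ℝ => B (NormedSpace.exp (t • D) v) (NormedSpace.exp (t • D) w) := by
    refine ODE_solution_unique_univ (v := fun _ w => D w) (s := fun _ => univ)
      (K := ‖D‖₊) (t₀ := 0) (fun t => D.lipschitz.lipschitzOnWith) (fun t => ⟨hE _ t, mem_univ _⟩)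
      (fun t => ⟨?_, mem_univ _⟩) ?_
    · have h1 := B.hasFDerivAt.comp_hasDerivAt t (hE v t)
      refine (h1.clm_apply (hE w t)).congr_deriv ?_
      simp only [hBa, hD, Function.comp_apply]
    · simp [NormedSpace.exp_zero, hBa]
  exact congrFun key s

/-- The dilations `exp (s D)` exist as soon as the eigenvectors of the derivation `D` with positive
integer eigenvalues span. -/
theorem isDilation_exp [FiniteDimensional ℝ V] [CompleteSpace V] (h : IsExpGroup V)
    {br : V →ₗ[ℝ] V →ₗ[ℝ] V} (hbr : IsInvariantBracket br) {D : V →L[ℝ] V}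
    (hD : ∀ v w, D (br v w) = br (D v) w + br v (D w)) {n : ℕ} {X : Fin n → V}
    (hX : ∀ j, D (X j) = X j)
    (hspan : Submodule.span ℝ {x : V | ∃ k : ℕ, 1 ≤ k ∧ D x = (k : ℝ) • x} = ⊤) :
    IsDilation X fun s => NormedSpace.exp (s • D) where
  zero := by simp only [zero_smul, NormedSpace.exp_zero]; rfl
  add s t x := by
    have hc : Commute (s • D) (t • D) := ((Commute.refl D).smul_left s).smul_right t
    let : NormedAlgebra ℚ (V →L[ℝ] V) := NormedAlgebra.restrictScalars ℚ ℝ (V →L[ℝ] V)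
    rw [add_smul, NormedSpace.exp_add_of_commute hc]
    rfl
  map_mul s x y := h.map_mul_of_map_bracket hbr (exp_smul_map_bracket D br hD s) x y
  map_layer s j := by
    have := exp_smul_apply_eigenvector D (k := 1) (x := X j) (by simp [hX]) s
    simpa using this
  tendsto x := by
    have hx : x ∈ Submodule.span ℝ {x : V | ∃ k : ℕ, 1 ≤ k ∧ D x = (k : ℝ) • x} :=
      hspan ▸ Submodule.mem_top
    induction hx using Submodule.span_induction with
    | mem x hx =>
      obtain ⟨k, hk, hx⟩ := hx
      simp only [exp_smul_apply_eigenvector D hx]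
      rw [← zero_smul ℝ x]
      refine Filter.Tendsto.smul_const (Real.tendsto_exp_atBot.comp ?_) x
      exact Filter.tendsto_id.atBot_mul_const (by exact_mod_cast hk)
    | zero => simp
    | add x y _ _ hx hy => simpa using hx.add hy
    | smul a x _ hx => simpa using hx.const_smul a

end Dilations

/-! ### The Lie algebra of Mathlib in exponential coordinates -/

section LieGroup

variable {V : Type*} [NormedAddCommGroup V] [NormedSpace ℝ V] [FiniteDimensional ℝ V]
  [CompleteSpace V] [Group V] [LieGroup 𝓘(ℝ, V) ∞ V]

omit [FiniteDimensional ℝ V] [CompleteSpace V] in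
theorem isExpGroup_of_lieGroup (hexp : ∀ (s t : ℝ) (x : V), (s • x) * (t • x) = (s + t) • x) :
    IsExpGroup V where
  contDiff_mul := by
    have h := contMDiff_mul 𝓘(ℝ, V) ∞ (G := V)
    rw [← modelWithCornersSelf_prod, chartedSpaceSelf_prod] at h
    exact h.contDiff
  smul_mul_smul := hexp

omit [FiniteDimensional ℝ V] [CompleteSpace V] [LieGroup 𝓘(ℝ, V) ∞ V] in
theorem mulInvariantVectorField_eq_leftDeriv (h : IsExpGroup V) (v : GroupLieAlgebra 𝓘(ℝ, V) V)
    (p : V) : mulInvariantVectorField (I := 𝓘(ℝ, V)) v p = leftDeriv p v := by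
  rw [mulInvariantVectorField, mfderiv_eq_fderiv, leftDeriv, h.one_eq_zero]
  rfl

variable (V) in
/-- The Lie bracket of the Lie algebra of `V`, as a bilinear map on `V`. -/
noncomputable def bracketMap : V →ₗ[ℝ] V →ₗ[ℝ] V :=
  LinearMap.mk₂ ℝ (fun v w : V =>
      @Bracket.bracket (GroupLieAlgebra 𝓘(ℝ, V) V) (GroupLieAlgebra 𝓘(ℝ, V) V) _ v w)
    (add_lie (L := GroupLieAlgebra 𝓘(ℝ, V) V) (M := GroupLieAlgebra 𝓘(ℝ, V) V))
    (smul_lie (R := ℝ) (L := GroupLieAlgebra 𝓘(ℝ, V) V) (M := GroupLieAlgebra 𝓘(ℝ, V) V))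
    (lie_add (L := GroupLieAlgebra 𝓘(ℝ, V) V) (M := GroupLieAlgebra 𝓘(ℝ, V) V))
    (fun c v w => lie_smul (R := ℝ) (L := GroupLieAlgebra 𝓘(ℝ, V) V)
      (M := GroupLieAlgebra 𝓘(ℝ, V) V) c v w)

theorem mlieBracket_self_apply {E : Type*} [NormedAddCommGroup E] [NormedSpace ℝ E]
    (f g : Π x : E, TangentSpace 𝓘(ℝ, E) x) (p : E) : VectorField.mlieBracket 𝓘(ℝ, E) f g p =
      fderiv ℝ (fun x => (g x : E)) p (f p) - fderiv ℝ (fun x => (f x : E)) p (g p) := by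
  rw [← VectorField.mlieBracketWithin_univ, VectorField.mlieBracketWithin_eq_lieBracketWithin]
  exact congrFun (VectorField.lieBracketWithin_univ.trans VectorField.lieBracket_eq) p

omit [FiniteDimensional ℝ V] in
theorem isInvariantBracket_bracketMap (h : IsExpGroup V) : IsInvariantBracket (bracketMap V) := by
  intro v w p
  have e1 : ∀ u : V, (mulInvariantVectorField (I := 𝓘(ℝ, V)) (G := V) u : V → V) =
      fun p => leftDeriv p u := fun u => funext fun p => mulInvariantVectorField_eq_leftDeriv h u p
  have h1 := congrFun (mulInvariantVector_mlieBracket (I := 𝓘(ℝ, V)) (G := V) v w) p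
  have h2 : leftDeriv p (bracketMap V v w) =
      VectorField.mlieBracket 𝓘(ℝ, V) (fun p : V => leftDeriv p v) (fun p : V => leftDeriv p w) p :=
    (mulInvariantVectorField_eq_leftDeriv h _ p).symm.trans (h1.trans
      (congrArg₂ (fun f g : V → V => VectorField.mlieBracket 𝓘(ℝ, V) f g p) (e1 v) (e1 w)))
  have e2 : ∀ u z : V, fderiv ℝ (fun p => leftDeriv p u) p z =
      fderiv ℝ (leftDeriv : V → V →L[ℝ] V) p z u := by
    intro u z
    have := ((h.hasFDerivAt_leftDeriv p).clm_apply (hasFDerivAt_const u p)).fderiv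
    rw [this]; simp
  have h3 := mlieBracket_self_apply (fun p : V => leftDeriv p v) (fun p : V => leftDeriv p w) p
  rw [e2, e2] at h3
  exact h3.symm.trans h2.symm

end LieGroup

/-! ### The Carnot–Carathéodory distance of a stratified group -/

section StratifiedDistance

variable {V : Type*} [NormedAddCommGroup V] [NormedSpace ℝ V] [Group V]

/-- The left-invariant frame determined by the vectors `X j`. -/
noncomputable def leftFrame {n : ℕ} (X : Fin n → V) : Fin n → V → V := fun j p => leftDeriv p (X j)

variable {n : ℕ} {X : Fin n → V}

section Invariance

variable [FiniteDimensional ℝ V]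

theorem IsExpGroup.ccDist_mul_left (h : IsExpGroup V) (g p q : V) :
    ccDist (leftFrame X) (g * p) (g * q) = ccDist (leftFrame X) p q := by
  have key : ∀ g p q : V, ccDist (leftFrame X) (g * p) (g * q) ≤ ccDist (leftFrame X) p q := by
    intro g p q
    have := ccDist_map_le (F := leftFrame X) (F' := leftFrame X)
      ((h.contDiff_mul_left g).of_le (by simp)) one_ne_zero
      (fun j x => by rw [one_smul]; exact h.fderiv_mul_left g x (X j)) p q
    simpa using this
  refine le_antisymm (key g p q) ?_
  simpa using key g⁻¹ (g * p) (g * q)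

theorem IsExpGroup.ccDist_zero_mul_le (h : IsExpGroup V) (x y : V) :
    ccDist (leftFrame X) 0 (x * y) ≤ ccDist (leftFrame X) 0 x + ccDist (leftFrame X) 0 y := by
  refine (ccDist_triangle 0 x _).trans (add_le_add le_rfl ?_)
  conv_lhs => rw [← h.mul_zero' x, mul_assoc, h.ccDist_mul_left, h.zero_mul']

theorem IsExpGroup.ccDist_zero_inv (h : IsExpGroup V) (x : V) :
    ccDist (leftFrame X) 0 x⁻¹ = ccDist (leftFrame X) 0 x := by
  rw [← h.ccDist_mul_left x, mul_inv_cancel, h.mul_zero', h.one_eq_zero, ccDist_comm]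

theorem IsExpGroup.ccDist_eq (h : IsExpGroup V) (x y : V) :
    ccDist (leftFrame X) x y = ccDist (leftFrame X) 0 (x⁻¹ * y) := by
  rw [← h.ccDist_mul_left x⁻¹, inv_mul_cancel, h.one_eq_zero]

omit [FiniteDimensional ℝ V] in
theorem IsExpGroup.ccDist_zero_smul_le (h : IsExpGroup V) (t : ℝ) (j : Fin n) :
    ccDist (leftFrame X) 0 (t • X j) ≤ ‖t‖ₑ := by
  have hc : IsHorizontalCurve (leftFrame X) 0 1 (fun s => s • (t • X j))
      (fun _ => t • EuclideanSpace.single j 1) :=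
    { le := zero_le_one
      absolutelyContinuous := ContDiffOn.absolutelyContinuousOnInterval
        (contDiff_id.smul contDiff_const).contDiffOn
      deriv := by
        refine .of_forall fun s _ => ?_
        have h1 : HasDerivAt (fun s : ℝ => s • (t • X j)) (t • X j) s := by
          simpa using (hasDerivAt_id s).smul_const (t • X j)
        refine h1.congr_deriv ?_
        rw [Finset.sum_eq_single j]
        · simp only [PiLp.smul_apply, PiLp.single_apply, if_true, smul_eq_mul, mul_one, leftFrame]
          rw [← map_smul, h.leftDeriv_smul_self s (t • X j)]
        · intro i _ hij
          simp [hij]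
        · simp }
  have := hc.ccDist_le
  have e : ‖EuclideanSpace.single j (1 : ℝ)‖ₑ = 1 := by
    rw [← ofReal_norm, PiLp.norm_single]; simp
  simpa [enorm_smul, e] using this

omit [FiniteDimensional ℝ V] in
theorem IsDilation.map_leftDeriv (h : IsExpGroup V) {δ : ℝ → V →L[ℝ] V} (hδ : IsDilation X δ) (s : ℝ)
    (p v : V) : δ s (leftDeriv p v) = leftDeriv (δ s p) (δ s v) := by
  have h1 := (δ s).hasFDerivAt.comp (0 : V) (h.hasFDerivAt_mul_left p 0)
  have h0 : HasFDerivAt (fun y => δ s p * y) (leftDeriv (δ s p)) (δ s 0) := by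
    rw [map_zero]; exact h.hasFDerivAt_mul_left _ _
  have h2 := h0.comp (0 : V) (δ s).hasFDerivAt
  have e : (δ s) ∘ (fun y => p * y) = (fun y => δ s p * y) ∘ (δ s) := by
    ext y; simp [hδ.map_mul]
  rw [e] at h1
  exact congrArg (fun L : V →L[ℝ] V => L v) (h1.unique h2)

theorem IsDilation.ccDist_map (h : IsExpGroup V) {δ : ℝ → V →L[ℝ] V} (hδ : IsDilation X δ) (s : ℝ)
    (p q : V) : ccDist (leftFrame X) (δ s p) (δ s q) =
      ENNReal.ofReal (Real.exp s) * ccDist (leftFrame X) p q := by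
  have key : ∀ s p q, ccDist (leftFrame X) (δ s p) (δ s q) ≤
      ENNReal.ofReal (Real.exp s) * ccDist (leftFrame X) p q := by
    intro s p q
    have := ccDist_map_le (F := leftFrame X) (F' := leftFrame X) (δ s).contDiff (Real.exp_ne_zero s)
      (fun j x => by
        rw [ContinuousLinearMap.fderiv, leftFrame, hδ.map_leftDeriv h, hδ.map_layer, map_smul]
        rfl) p q
    rwa [Real.enorm_of_nonneg (Real.exp_pos s).le] at this
  refine le_antisymm (key s p q) ?_
  have h1 := key (-s) (δ s p) (δ s q)
  have h2 : ∀ x, δ (-s) (δ s x) = x := by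
    intro x
    rw [← hδ.add, neg_add_cancel, hδ.zero]
    rfl
  rw [h2, h2] at h1
  calc _ ≤ ENNReal.ofReal (Real.exp s) * (ENNReal.ofReal (Real.exp (-s)) *
        ccDist (leftFrame X) (δ s p) (δ s q)) := by gcongr
    _ = _ := by
      rw [← mul_assoc, ← ENNReal.ofReal_mul (Real.exp_pos s).le, ← Real.exp_add, add_neg_cancel,
        Real.exp_zero, ENNReal.ofReal_one, one_mul]

end Invariance

section Chow

variable [FiniteDimensional ℝ V]

omit [FiniteDimensional ℝ V] in
/-- The derivative at `0` of the map `v ↦ ∏ (c_i(v) • b_i)`. If `b` is a basis and the `c_i` are its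
coordinate functionals, then this derivative is the identity. -/
theorem IsExpGroup.hasStrictFDerivAt_prod (h : IsExpGroup V) {ι : Type*} (b : ι → V)
    (c : ι → V →L[ℝ] ℝ) (l : List ι) :
    HasStrictFDerivAt (fun v : V => (l.map fun i => c i v • b i).prod)
      (l.map fun i => (c i).smulRight (b i)).sum 0 := by
  induction l with
  | nil => simpa using hasStrictFDerivAt_const (1 : V) (0 : V)
  | cons i l ih =>
    have hm : HasStrictFDerivAt (fun p : V × V => p.1 * p.2)
        (ContinuousLinearMap.fst ℝ V V + ContinuousLinearMap.snd ℝ V V) ((0, 0) : V × V) := by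
      have h1 := (h.contDiff_mul.contDiffAt (x := ((0, 0) : V × V))).hasStrictFDerivAt (by simp)
      have h2 : fderiv ℝ (fun p : V × V => p.1 * p.2) (0, 0) =
          ContinuousLinearMap.fst ℝ V V + ContinuousLinearMap.snd ℝ V V := by
        have e1 := HasFDerivAt.comp (0 : V) (f := fun e : V => (e, (0 : V))) h1.hasFDerivAt
            (hasFDerivAt_prodMk_left (0 : V) (0 : V))
        have e2 := HasFDerivAt.comp (0 : V) (f := fun e : V => ((0 : V), e)) h1.hasFDerivAt
            (hasFDerivAt_prodMk_right (0 : V) (0 : V))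
        have e3 : (fun p : V × V => p.1 * p.2) ∘ (fun e => (e, 0)) = id := by
          ext x; simp [h.mul_zero']
        have e4 : (fun p : V × V => p.1 * p.2) ∘ (fun e => (0, e)) = id := by
          ext x; simp [h.zero_mul']
        rw [e3] at e1
        rw [e4] at e2
        have e5 := e1.unique (hasFDerivAt_id _)
        have e6 := e2.unique (hasFDerivAt_id _)
        refine ContinuousLinearMap.ext fun x => ?_
        have e7 := congrArg (fun L : V →L[ℝ] V => L x.1) e5
        have e8 := congrArg (fun L : V →L[ℝ] V => L x.2) e6
        simp only [ContinuousLinearMap.comp_apply, ContinuousLinearMap.inl_apply,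
          ContinuousLinearMap.inr_apply, ContinuousLinearMap.id_apply] at e7 e8
        have e9 : x = (x.1, 0) + (0, x.2) := by simp
        rw [e9, map_add, e7, e8]
        simp
      rwa [h2] at h1
    have hl0 : (l.map fun i => c i 0 • b i).prod = 0 := by
      have : (l.map fun i => c i 0 • b i) = l.map fun _ => (1 : V) := by
        simp [h.one_eq_zero]
      rw [this, List.map_const', List.prod_replicate, one_pow, h.one_eq_zero]
    have hi : HasStrictFDerivAt (fun v : V => c i v • b i) ((c i).smulRight (b i)) 0 :=
      ((c i).smulRight (b i)).hasStrictFDerivAt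
    have hm' : HasStrictFDerivAt (fun p : V × V => p.1 * p.2)
        (ContinuousLinearMap.fst ℝ V V + ContinuousLinearMap.snd ℝ V V)
        (c i 0 • b i, (l.map fun i => c i 0 • b i).prod) := by
      rw [hl0, map_zero, zero_smul]; exact hm
    have h3 := hm'.comp (0 : V) (hi.prodMk ih)
    simp only [List.map_cons, List.prod_cons, List.sum_cons]
    exact h3.congr_fderiv (ContinuousLinearMap.ext fun x => by simp)

/-- The distance from the identity is bounded near the identity. The conjugates of the `X j` by
points at finite distance span `V`, because their span is stable under the brackets with the `X j`.
A basis chosen among them gives, by multiplication, a chart near the identity whose points are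
products of boundedly many horizontal segments. -/
theorem IsExpGroup.ccDist_bounded_near_zero (h : IsExpGroup V) {br : V →ₗ[ℝ] V →ₗ[ℝ] V}
    (hbr : IsInvariantBracket br)
    (hgen : ∀ U : Submodule ℝ V, (∀ j, X j ∈ U) → (∀ j, ∀ u ∈ U, br (X j) u ∈ U) → U = ⊤) :
    ∃ C : ℝ≥0∞, C ≠ ⊤ ∧ ∀ᶠ z in nhds (0 : V), ccDist (leftFrame X) 0 z ≤ C := by
  set ρ : V → ℝ≥0∞ := ccDist (leftFrame X) 0 with hρ
  -- the conjugates of the `X j` by points at finite distance span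
  set S : Set V := {x | ∃ g j, ρ g ≠ ⊤ ∧ x = g * X j * g⁻¹} with hS
  have hspan : Submodule.span ℝ S = ⊤ := by
    refine hgen _ (fun j => Submodule.subset_span ⟨1, j, ?_, by simp⟩) fun j u hu => ?_
    · rw [hρ, h.one_eq_zero, ccDist_self]; exact ENNReal.zero_ne_top
    · have h1 : ∀ s : ℝ, (s • X j) * u * (s • X j)⁻¹ ∈ Submodule.span ℝ S := by
        intro s
        rw [h.conj_eq_fderiv]
        induction hu using Submodule.span_induction with
        | mem x hx =>
          obtain ⟨g, i, hg, rfl⟩ := hx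
          rw [← h.conj_eq_fderiv]
          refine Submodule.subset_span ⟨(s • X j) * g, i, ?_, by group⟩
          exact ne_top_of_le_ne_top (ENNReal.add_ne_top.2
            ⟨ne_top_of_le_ne_top enorm_ne_top (h.ccDist_zero_smul_le s j), hg⟩)
            (h.ccDist_zero_mul_le _ _)
        | zero => rw [map_zero]; exact Submodule.zero_mem _
        | add x y _ _ hx hy => rw [map_add]; exact Submodule.add_mem _ hx hy
        | smul a x _ hx => rw [map_smul]; exact Submodule.smul_mem _ _ hx
      have h2 := h.hasDerivAt_conj hbr (X j) u
      have hcl : IsClosed (Submodule.span ℝ S : Set V) := Submodule.closed_of_finiteDimensional _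
      rw [hasDerivAt_iff_tendsto_slope] at h2
      refine hcl.mem_of_tendsto h2 (.of_forall fun s => ?_)
      rw [slope_def_module]
      exact Submodule.smul_mem _ _ (Submodule.sub_mem _ (h1 s) (h1 0))
  -- choose a basis among them
  obtain ⟨ι, b, hbS⟩ : ∃ (ι : Type _) (b : Module.Basis ι ℝ V), ∀ i, b i ∈ S :=
    ⟨_, Module.Basis.ofSpan (K := ℝ) hspan.ge, fun i => Module.Basis.ofSpan_subset hspan.ge ⟨i, rfl⟩⟩
  have : Fintype ι := FiniteDimensional.fintypeBasisIndex b
  -- `ρ` is bounded on the segments spanned by the basis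
  have hseg : ∀ i, ∃ C : ℝ≥0∞, C ≠ ⊤ ∧ ∀ t : ℝ, |t| ≤ 1 → ρ (t • b i) ≤ C := by
    intro i
    obtain ⟨g, j, hg, hi⟩ := hbS i
    refine ⟨ρ g + 1 + ρ g, by simp [hg], fun t ht => ?_⟩
    rw [hi, h.conj_eq_fderiv, ← map_smul, ← h.conj_eq_fderiv]
    refine (h.ccDist_zero_mul_le _ _).trans (add_le_add ((h.ccDist_zero_mul_le _ _).trans
      (add_le_add le_rfl ((h.ccDist_zero_smul_le _ _).trans ?_))) (h.ccDist_zero_inv g).le)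
    rw [Real.enorm_eq_ofReal_abs]
    exact ENNReal.ofReal_le_one.2 ht
  choose C hC hCt using hseg
  set l := (Finset.univ : Finset ι).toList with hl
  refine ⟨(l.map C).sum, ?_, ?_⟩
  · rw [hl, Finset.sum_map_toList]
    exact ENNReal.sum_ne_top.2 fun i _ => hC i
  let c : ι → V →L[ℝ] ℝ := fun i => LinearMap.toContinuousLinearMap (b.coord i)
  have hd := h.hasStrictFDerivAt_prod b c l
  have hid : (l.map fun i => (c i).smulRight (b i)).sum = ContinuousLinearMap.id ℝ V := by
    rw [hl, Finset.sum_map_toList]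
    refine ContinuousLinearMap.ext fun x => ?_
    rw [sum_apply]
    exact b.sum_repr x
  rw [hid] at hd
  have hmap := hd.map_nhds_eq_of_surj (by exact LinearMap.range_id)
  have hF0 : (l.map fun i => c i 0 • b i).prod = 0 := by
    have : (l.map fun i => c i 0 • b i) = l.map fun _ => (1 : V) := by simp [h.one_eq_zero]
    rw [this, List.map_const', List.prod_replicate, one_pow, h.one_eq_zero]
  rw [hF0] at hmap
  rw [← hmap, Filter.eventually_map]
  have hsmall : ∀ i, ∀ᶠ v in nhds (0 : V), |c i v| ≤ 1 := by
    intro i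
    have : Filter.Tendsto (fun v => |c i v|) (nhds 0) (nhds 0) := by
      have := (c i).continuous.abs.tendsto 0
      simpa using this
    exact this.eventually_le_const one_pos
  filter_upwards [Filter.eventually_all.2 hsmall] with v hv
  have hlist : ∀ l : List ι, ρ (l.map fun i => c i v • b i).prod ≤ (l.map C).sum := by
    intro l
    induction l with
    | nil => simp [hρ, h.one_eq_zero, ccDist_self]
    | cons i l ih =>
      simp only [List.map_cons, List.prod_cons, List.sum_cons]
      exact (h.ccDist_zero_mul_le _ _).trans (add_le_add (hCt i _ (hv i)) ih)
  exact hlist l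

/-- **Chow's theorem** for stratified groups: the distance from the identity is continuous there,
since the dilations turn its local boundedness into smallness. -/
theorem IsDilation.tendsto_ccDist (h : IsExpGroup V) {δ : ℝ → V →L[ℝ] V} (hδ : IsDilation X δ)
    {C : ℝ≥0∞} (hC : C ≠ ⊤) (hbd : ∀ᶠ z in nhds (0 : V), ccDist (leftFrame X) 0 z ≤ C) :
    Filter.Tendsto (ccDist (leftFrame X) 0) (nhds 0) (nhds 0) := by
  rw [ENNReal.tendsto_nhds_zero]
  intro ε hε
  have h1 : Filter.Tendsto (fun s => ENNReal.ofReal (Real.exp s) * C) Filter.atBot (nhds 0) := by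
    have := ENNReal.Tendsto.mul_const (b := C)
      (ENNReal.tendsto_ofReal Real.tendsto_exp_atBot) (Or.inr hC)
    simpa using this
  obtain ⟨s, hs⟩ := ((ENNReal.tendsto_nhds_zero.1 h1) ε hε).exists
  have h2 : Filter.Tendsto (δ (-s)) (nhds 0) (nhds 0) := by
    have := (δ (-s)).continuous.tendsto 0
    rwa [map_zero] at this
  filter_upwards [h2.eventually hbd] with z hz
  have h3 := hδ.ccDist_map h s 0 (δ (-s) z)
  have h4 : δ s (δ (-s) z) = z := by
    rw [← hδ.add, add_neg_cancel, hδ.zero]; rfl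
  rw [map_zero, h4] at h3
  rw [h3]
  exact (mul_le_mul_right hz _).trans hs

theorem IsDilation.ccDist_ne_top (h : IsExpGroup V) {δ : ℝ → V →L[ℝ] V} (hδ : IsDilation X δ)
    (hlim : Filter.Tendsto (ccDist (leftFrame X) 0) (nhds 0) (nhds 0)) (x y : V) :
    ccDist (leftFrame X) x y ≠ ⊤ := by
  rw [h.ccDist_eq]
  set z := x⁻¹ * y
  obtain ⟨s, hs⟩ := ((hδ.tendsto z).eventually
    ((ENNReal.tendsto_nhds_zero.1 hlim) 1 one_pos)).exists
  have h3 := hδ.ccDist_map h s 0 z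
  rw [map_zero] at h3
  rw [h3] at hs
  intro htop
  rw [htop, ENNReal.mul_top (by simpa using Real.exp_pos s)] at hs
  exact absurd hs (by simp)

/-- The norm is locally controlled by the Carnot–Carathéodory distance, since the vector fields of the
frame are bounded on the unit ball. -/
theorem IsExpGroup.exists_min_norm_le (h : IsExpGroup V) (X : Fin n → V) :
    ∃ K : ℝ, 0 < K ∧ ∀ z : V,
      ENNReal.ofReal (min ‖z‖ 1) ≤ ENNReal.ofReal K * ccDist (leftFrame X) 0 z := by
  have hcont : ∀ j, Continuous fun p : V => leftDeriv p (X j) := fun j =>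
    h.contDiff_leftDeriv.continuous.clm_apply continuous_const
  have hb : ∀ j, ∃ K, ∀ p ∈ Metric.closedBall (0 : V) 1, ‖leftDeriv p (X j)‖ ≤ K := fun j =>
    (isCompact_closedBall (0 : V) 1).exists_bound_of_continuousOn (hcont j).continuousOn
  choose K hK using hb
  have hK0 : ∀ j, 0 ≤ K j := fun j => (norm_nonneg _).trans (hK j 0 (by simp))
  have hpos : 0 < ∑ j, K j + 1 := by
    have := Finset.sum_nonneg fun j (_ : j ∈ Finset.univ) => hK0 j
    linarith
  refine ⟨∑ j, K j + 1, hpos, fun z => ?_⟩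
  set K₀ := ∑ j, K j + 1
  rw [mul_comm, ← ENNReal.div_le_iff (by simpa using hpos) ENNReal.ofReal_ne_top]
  refine le_of_forall_gt fun L hL => ?_
  obtain ⟨a, b, γ, c, hγ, ha, hb, hlen⟩ := exists_curve_of_ccDist_lt hL
  refine lt_of_le_of_lt ?_ hlen
  rw [ENNReal.div_le_iff (by simpa using hpos) ENNReal.ofReal_ne_top, mul_comm]
  set ρ := min ‖z‖ 1 with hρ
  have hab := hγ.le
  have hγc : ContinuousOn γ (Icc a b) := by
    have := hγ.absolutelyContinuous.continuousOn
    rwa [uIcc_of_le hab] at this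
  -- the first time at which the curve reaches the sphere of radius `ρ`
  set T : Set ℝ := {t | t ∈ Icc a b ∧ ρ ≤ ‖γ t‖} with hT
  have hTne : T.Nonempty := ⟨b, right_mem_Icc.2 hab, by rw [hb]; exact min_le_left _ _⟩
  have hTcl : IsClosed T := by
    have := hγc.norm.preimage_isClosed_of_isClosed isClosed_Icc (isClosed_Ici (a := ρ))
    exact this
  have hTbdd : BddBelow T := ⟨a, fun t ht => ht.1.1⟩
  set t₁ := sInf T with ht₁
  have ht₁T : t₁ ∈ T := hTcl.csInf_mem hTne hTbdd
  have hbefore : ∀ t ∈ Icc a b, t < t₁ → ‖γ t‖ ≤ 1 := by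
    intro t ht htt
    by_contra hcon
    refine (not_le.2 htt) (csInf_le hTbdd ⟨ht, ?_⟩)
    exact (min_le_right _ _).trans (not_le.1 hcon).le
  have hac : AbsolutelyContinuousOnInterval γ a t₁ :=
    hγ.absolutelyContinuous.mono (by
      rw [uIcc_of_le hab, uIcc_of_le ht₁T.1.1]; exact Icc_subset_Icc_right ht₁T.1.2)
  have hsub : Icc a t₁ ⊆ Icc a b := Icc_subset_Icc_right ht₁T.1.2
  have h1 := hac.enorm_sub_le_lintegral ht₁T.1.1 (hγ.deriv.mono fun t ht hm => ht (hsub hm))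
  rw [ha, sub_zero] at h1
  have h2 : ENNReal.ofReal ρ ≤ ‖γ t₁‖ₑ := by
    rw [← ofReal_norm]; exact ENNReal.ofReal_le_ofReal ht₁T.2
  refine h2.trans (h1.trans ?_)
  rw [← lintegral_const_mul' _ _ ENNReal.ofReal_ne_top]
  refine le_trans ?_ (lintegral_mono_set hsub)
  refine lintegral_mono_ae ?_
  rw [ae_restrict_iff' measurableSet_Icc]
  filter_upwards [Measure.ae_ne volume t₁] with t hne hmem
  have hball : γ t ∈ Metric.closedBall (0 : V) 1 := by
    rw [mem_closedBall_zero_iff]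
    exact hbefore t (hsub hmem) (lt_of_le_of_ne hmem.2 hne)
  rw [← ofReal_norm, ← ofReal_norm, ← ENNReal.ofReal_mul hpos.le]
  refine ENNReal.ofReal_le_ofReal ?_
  calc ‖∑ j, c t j • leftFrame X j (γ t)‖ ≤ ∑ j, ‖c t j • leftFrame X j (γ t)‖ := norm_sum_le _ _
    _ ≤ ∑ j, K j * ‖c t‖ := by
        refine Finset.sum_le_sum fun j _ => ?_
        rw [norm_smul, mul_comm]
        exact mul_le_mul (hK j _ hball) (PiLp.norm_apply_le _ _) (norm_nonneg _) (hK0 j)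
    _ = (∑ j, K j) * ‖c t‖ := by rw [Finset.sum_mul]
    _ ≤ K₀ * ‖c t‖ := by
        gcongr
        exact le_add_of_nonneg_right zero_le_one

end Chow

end StratifiedDistance

/-! ### Haar measure of the balls -/

/-- The properties of the Carnot–Carathéodory distance and of the Haar measure of a stratified group
on which the rest of the argument depends: `d` is a metric which induces the topology, and the
measure of a ball is finite, positive, independent of the center, and is multiplied by a constant
when the radius is. -/
structure IsHomogeneousDist {V : Type*} [TopologicalSpace V] [MeasurableSpace V]
    (d : V → V → ℝ≥0∞) (ν : Measure V) : Prop where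
  ne_top : ∀ x y, d x y ≠ ⊤
  eq_zero_iff : ∀ x y, d x y = 0 ↔ x = y
  symm : ∀ x y, d x y = d y x
  triangle : ∀ x y z, d x z ≤ d x y + d y z
  ball_mem_nhds : ∀ x r, 0 < r → distBall d x r ∈ nhds x
  exists_ball_subset : ∀ x, ∀ U ∈ nhds x, ∃ r, 0 < r ∧ distBall d x r ⊆ U
  measure_ball_eq : ∀ x y r, ν (distBall d x r) = ν (distBall d y r)
  measure_ball_ne_zero : ∀ x r, 0 < r → ν (distBall d x r) ≠ 0
  measure_ball_ne_top : ∀ x r, ν (distBall d x r) ≠ ⊤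
  measure_ball_mul : ∀ m : ℝ, 0 < m → ∃ C : ℝ≥0∞, C ≠ ⊤ ∧ ∀ x r, 0 < r →
    ν (distBall d x (m * r)) = C * ν (distBall d x r)

section BallMeasure

variable {V : Type*} [NormedAddCommGroup V] [NormedSpace ℝ V] [Group V]
  {n : ℕ} {X : Fin n → V} [FiniteDimensional ℝ V]

omit [FiniteDimensional ℝ V] in
theorem IsDilation.neg_apply_apply {δ : ℝ → V →L[ℝ] V} (hδ : IsDilation X δ) (s : ℝ) (x : V) :
    δ (-s) (δ s x) = x := by
  rw [← hδ.add, neg_add_cancel, hδ.zero]; rfl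

omit [FiniteDimensional ℝ V] in
theorem IsDilation.apply_neg_apply {δ : ℝ → V →L[ℝ] V} (hδ : IsDilation X δ) (s : ℝ) (x : V) :
    δ s (δ (-s) x) = x := by
  rw [← hδ.add, add_neg_cancel, hδ.zero]; rfl

omit [FiniteDimensional ℝ V] in
theorem IsDilation.det_ne_zero {δ : ℝ → V →L[ℝ] V} (hδ : IsDilation X δ) (s : ℝ) :
    (δ s).det ≠ 0 := by
  have h1 : (δ (-s)).comp (δ s) = ContinuousLinearMap.id ℝ V :=
    ContinuousLinearMap.ext fun x => hδ.neg_apply_apply s x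
  have h2 : (δ (-s)).det * (δ s).det = 1 := by
    have := congrArg ContinuousLinearMap.det h1
    simpa [ContinuousLinearMap.det, LinearMap.det_comp] using this
  exact right_ne_zero_of_mul_eq_one h2

omit [FiniteDimensional ℝ V] in
/-- Left translations have Jacobian determinant one: it is invariant under the dilations, which
contract to the identity element. -/
theorem IsDilation.det_leftDeriv (h : IsExpGroup V) {δ : ℝ → V →L[ℝ] V} (hδ : IsDilation X δ)
    (p : V) : (leftDeriv p).det = 1 := by
  have h1 : ∀ s, (leftDeriv (δ s p)).det = (leftDeriv p).det := by
    intro s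
    have h2 : (δ s).comp (leftDeriv p) = (leftDeriv (δ s p)).comp (δ s) :=
      ContinuousLinearMap.ext fun v => hδ.map_leftDeriv h s p v
    have h3 := congrArg ContinuousLinearMap.det h2
    simp only [ContinuousLinearMap.det, ContinuousLinearMap.toLinearMap_comp, LinearMap.det_comp] at h3
    rw [mul_comm] at h3
    exact (mul_right_cancel₀ (hδ.det_ne_zero s) h3).symm
  have h2 : Filter.Tendsto (fun s => (leftDeriv (δ s p)).det) Filter.atBot (nhds 1) := by
    have h3 : Continuous fun q : V => (leftDeriv q).det :=
      ContinuousLinearMap.continuous_det.comp h.contDiff_leftDeriv.continuous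
    have h4 := (h3.tendsto 0).comp (hδ.tendsto p)
    have h5 : (leftDeriv (0 : V)).det = 1 := by
      rw [h.leftDeriv_zero]; exact LinearMap.det_id
    rw [h5] at h4
    exact h4
  simp only [h1] at h2
  exact tendsto_nhds_unique tendsto_const_nhds h2

omit [FiniteDimensional ℝ V] in
theorem IsDilation.det_fderiv_mul_left (h : IsExpGroup V) {δ : ℝ → V →L[ℝ] V}
    (hδ : IsDilation X δ) (p x : V) : (fderiv ℝ (fun y => p * y) x).det = 1 := by
  have h1 : (fderiv ℝ (fun y => p * y) x).comp (leftDeriv x) = leftDeriv (p * x) :=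
    ContinuousLinearMap.ext fun v => h.fderiv_mul_left p x v
  have h2 := congrArg ContinuousLinearMap.det h1
  have h3 := hδ.det_leftDeriv h x
  have h4 := hδ.det_leftDeriv h (p * x)
  simp only [ContinuousLinearMap.det, ContinuousLinearMap.toLinearMap_comp, LinearMap.det_comp] at h2 h3 h4 ⊢
  rwa [h3, h4, mul_one] at h2

variable [MeasurableSpace V] [BorelSpace V] (ν : Measure V) [ν.IsAddHaarMeasure]

theorem IsDilation.measure_mul_left_image (h : IsExpGroup V) {δ : ℝ → V →L[ℝ] V}
    (hδ : IsDilation X δ) (p : V) {s : Set V} (hs : MeasurableSet s) :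
    ν ((fun y => p * y) '' s) = ν s := by
  rw [← lintegral_abs_det_fderiv_eq_addHaar_image ν hs
    (fun x _ => (h.hasFDerivAt_mul_left p x).hasFDerivWithinAt) (mul_right_injective p).injOn]
  simp only [hδ.det_fderiv_mul_left h]
  simp

omit [MeasurableSpace V] [BorelSpace V] in
theorem IsExpGroup.mul_left_image_distBall (h : IsExpGroup V) (p x : V) (r : ℝ) :
    (fun y => p * y) '' distBall (ccDist (leftFrame X)) x r =
      distBall (ccDist (leftFrame X)) (p * x) r := by
  ext y
  constructor
  · rintro ⟨z, hz, rfl⟩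
    simpa only [distBall, mem_ofPred_eq, h.ccDist_mul_left] using hz
  · intro hy
    refine ⟨p⁻¹ * y, ?_, by simp⟩
    rw [distBall, mem_ofPred_eq, ← h.ccDist_mul_left p, mul_inv_cancel_left]
    exact hy

omit [MeasurableSpace V] [BorelSpace V] in
theorem IsDilation.image_distBall (h : IsExpGroup V) {δ : ℝ → V →L[ℝ] V} (hδ : IsDilation X δ)
    (s r : ℝ) : δ s '' distBall (ccDist (leftFrame X)) 0 r =
      distBall (ccDist (leftFrame X)) 0 (Real.exp s * r) := by
  have key : ∀ s r, δ s '' distBall (ccDist (leftFrame X)) 0 r ⊆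
      distBall (ccDist (leftFrame X)) 0 (Real.exp s * r) := by
    rintro s r - ⟨z, hz, rfl⟩
    have h1 := hδ.ccDist_map h s z 0
    rw [map_zero] at h1
    rw [distBall, mem_ofPred_eq, h1, ENNReal.ofReal_mul (Real.exp_pos s).le]
    exact ENNReal.mul_lt_mul_right (by simpa using Real.exp_pos s) ENNReal.ofReal_ne_top hz
  refine (key s r).antisymm fun y hy => ⟨δ (-s) y, ?_, hδ.apply_neg_apply s y⟩
  have h1 := key (-s) _ (mem_image_of_mem _ hy)
  rwa [← mul_assoc, ← Real.exp_add, neg_add_cancel, Real.exp_zero, one_mul] at h1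

/-- The Carnot–Carathéodory distance of a stratified group is a homogeneous distance. -/
theorem IsDilation.isHomogeneousDist (h : IsExpGroup V) {br : V →ₗ[ℝ] V →ₗ[ℝ] V}
    (hbr : IsInvariantBracket br) {δ : ℝ → V →L[ℝ] V} (hδ : IsDilation X δ)
    (hgen : ∀ U : Submodule ℝ V, (∀ j, X j ∈ U) → (∀ j, ∀ u ∈ U, br (X j) u ∈ U) → U = ⊤) :
    IsHomogeneousDist (ccDist (leftFrame X)) ν := by
  set d := ccDist (leftFrame X) with hd
  obtain ⟨C, hC, hCb⟩ := h.ccDist_bounded_near_zero hbr hgen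
  have hlim := hδ.tendsto_ccDist h hC hCb
  have hfin := hδ.ccDist_ne_top h hlim
  obtain ⟨K, hK, hKb⟩ := h.exists_min_norm_le X
  have hcont : ∀ p : V, Continuous fun x => p * x := fun p => (h.contDiff_mul_left p).continuous
  have hnhds : ∀ x r, 0 < r → distBall d x r ∈ nhds x := by
    intro x r hr
    have h1 : Filter.Tendsto (fun y => x⁻¹ * y) (nhds x) (nhds 0) := by
      have := (hcont x⁻¹).tendsto x
      rwa [inv_mul_cancel, h.one_eq_zero] at this
    have h2 := h1.eventually (hlim.eventually (gt_mem_nhds (ENNReal.ofReal_pos.2 hr)))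
    filter_upwards [h2] with y hy
    rw [distBall, mem_ofPred_eq, hd, ccDist_comm, h.ccDist_eq]
    exact hy
  have hopen : ∀ x r, IsOpen (distBall d x r) := by
    intro x r
    rw [isOpen_iff_mem_nhds]
    intro y hy
    obtain ⟨ε, hε, hyε⟩ := ENNReal.lt_iff_exists_add_pos_lt.1 hy
    filter_upwards [hnhds y ε (by exact_mod_cast hε)] with z hz
    rw [distBall, mem_ofPred_eq] at hz ⊢
    rw [ENNReal.ofReal_coe_nnreal] at hz
    calc d z x ≤ d z y + d y x := ccDist_triangle _ _ _
      _ ≤ ε + d y x := by gcongr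
      _ = d y x + ε := add_comm _ _
      _ < _ := hyε
  have hsub0 : ∀ ε : ℝ, 0 < ε → ε ≤ 1 → distBall d 0 (ε / K) ⊆ Metric.ball 0 ε := by
    intro ε hε hε1 z hz
    rw [distBall, mem_ofPred_eq, hd, ccDist_comm] at hz
    have h1 : ENNReal.ofReal K * d 0 z < ENNReal.ofReal ε := by
      have h2 := ENNReal.mul_lt_mul_right (a := ENNReal.ofReal K)
        (by simpa using hK) ENNReal.ofReal_ne_top hz
      rwa [← ENNReal.ofReal_mul hK.le, mul_div_cancel₀ _ hK.ne'] at h2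
    have h2 := (ENNReal.ofReal_lt_ofReal_iff hε).1 ((hKb z).trans_lt h1)
    rw [mem_ball_zero_iff]
    rcases min_lt_iff.1 h2 with h3 | h3
    · exact h3
    · linarith
  have hball_eq : ∀ x r, ν (distBall d x r) = ν (distBall d 0 r) := by
    intro x r
    rw [← hδ.measure_mul_left_image ν h x (hopen 0 r).measurableSet, hd,
      h.mul_left_image_distBall, h.mul_zero']
  have hdil : ∀ s r, ν (distBall d 0 (Real.exp s * r)) =
      ENNReal.ofReal |(δ s).det| * ν (distBall d 0 r) := by
    intro s r
    rw [hd, ← hδ.image_distBall h, Measure.addHaar_image_continuousLinearMap]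
  have hball_pos : ∀ x r, 0 < r → ν (distBall d x r) ≠ 0 := fun x r hr =>
    (Measure.measure_pos_of_mem_nhds ν (hnhds x r hr)).ne'
  refine ⟨hfin, fun x y => ⟨fun hxy => ?_, fun hxy => ?_⟩, ccDist_comm, ccDist_triangle, hnhds, ?_,
    fun x y r => (hball_eq x r).trans (hball_eq y r).symm, hball_pos, ?_, ?_⟩
  · have h1 := hKb (x⁻¹ * y)
    rw [← h.ccDist_eq, ← hd, hxy, mul_zero, nonpos_iff_eq_zero, ENNReal.ofReal_eq_zero] at h1
    have h2 : ‖x⁻¹ * y‖ = 0 := by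
      rcases min_le_iff.1 h1 with h3 | h3
      · exact le_antisymm h3 (norm_nonneg _)
      · exact absurd h3 (by norm_num)
    rw [norm_eq_zero, ← h.one_eq_zero] at h2
    exact (inv_mul_eq_one.1 h2)
  · rw [hxy, hd, ccDist_self]
  · intro x U hU
    have h1 : Filter.Tendsto (fun y => x * y) (nhds 0) (nhds x) := by
      have := (hcont x).tendsto 0
      rwa [h.mul_zero'] at this
    obtain ⟨ε, hε, hεU⟩ := Metric.mem_nhds_iff.1 (h1 hU)
    refine ⟨min ε 1 / K, by positivity, ?_⟩
    have h2 := hsub0 (min ε 1) (by positivity) (min_le_right _ _)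
    rw [hd, ← h.mul_zero' x, ← h.mul_left_image_distBall]
    rintro - ⟨z, hz, rfl⟩
    exact hεU (Metric.ball_subset_ball (min_le_left _ _) (h2 hz))
  · intro x r
    rw [hball_eq]
    rcases le_or_gt r 0 with hr | hr
    · have : distBall d 0 r = ∅ := by
        ext y; simp [distBall, ENNReal.ofReal_of_nonpos hr]
      simp [this]
    · have h1 : r = Real.exp (Real.log (r * K)) * (1 / K) := by
        rw [Real.exp_log (by positivity)]; field_simp
      rw [h1, hdil]
      refine ENNReal.mul_ne_top ENNReal.ofReal_ne_top ?_
      exact ((measure_mono (hsub0 1 one_pos le_rfl)).trans_lt measure_ball_lt_top).ne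
  · intro m hm
    refine ⟨ENNReal.ofReal |(δ (Real.log m)).det|, ENNReal.ofReal_ne_top, fun x r _ => ?_⟩
    rw [hball_eq, hball_eq x r, ← hdil, Real.exp_log hm]

end BallMeasure

/-! ### Nested partitions of doubling metric spaces -/

section NestedPartitions

variable {X : Type*} [PseudoMetricSpace X]

/-- Nets `Z k` at the scales `8 ^ k`, all containing a common point `root`, together with a choice of a
parent `par k x`, in the next coarser net, of each point `x` (of the net `Z k`, say). The numbers
`code z` serve to break ties. Since all nets contain `root`, any two points have a common ancestor. -/
structure NetSystem (X : Type*) [PseudoMetricSpace X] where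
  Z : ℤ → Set X
  par : ℤ → X → X
  root : X
  code : X → ℕ
  root_mem : ∀ k, root ∈ Z k
  sep : ∀ k, ∀ z ∈ Z k, ∀ w ∈ Z k, z ≠ w → (8 : ℝ) ^ k ≤ dist z w
  dense : ∀ k x, ∃ z ∈ Z k, dist x z < 8 ^ k
  finite_ball : ∀ k x R, (Z k ∩ Metric.ball x R).Finite
  code_inj : ∀ k, InjOn code (Z k)
  par_mem : ∀ k x, par k x ∈ Z (k + 1)
  dist_par : ∀ k x, dist x (par k x) < 8 ^ (k + 1)
  par_eq : ∀ k x, ∀ w ∈ Z (k + 1), dist x w < 8 ^ (k + 1) / 2 → par k x = w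

theorem exists_maximal_separated (x₀ : X) {r : ℝ} (hr : 0 < r) :
    ∃ S : Set X, x₀ ∈ S ∧ (∀ z ∈ S, ∀ w ∈ S, z ≠ w → r ≤ dist z w) ∧
      ∀ x, ∃ z ∈ S, dist x z < r := by
  have H : ∀ c ⊆ {S : Set X | ∀ z ∈ S, ∀ w ∈ S, z ≠ w → r ≤ dist z w}, IsChain (· ⊆ ·) c →
      c.Nonempty → ∃ ub ∈ {S : Set X | ∀ z ∈ S, ∀ w ∈ S, z ≠ w → r ≤ dist z w}, ∀ s ∈ c, s ⊆ ub := by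
    intro c hc hchain _
    refine ⟨⋃₀ c, fun z hz w hw hne => ?_, fun s hs => subset_sUnion_of_mem hs⟩
    obtain ⟨s, hs, hzs⟩ := hz
    obtain ⟨t, ht, hwt⟩ := hw
    rcases hchain.total hs ht with h | h
    · exact hc ht z (h hzs) w hwt hne
    · exact hc hs z hzs w (h hwt) hne
  obtain ⟨S, hxS, hS⟩ := zorn_subset_nonempty _ H {x₀}
    (fun z hz w hw hne => absurd (hz.trans hw.symm) hne)
  · refine ⟨S, hxS rfl, hS.1, fun x => ?_⟩
    by_contra! hcon
    have hx : x ∉ S := fun hx => by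
      have := hcon x hx
      rw [dist_self] at this
      linarith
    refine hx (hS.2 (y := insert x S) ?_ (subset_insert _ _) (mem_insert _ _))
    intro z hz w hw hne
    rcases hz with rfl | hz <;> rcases hw with rfl | hw
    · exact absurd rfl hne
    · exact hcon w hw
    · rw [dist_comm]; exact hcon z hz
    · exact hS.1 z hz w hw hne

theorem exists_netSystem (x₀ : X)
    (hfin : ∀ r : ℝ, 0 < r → ∀ S : Set X, (∀ z ∈ S, ∀ w ∈ S, z ≠ w → r ≤ dist z w) →
      ∀ x R, (S ∩ Metric.ball x R).Finite) : Nonempty (NetSystem X) := by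
  have hpos : ∀ k : ℤ, (0 : ℝ) < 8 ^ k := fun k => by positivity
  choose Z hroot hsep hdense using fun k : ℤ => exists_maximal_separated x₀ (hpos k)
  have hfb : ∀ k x R, (Z k ∩ Metric.ball x R).Finite := fun k => hfin _ (hpos k) _ (hsep k)
  have hcount : (⋃ k, Z k).Countable := by
    refine countable_iUnion fun k => ?_
    have : Z k = ⋃ n : ℕ, Z k ∩ Metric.ball x₀ n := by
      rw [← inter_iUnion, Metric.iUnion_ball_nat, inter_univ]
    rw [this]
    exact countable_iUnion fun n => (hfb k x₀ n).countable
  obtain ⟨code, hcode⟩ := countable_iff_exists_injOn.1 hcount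
  have hpar : ∀ (k : ℤ) (x : X), ∃ w ∈ Z (k + 1), dist x w < 8 ^ (k + 1) ∧
      ∀ w' ∈ Z (k + 1), dist x w' < 8 ^ (k + 1) / 2 → w = w' := by
    intro k x
    by_cases h : ∃ w ∈ Z (k + 1), dist x w < 8 ^ (k + 1) / 2
    · obtain ⟨w, hw, hd⟩ := h
      refine ⟨w, hw, hd.trans (half_lt_self (hpos _)), fun w' hw' hd' => ?_⟩
      by_contra hne
      have h1 := hsep _ w hw w' hw' hne
      have h2 := dist_triangle_left w w' x
      linarith
    · push Not at h
      obtain ⟨w, hw, hd⟩ := hdense (k + 1) x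
      exact ⟨w, hw, hd, fun w' hw' hd' => absurd hd' (not_lt.2 (h w' hw'))⟩
  choose par hpm hpd hpe using hpar
  exact ⟨⟨Z, par, x₀, code, hroot, hsep, hdense, hfb,
    fun k => hcode.mono (subset_iUnion Z k), hpm, hpd, hpe⟩⟩

namespace NetSystem

variable (N : NetSystem X)

/-- The ancestor `m` generations above a point `x` of generation `k`. -/
def anc (k : ℤ) (m : ℕ) (x : X) : X :=
  ((fun p : ℤ × X => (p.1 + 1, N.par p.1 p.2))^[m] (k, x)).2

theorem anc_zero (k : ℤ) (x : X) : N.anc k 0 x = x := rfl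

theorem anc_succ' (k : ℤ) (m : ℕ) (x : X) : N.anc k (m + 1) x = N.anc (k + 1) m (N.par k x) := rfl

theorem anc_succ (k : ℤ) (m : ℕ) (x : X) :
    N.anc k (m + 1) x = N.par (k + m) (N.anc k m x) := by
  induction m generalizing k x with
  | zero => simp [anc]
  | succ m ih =>
    rw [anc_succ', ih, anc_succ']
    congr 1
    push_cast; ring

theorem anc_mem {k : ℤ} {x : X} (hx : x ∈ N.Z k) (m : ℕ) : N.anc k m x ∈ N.Z (k + m) := by
  cases m with
  | zero => simpa [anc_zero] using hx
  | succ m =>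
    rw [anc_succ]
    have := N.par_mem (k + m) (N.anc k m x)
    rw [add_assoc] at this
    exact_mod_cast this

theorem dist_anc (k : ℤ) (m : ℕ) (x : X) : dist x (N.anc k m x) < 2 * 8 ^ (k + m) := by
  induction m with
  | zero => simp [anc_zero]; positivity
  | succ m ih =>
    rw [anc_succ]
    have h1 := N.dist_par (k + m) (N.anc k m x)
    have h2 := dist_triangle x (N.anc k m x) (N.par (k + m) (N.anc k m x))
    have h3 : (8 : ℝ) ^ (k + (m + 1 : ℕ)) = 8 * 8 ^ (k + m : ℤ) := by
      push_cast
      rw [← add_assoc, zpow_add_one₀ (by norm_num), mul_comm]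
    rw [zpow_add_one₀ (by norm_num)] at h1
    rw [h3]
    have h4 : (0 : ℝ) < 8 ^ (k + m : ℤ) := by positivity
    linarith

theorem exists_anc_eq (k : ℤ) (z w : X) : ∃ m, N.anc k m z = N.anc k m w := by
  obtain ⟨m, hm⟩ : ∃ m : ℕ, max (dist z N.root) (dist w N.root) < 8 ^ (k + m) := by
    obtain ⟨m, hm⟩ := pow_unbounded_of_one_lt
      (max (dist z N.root) (dist w N.root) / 8 ^ k) (by norm_num : (1 : ℝ) < 8)
    refine ⟨m, ?_⟩
    rw [div_lt_iff₀ (by positivity)] at hm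
    rw [zpow_add₀ (by norm_num), mul_comm]
    exact_mod_cast hm
  have key : ∀ y, dist y N.root < 8 ^ (k + m) → N.anc k (m + 1) y = N.root := by
    intro y hy
    rw [anc_succ]
    refine N.par_eq _ _ _ (N.root_mem _) ?_
    have h1 := N.dist_anc k m y
    have h2 := dist_triangle_left (N.anc k m y) N.root y
    have h3 : (0 : ℝ) < 8 ^ (k + m : ℤ) := by positivity
    rw [zpow_add_one₀ (by norm_num)]
    linarith
  exact ⟨m + 1, by rw [key z ((le_max_left _ _).trans_lt hm), key w ((le_max_right _ _).trans_lt hm)]⟩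

/-- The descendants of `w`, as a point of generation `k`. -/
def desc (k : ℤ) (w : X) : Set X :=
  {z | ∃ (l : ℤ) (m : ℕ), l + m = k ∧ z ∈ N.Z l ∧ N.anc l m z = w}

theorem dist_desc {k : ℤ} {w z : X} (hz : z ∈ N.desc k w) : dist z w < 2 * 8 ^ k := by
  obtain ⟨l, m, rfl, -, rfl⟩ := hz
  exact N.dist_anc l m z

theorem dist_closure_desc {k : ℤ} {w x : X} (hx : x ∈ closure (N.desc k w)) :
    dist x w ≤ 2 * 8 ^ k := by
  have : closure (N.desc k w) ⊆ Metric.closedBall w (2 * 8 ^ k) :=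
    closure_minimal (fun z hz => (N.dist_desc hz).le) Metric.isClosed_closedBall
  exact this hx

/-- The closed cubes cover the space, because the descendants are dense and the family of the closed
cubes is locally finite. -/
theorem exists_mem_closure_desc (k : ℤ) (x : X) : ∃ w ∈ N.Z k, x ∈ closure (N.desc k w) := by
  set F := N.Z k ∩ Metric.ball x (4 * 8 ^ k) with hF
  have hx : x ∈ closure (⋃ w ∈ F, N.desc k w) := by
    rw [Metric.mem_closure_iff]
    intro ε hε
    obtain ⟨m, hm⟩ := exists_pow_lt_of_lt_one (show 0 < ε / 8 ^ k by positivity)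
      (by norm_num : (8 : ℝ)⁻¹ < 1)
    have hm' : (8 : ℝ) ^ (k - m) < ε := by
      rw [lt_div_iff₀ (by positivity)] at hm
      rw [zpow_sub₀ (by norm_num), div_eq_mul_inv, mul_comm]
      simpa using hm
    obtain ⟨z, hz, hd⟩ := N.dense (k - m) x
    have hk : k - m + m = k := by ring
    have h1 := N.anc_mem hz m
    have h2 := N.dist_anc (k - m) m z
    rw [hk] at h1 h2
    refine ⟨z, mem_biUnion (x := N.anc (k - m) m z) ⟨h1, ?_⟩ ⟨k - m, m, hk, hz, rfl⟩, hd.trans hm'⟩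
    rw [Metric.mem_ball, dist_comm]
    have h3 := dist_triangle x z (N.anc (k - m) m z)
    have h4 : (8 : ℝ) ^ (k - m) ≤ 8 ^ k := zpow_le_zpow_right₀ (by norm_num) (by omega)
    have h5 : (0 : ℝ) < 8 ^ k := by positivity
    linarith
  rw [(N.finite_ball k x _).closure_biUnion] at hx
  obtain ⟨w, hw, hxw⟩ := mem_iUnion₂.1 hx
  exact ⟨w, hw.1, hxw⟩

/-- Points close to the center `w` belong to no other closed cube of the same generation. -/
theorem eq_of_mem_closure_desc {k : ℤ} {w w' x : X} (hw : w ∈ N.Z k) (hw' : w' ∈ N.Z k)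
    (hx : dist x w < 8 ^ k / 8) (hx' : x ∈ closure (N.desc k w')) : w' = w := by
  have hpos : (0 : ℝ) < 8 ^ k := by positivity
  obtain ⟨z, hz, hd⟩ := Metric.mem_closure_iff.1 hx' (8 ^ k / 8) (by positivity)
  have hzw : dist z w < 8 ^ k / 4 := by
    have := dist_triangle_left z w x
    linarith
  obtain ⟨l, m, hlm, hzl, hanc⟩ := hz
  cases m with
  | zero =>
    rw [anc_zero] at hanc
    by_contra hne
    have := N.sep k w' hw' w hw hne
    rw [hanc] at hzw
    linarith
  | succ m =>
    rw [anc_succ] at hanc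
    have hk : l + m + 1 = k := by rw [← hlm]; push_cast; ring
    rw [← hanc]
    refine N.par_eq _ _ _ (hk ▸ hw) ?_
    have h1 := N.dist_anc l m z
    have h2 := dist_triangle_left (N.anc l m z) w z
    have h3 : (8 : ℝ) ^ k = 8 ^ (l + m : ℤ) * 8 := by rw [← hk, zpow_add_one₀ (by norm_num)]
    rw [hk]
    linarith

/-- A closed cube is covered by the closed cubes of its children. -/
theorem exists_child {k : ℤ} {v x : X} (hv : v ∈ N.Z (k + 1))
    (hx : x ∈ closure (N.desc (k + 1) v)) :
    ∃ w ∈ N.Z k, N.par k w = v ∧ x ∈ closure (N.desc k w) := by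
  have hpos : (0 : ℝ) < 8 ^ k := by positivity
  set F := {w ∈ N.Z k | N.par k w = v} with hF
  have hFfin : F.Finite := by
    refine (N.finite_ball k v (8 ^ (k + 1))).subset fun w hw => ⟨hw.1, ?_⟩
    rw [Metric.mem_ball, ← hw.2]
    exact N.dist_par k w
  have hsub : N.desc (k + 1) v ⊆ {v} ∪ ⋃ w ∈ F, N.desc k w := by
    rintro z ⟨l, m, hlm, hz, hanc⟩
    cases m with
    | zero => exact Or.inl hanc
    | succ m =>
      have hlm' : l + m = k := by push_cast at hlm; linarith
      rw [anc_succ, hlm'] at hanc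
      exact Or.inr (mem_biUnion (x := N.anc l m z) ⟨hlm' ▸ N.anc_mem hz m, hanc⟩
        ⟨l, m, hlm', hz, rfl⟩)
  have hx' := closure_mono hsub hx
  rw [closure_union, hFfin.closure_biUnion] at hx'
  rcases hx' with hx' | hx'
  · -- only the center itself can fail to come from a child
    obtain ⟨w, hw, hxw⟩ := N.exists_mem_closure_desc k x
    refine ⟨w, hw, N.par_eq k w v hv ?_, hxw⟩
    have h1 := N.dist_closure_desc hxw
    have h2 : dist x v = 0 := by
      have : x ∈ Metric.closedBall v 0 := closure_minimal
        (singleton_subset_iff.2 (Metric.mem_closedBall_self le_rfl)) Metric.isClosed_closedBall hx'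
      exact le_antisymm this dist_nonneg
    have h3 := dist_triangle_left w v x
    rw [zpow_add_one₀ (by norm_num)]
    linarith
  · obtain ⟨w, hw, hxw⟩ := mem_iUnion₂.1 hx'
    exact ⟨w, hw.1, hw.2, hxw⟩

theorem closure_desc_subset_par (k : ℤ) (w : X) :
    closure (N.desc k w) ⊆ closure (N.desc (k + 1) (N.par k w)) := by
  refine closure_mono ?_
  rintro z ⟨l, m, hlm, hz, hanc⟩
  refine ⟨l, m + 1, by push_cast; rw [← hlm]; ring, hz, ?_⟩
  rw [anc_succ, hanc, hlm]

/-- The lexicographic order on the points of generation `k`: points are compared through their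
ancestors in the last generation in which these differ. -/
def prec (k : ℤ) (z w : X) : Prop :=
  ∃ m, N.anc k (m + 1) z = N.anc k (m + 1) w ∧ N.code (N.anc k m z) < N.code (N.anc k m w)

variable {N}

theorem anc_eq_of_le {k : ℤ} {z w : X} {m m' : ℕ} (hm : m ≤ m') (h : N.anc k m z = N.anc k m w) :
    N.anc k m' z = N.anc k m' w := by
  induction hm with
  | refl => exact h
  | step _ ih => rw [anc_succ, anc_succ, ih]

theorem prec_irrefl (k : ℤ) (z : X) : ¬ N.prec k z z := fun ⟨_, _, h⟩ => lt_irrefl _ h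

theorem prec_trans {k : ℤ} {a b c : X} (h : N.prec k a b) (h' : N.prec k b c) : N.prec k a c := by
  obtain ⟨m, h1, h2⟩ := h
  obtain ⟨m', h1', h2'⟩ := h'
  rcases lt_trichotomy m m' with hlt | rfl | hlt
  · refine ⟨m', (anc_eq_of_le (by omega) h1).trans h1', ?_⟩
    rwa [anc_eq_of_le (show m + 1 ≤ m' by omega) h1]
  · exact ⟨m, h1.trans h1', h2.trans h2'⟩
  · refine ⟨m, h1.trans (anc_eq_of_le (by omega) h1'), ?_⟩
    rwa [← anc_eq_of_le (show m' + 1 ≤ m by omega) h1']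

theorem prec_total {k : ℤ} {z w : X} (hz : z ∈ N.Z k) (hw : w ∈ N.Z k) (hne : z ≠ w) :
    N.prec k z w ∨ N.prec k w z := by
  classical
  have hex := N.exists_anc_eq k z w
  obtain ⟨m, hm⟩ : ∃ m, Nat.find hex = m + 1 := by
    refine Nat.exists_eq_succ_of_ne_zero fun h0 => hne ?_
    have := Nat.find_spec hex
    rwa [h0] at this
  have h1 := Nat.find_spec hex
  have h2 : N.anc k m z ≠ N.anc k m w := Nat.find_min hex (by omega)
  rw [hm] at h1
  have h3 : N.code (N.anc k m z) ≠ N.code (N.anc k m w) := fun h =>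
    h2 (N.code_inj _ (N.anc_mem hz m) (N.anc_mem hw m) h)
  rcases lt_or_gt_of_ne h3 with h | h
  · exact Or.inl ⟨m, h1, h⟩
  · exact Or.inr ⟨m, h1.symm, h⟩

theorem prec_par {k : ℤ} {z w : X} (h : N.prec k z w) (hne : N.par k z ≠ N.par k w) :
    N.prec (k + 1) (N.par k z) (N.par k w) := by
  obtain ⟨m, h1, h2⟩ := h
  cases m with
  | zero => exact absurd h1 hne
  | succ m => exact ⟨m, h1, h2⟩

variable (N)

/-- The cube with center `w`: the points of its closed cube which belong to no closed cube preceding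
it in the lexicographic order. -/
def cube (k : ℤ) (w : X) : Set X :=
  closure (N.desc k w) \ ⋃ w' ∈ {w' ∈ N.Z k | N.prec k w' w}, closure (N.desc k w')

variable {N}

theorem mem_cube_iff {k : ℤ} {w x : X} : x ∈ N.cube k w ↔ x ∈ closure (N.desc k w) ∧
    ∀ w' ∈ N.Z k, N.prec k w' w → x ∉ closure (N.desc k w') := by
  simp [cube]

variable (N)

theorem countable_Z (k : ℤ) : (N.Z k).Countable :=
  countable_iff_exists_injOn.2 ⟨N.code, N.code_inj k⟩

theorem measurableSet_cube [MeasurableSpace X] (hX : ∀ s : Set X, IsClosed s → MeasurableSet s)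
    (k : ℤ) (w : X) : MeasurableSet (N.cube k w) :=
  (hX _ isClosed_closure).diff (MeasurableSet.biUnion ((N.countable_Z k).mono (sep_subset _ _))
    fun _ _ => hX _ isClosed_closure)

theorem exists_mem_cube (k : ℤ) (x : X) : ∃ w ∈ N.Z k, x ∈ N.cube k w := by
  have : IsStrictOrder X (N.prec k) :=
    { irrefl := prec_irrefl k
      trans := fun _ _ _ => prec_trans }
  set M := {w ∈ N.Z k | x ∈ closure (N.desc k w)} with hM
  have hMfin : M.Finite := by
    refine (N.finite_ball k x (3 * 8 ^ k)).subset fun w hw => ⟨hw.1, ?_⟩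
    have h1 := N.dist_closure_desc hw.2
    have h2 : (0 : ℝ) < 8 ^ k := by positivity
    rw [Metric.mem_ball, dist_comm]
    linarith
  obtain ⟨w, hw, hxw⟩ := N.exists_mem_closure_desc k x
  obtain ⟨w₀, -, hmin⟩ := (hMfin.wellFoundedOn (r := N.prec k)).has_min univ ⟨⟨w, hw, hxw⟩, trivial⟩
  refine ⟨w₀, w₀.2.1, mem_cube_iff.2 ⟨w₀.2.2, fun w' hw' hprec hxw' => ?_⟩⟩
  exact hmin ⟨w', hw', hxw'⟩ trivial hprec

variable {N}

theorem eq_of_mem_cube {k : ℤ} {w w' x : X} (hw : w ∈ N.Z k) (hw' : w' ∈ N.Z k)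
    (hx : x ∈ N.cube k w) (hx' : x ∈ N.cube k w') : w = w' := by
  rw [mem_cube_iff] at hx hx'
  by_contra hne
  rcases prec_total hw hw' hne with h | h
  · exact hx'.2 w hw h hx.1
  · exact hx.2 w' hw' h hx'.1

theorem cube_subset_par {k : ℤ} {w : X} (hw : w ∈ N.Z k) :
    N.cube k w ⊆ N.cube (k + 1) (N.par k w) := by
  intro x hx
  rw [mem_cube_iff] at hx ⊢
  refine ⟨N.closure_desc_subset_par k w hx.1, fun v hv hvw hxv => ?_⟩
  obtain ⟨w', hw', rfl, hxw'⟩ := N.exists_child hv hxv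
  have hne : N.par k w' ≠ N.par k w := fun h => prec_irrefl _ _ (h ▸ hvw)
  rcases prec_total hw' hw (fun h => hne (h ▸ rfl)) with h | h
  · exact hx.2 w' hw' h hxw'
  · exact prec_irrefl _ _ (prec_trans hvw (prec_par h hne.symm))

theorem cube_subset_anc {k : ℤ} {w : X} (hw : w ∈ N.Z k) (m : ℕ) :
    N.cube k w ⊆ N.cube (k + m) (N.anc k m w) := by
  induction m with
  | zero => simp [anc_zero]
  | succ m ih =>
    rw [anc_succ]
    refine ih.trans ?_
    have := cube_subset_par (N.anc_mem hw m)
    rw [add_assoc] at this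
    exact_mod_cast this

theorem ball_subset_cube {k : ℤ} {w : X} (hw : w ∈ N.Z k) :
    Metric.ball w (8 ^ k / 8) ⊆ N.cube k w := by
  intro x hx
  obtain ⟨w', hw', hxw'⟩ := N.exists_mem_cube k x
  have := N.eq_of_mem_closure_desc hw hw' hx (mem_cube_iff.1 hxw').1
  rwa [this] at hxw'

theorem cube_subset_ball {k : ℤ} {w : X} : N.cube k w ⊆ Metric.ball w (8 * 8 ^ k) := by
  intro x hx
  have := N.dist_closure_desc (mem_cube_iff.1 hx).1
  have hpos : (0 : ℝ) < 8 ^ k := by positivity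
  rw [Metric.mem_ball]
  linarith

end NetSystem

/-- Dyadic systems exist in every metric space in which the cardinality of separated subsets of balls
is bounded uniformly in the scale. -/
theorem nonempty_dyadicSystem_of_card_le [MeasurableSpace X]
    (hX : ∀ s : Set X, IsClosed s → MeasurableSet s) (x₀ : X)
    (hcard : ∀ R : ℝ, ∃ J : ℕ, ∀ r : ℝ, 0 < r → ∀ (x : X) (S : Set X),
      (∀ z ∈ S, ∀ w ∈ S, z ≠ w → r ≤ dist z w) → (S ∩ Metric.ball x (R * r)).encard ≤ J)
    {d : X → X → ℝ≥0∞} (hd : ∀ x r, distBall d x r = Metric.ball x r) (ν : Measure X) :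
    Nonempty (DyadicSystem d ν) := by
  obtain ⟨N⟩ := exists_netSystem x₀ fun r hr S hS x R => by
    obtain ⟨J, hJ⟩ := hcard (R / r)
    have := hJ r hr x S hS
    rw [div_mul_cancel₀ _ hr.ne'] at this
    exact finite_of_encard_le_coe this
  obtain ⟨J, hJ⟩ := hcard 64
  have hpos : ∀ k : ℤ, (0 : ℝ) < 8 ^ k := fun k => by positivity
  let I : ℤ → Type := fun k => {c : ℕ // ∃ z ∈ N.Z k, N.code z = c}
  let center : ∀ k, I k → X := fun k α => α.2.choose
  have hmem : ∀ k α, center k α ∈ N.Z k := fun k α => α.2.choose_spec.1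
  have hcode : ∀ k α, N.code (center k α) = α.1 := fun k α => α.2.choose_spec.2
  have hinj : ∀ k (α β : I k), center k α = center k β → α = β := fun k α β h =>
    Subtype.ext (by rw [← hcode, ← hcode, h])
  have hsurj : ∀ k, ∀ z ∈ N.Z k, ∃ α : I k, center k α = z := fun k z hz =>
    ⟨⟨N.code z, z, hz, rfl⟩, N.code_inj k (hmem _ _) hz (hcode _ _)⟩
  have hself : ∀ k (α : I k), center k α ∈ N.cube k (center k α) := fun k α =>
    NetSystem.ball_subset_cube (hmem k α) (Metric.mem_ball_self (by have := hpos k; positivity))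
  have hanc : ∀ l k, l ≤ k → ∀ β : I l, ∃ α : I k,
      N.cube l (center l β) ⊆ N.cube k (center k α) := by
    intro l k hlk β
    obtain ⟨m, rfl⟩ : ∃ m : ℕ, k = l + m := ⟨(k - l).toNat, by omega⟩
    obtain ⟨α, hα⟩ := hsurj _ _ (N.anc_mem (hmem l β) m)
    exact ⟨α, by rw [hα]; exact NetSystem.cube_subset_anc (hmem l β) m⟩
  exact ⟨
    { η := 8
      C := 8
      J := max J 2
      one_lt_η := by norm_num
      one_lt_C := by norm_num
      two_le_J := le_max_right _ _
      I := I
      countable_I := fun k => inferInstanceAs (Countable {c : ℕ // _})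
      Q := fun k α => N.cube k (center k α)
      center := center
      measurableSet := fun k α => N.measurableSet_cube hX k _
      cover := fun k => by
        have : (⋃ α : I k, N.cube k (center k α)) = univ := by
          refine eq_univ_of_forall fun x => ?_
          obtain ⟨w, hw, hx⟩ := N.exists_mem_cube k x
          obtain ⟨α, rfl⟩ := hsurj k w hw
          exact mem_iUnion.2 ⟨α, hx⟩
        rw [this, compl_univ, measure_empty]
      ball_subset := fun k α => by
        rw [hd]
        convert NetSystem.ball_subset_cube (hmem k α) using 2
        ring
      subset_ball := fun k α => by
        rw [hd]
        exact NetSystem.cube_subset_ball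
      disjoint := fun k α β hne => by
        by_contra hcon
        obtain ⟨x, hx, hx'⟩ := nonempty_iff_ne_empty.2 hcon
        exact hne (hinj k α β (NetSystem.eq_of_mem_cube (hmem _ _) (hmem _ _) hx hx'))
      children_le := fun k α => by
        have hk : (8 : ℝ) * 8 ^ k = 64 * 8 ^ (k - 1) := by
          rw [zpow_sub_one₀ (by norm_num)]; ring
        have h1 := hJ _ (hpos (k - 1)) (center k α) _ (N.sep (k - 1))
        refine le_trans ?_ (h1.trans (by exact_mod_cast le_max_left J 2))
        have hinj' : Function.Injective (center (k - 1)) := fun α β h => hinj _ α β h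
        rw [← hinj'.encard_image]
        refine encard_le_encard ?_
        rintro - ⟨β, hβ, rfl⟩
        refine ⟨hmem _ _, ?_⟩
        rw [← hk]
        exact NetSystem.cube_subset_ball (hβ (hself _ β))
      existsUnique_ancestor := fun l k hlk β => by
        obtain ⟨α, hα⟩ := hanc l k hlk β
        exact ⟨α, hα, fun α' hα' => hinj k _ _ (NetSystem.eq_of_mem_cube (hmem _ _) (hmem _ _)
          (hα' (hself _ β)) (hα (hself _ β)))⟩
      nested := fun l k hlk α β => by
        by_cases hdisj : N.cube k (center k α) ∩ N.cube l (center l β) = ∅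
        · exact Or.inl hdisj
        · obtain ⟨x, hx, hx'⟩ := nonempty_iff_ne_empty.2 hdisj
          obtain ⟨α', hα'⟩ := hanc l k hlk β
          have := NetSystem.eq_of_mem_cube (hmem _ _) (hmem _ _) hx (hα' hx')
          rw [← this] at hα'
          exact Or.inr hα' }⟩

end NestedPartitions

/-! ### Dyadic systems for homogeneous distances -/

section HomogeneousDist

variable {V : Type*} [TopologicalSpace V] [MeasurableSpace V] [OpensMeasurableSpace V]
  {d : V → V → ℝ≥0∞} {ν : Measure V}

theorem distBall_mono {X : Type*} {d : X → X → ℝ≥0∞} {x : X} {r s : ℝ} (h : r ≤ s) :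
    distBall d x r ⊆ distBall d x s := fun _ hy =>
  lt_of_lt_of_le hy (ENNReal.ofReal_le_ofReal h)

namespace IsHomogeneousDist

variable (h : IsHomogeneousDist d ν)
include h

omit [OpensMeasurableSpace V] in
theorem isOpen_distBall (x : V) (r : ℝ) : IsOpen (distBall d x r) := by
  rw [isOpen_iff_mem_nhds]
  intro y hy
  obtain ⟨ε, hε, hyε⟩ := ENNReal.lt_iff_exists_add_pos_lt.1 hy
  filter_upwards [h.ball_mem_nhds y ε (by exact_mod_cast hε)] with z hz
  rw [distBall, mem_ofPred_eq] at hz ⊢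
  rw [ENNReal.ofReal_coe_nnreal] at hz
  calc d z x ≤ d z y + d y x := h.triangle _ _ _
    _ ≤ ε + d y x := by gcongr
    _ = d y x + ε := add_comm _ _
    _ < _ := hyε

omit [OpensMeasurableSpace V] in
theorem distBall_subset {x y : V} {r s : ℝ} (hr : 0 ≤ r) (hs : 0 ≤ s)
    (hy : d x y ≤ ENNReal.ofReal s) : distBall d x r ⊆ distBall d y (r + s) := by
  intro z hz
  rw [distBall, mem_ofPred_eq, ENNReal.ofReal_add hr hs]
  exact (h.triangle z x y).trans_lt (ENNReal.add_lt_add_of_lt_of_le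
    (ne_top_of_le_ne_top ENNReal.ofReal_ne_top hy) hz hy)

/-- Separated subsets of balls have bounded cardinality, by comparison of measures. -/
theorem card_le (R : ℝ) : ∃ J : ℕ, ∀ r : ℝ, 0 < r → ∀ (x : V) (S : Set V),
    (∀ z ∈ S, ∀ w ∈ S, z ≠ w → ENNReal.ofReal r ≤ d z w) →
      (S ∩ distBall d x (R * r)).encard ≤ J := by
  rcases le_or_gt R 0 with hR | hR
  · refine ⟨0, fun r hr x S _ => ?_⟩
    have : distBall d x (R * r) = ∅ := by
      ext y
      simp [distBall, ENNReal.ofReal_of_nonpos (mul_nonpos_of_nonpos_of_nonneg hR hr.le)]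
    simp [this]
  obtain ⟨C, hC, hCb⟩ := h.measure_ball_mul (2 * (R + 1)) (by positivity)
  refine ⟨⌈C.toReal⌉₊, fun r hr x S hS => ?_⟩
  by_contra! hcon
  obtain ⟨T, hTS, hT⟩ := exists_subset_encard_eq (Order.add_one_le_of_lt hcon)
  have hTfin : T.Finite := finite_of_encard_eq_coe (k := ⌈C.toReal⌉₊ + 1) (by exact_mod_cast hT)
  set m := ν (distBall d x (r / 2)) with hm
  have hm0 : m ≠ 0 := h.measure_ball_ne_zero _ _ (by positivity)
  have hmt : m ≠ ⊤ := h.measure_ball_ne_top _ _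
  -- the balls of radius `r / 2` around the points of `T` are disjoint
  have hdisj : T.PairwiseDisjoint fun z => distBall d z (r / 2) := by
    intro z hz w hw hne
    refine Set.disjoint_left.2 fun y hyz hyw => ?_
    refine absurd (hS z (hTS hz).1 w (hTS hw).1 hne) (not_le.2 ?_)
    calc d z w ≤ d z y + d y w := h.triangle _ _ _
      _ < ENNReal.ofReal (r / 2) + ENNReal.ofReal (r / 2) := by
        rw [h.symm z y]; exact ENNReal.add_lt_add hyz hyw
      _ = ENNReal.ofReal r := by
        rw [← ENNReal.ofReal_add (by positivity) (by positivity), add_halves]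
  have h1 : ν (⋃ z ∈ T, distBall d z (r / 2)) = T.encard.toENNReal * m := by
    rw [measure_biUnion hTfin.countable hdisj fun z _ => (h.isOpen_distBall _ _).measurableSet]
    simp only [h.measure_ball_eq _ x, ← hm]
    rw [ENNReal.tsum_const]
    rfl
  have h2 : (⋃ z ∈ T, distBall d z (r / 2)) ⊆ distBall d x (2 * (R + 1) * (r / 2)) := by
    refine iUnion₂_subset fun z hz => ?_
    refine (h.distBall_subset (s := R * r) (by positivity) (by positivity) (hTS hz).2.le).trans
      (distBall_mono ?_)
    nlinarith
  have h3 := measure_mono (μ := ν) h2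
  rw [h1, hCb x _ (by positivity), ← hm, ENNReal.mul_le_mul_iff_left hm0 hmt, hT] at h3
  have h4 : ((⌈C.toReal⌉₊ + 1 : ℕ) : ℝ≥0∞) ≤ C := by simpa using h3
  have h5 := ENNReal.toReal_mono hC h4
  rw [ENNReal.toReal_natCast] at h5
  have h6 := Nat.le_ceil C.toReal
  push_cast at h5
  linarith

theorem nonempty_dyadicSystem (x₀ : V) : Nonempty (DyadicSystem d ν) := by
  let m : PseudoMetricSpace V :=
    { dist := fun x y => (d x y).toReal
      dist_self := fun x => by simp [(h.eq_zero_iff x x).2 rfl]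
      dist_comm := fun x y => by simp only [h.symm x y]
      dist_triangle := fun x y z => by
        rw [← ENNReal.toReal_add (h.ne_top _ _) (h.ne_top _ _)]
        exact ENNReal.toReal_mono (ENNReal.add_ne_top.2 ⟨h.ne_top _ _, h.ne_top _ _⟩)
          (h.triangle _ _ _) }
  have hball : ∀ x r, distBall d x r = @Metric.ball V m x r := by
    intro x r
    ext y
    exact ENNReal.lt_ofReal_iff_toReal_lt (h.ne_top _ _)
  refine @nonempty_dyadicSystem_of_card_le V m _ (fun s hs => ?_) x₀ (fun R => ?_) d hball ν
  · have hs' : @IsOpen V m.toUniformSpace.toTopologicalSpace sᶜ :=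
      (@isOpen_compl_iff V s m.toUniformSpace.toTopologicalSpace).2 hs
    have : IsOpen sᶜ := by
      rw [isOpen_iff_mem_nhds]
      intro x hx
      obtain ⟨ε, hε, hsub⟩ := (@Metric.isOpen_iff V m _).1 hs' x hx
      rw [← hball] at hsub
      exact Filter.mem_of_superset (h.ball_mem_nhds x ε hε) hsub
    exact this.measurableSet.of_compl
  · obtain ⟨J, hJ⟩ := h.card_le R
    refine ⟨J, fun r hr x S hS => ?_⟩
    rw [← hball]
    refine hJ r hr x S fun z hz w hw hne => ?_
    exact (ENNReal.ofReal_le_iff_le_toReal (h.ne_top _ _)).2 (hS z hz w hw hne)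

end IsHomogeneousDist

end HomogeneousDist

/-! ### Calderón–Zygmund decompositions from trees of sets -/

section StoppingTime

/-- A family of sets, indexed by `P`, each of which is split, up to a null set, into countably many
disjoint smaller members of the family of comparable measure. Infinite branches shrink to points. -/
structure SplittingFamily {X : Type*} [TopologicalSpace X] [MeasurableSpace X] (μ : Measure X)
    (κ : ℝ) (P : Type) where
  carrier : P → Set X
  children : P → Set P
  measurableSet : ∀ p, MeasurableSet (carrier p)
  measure_ne_zero : ∀ p, μ (carrier p) ≠ 0
  measure_ne_top : ∀ p, μ (carrier p) ≠ ⊤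
  countable_children : ∀ p, (children p).Countable
  disjoint_children : ∀ p, (children p).PairwiseDisjoint carrier
  subset_of_mem : ∀ p, ∀ q ∈ children p, carrier q ⊆ carrier p
  measure_diff : ∀ p, μ (carrier p \ ⋃ q ∈ children p, carrier q) = 0
  measure_le : ∀ p, ∀ q ∈ children p, μ (carrier p) ≤ ENNReal.ofReal κ * μ (carrier q)
  shrink : ∀ (p : ℕ → P) (x : X), (∀ n, p (n + 1) ∈ children (p n)) → (∀ n, x ∈ carrier (p n)) →
    ∀ U, IsOpen U → x ∈ U → ∃ n, carrier (p n) ⊆ U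

variable {X : Type*} [TopologicalSpace X] [MeasurableSpace X] {μ : Measure X} {κ : ℝ} {P : Type}

namespace SplittingFamily

variable (T : SplittingFamily μ κ P) (good : P → Prop) (G : Set P)

/-- The sets of generation `n` all of whose ancestors from the initial partition `G` on are good. -/
def active : ℕ → Set P
  | 0 => G
  | n + 1 => {q | (∃ p ∈ active n, q ∈ T.children p) ∧ good q}

/-- The bad sets all of whose proper ancestors are good, in generation `n + 1`. -/
def stopped (n : ℕ) : Set P := {q | (∃ p ∈ T.active good G n, q ∈ T.children p) ∧ ¬ good q}

variable {good G}

theorem countable_active (hG : G.Countable) (n : ℕ) : (T.active good G n).Countable := by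
  induction n with
  | zero => exact hG
  | succ n ih =>
    refine (ih.biUnion fun p _ => T.countable_children p).mono fun q hq => ?_
    obtain ⟨p, hp, hq⟩ := hq.1
    exact mem_biUnion hp hq

theorem countable_stopped (hG : G.Countable) (n : ℕ) : (T.stopped good G n).Countable := by
  refine ((T.countable_active (good := good) hG n).biUnion
    fun p _ => T.countable_children p).mono fun q hq => ?_
  obtain ⟨p, hp, hq⟩ := hq.1
  exact mem_biUnion hp hq

theorem disjoint_of_parents {S : Set P} (hS : S.PairwiseDisjoint T.carrier) :
    {q | ∃ p ∈ S, q ∈ T.children p}.PairwiseDisjoint T.carrier := by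
  rintro q ⟨p, hp, hq⟩ q' ⟨p', hp', hq'⟩ hne
  by_cases h : p = p'
  · subst h
    exact T.disjoint_children p hq hq' hne
  · exact (hS hp hp' h).mono (T.subset_of_mem p q hq) (T.subset_of_mem p' q' hq')

theorem disjoint_active (hG : G.PairwiseDisjoint T.carrier) (n : ℕ) :
    (T.active good G n).PairwiseDisjoint T.carrier := by
  induction n with
  | zero => exact hG
  | succ n ih => exact (T.disjoint_of_parents ih).subset fun q hq => hq.1

theorem exists_active_of_mem_active {n m : ℕ} (hnm : n ≤ m) {q : P} (hq : q ∈ T.active good G m) :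
    ∃ r ∈ T.active good G n, T.carrier q ⊆ T.carrier r := by
  induction hnm generalizing q with
  | refl => exact ⟨q, hq, subset_rfl⟩
  | step _ ih =>
    obtain ⟨p, hp, hqp⟩ := hq.1
    obtain ⟨r, hr, hpr⟩ := ih hp
    exact ⟨r, hr, (T.subset_of_mem p q hqp).trans hpr⟩

theorem disjoint_stopped (hG : G.PairwiseDisjoint T.carrier) :
    (⋃ n, T.stopped good G n).PairwiseDisjoint T.carrier := by
  have key : ∀ n m, n < m → ∀ q ∈ T.stopped good G n, ∀ q' ∈ T.stopped good G m,
      Disjoint (T.carrier q) (T.carrier q') := by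
    intro n m hnm q hq q' hq'
    obtain ⟨p', hp', hqp'⟩ := hq'.1
    obtain ⟨r, hr, hpr⟩ := T.exists_active_of_mem_active (show n + 1 ≤ m from hnm) hp'
    have hne : q ≠ r := fun h => hq.2 (h ▸ hr.2)
    exact (T.disjoint_of_parents (T.disjoint_active hG n) hq.1 hr.1 hne).mono_right
      ((T.subset_of_mem p' q' hqp').trans hpr)
  intro q hq q' hq' hne
  obtain ⟨n, hn⟩ := mem_iUnion.1 hq
  obtain ⟨m, hm⟩ := mem_iUnion.1 hq'
  rcases lt_trichotomy n m with h | rfl | h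
  · exact key n m h q hn q' hm
  · exact T.disjoint_of_parents (T.disjoint_active hG n) hn.1 hm.1 hne
  · exact (key m n h q' hm q hn).symm

/-- The points outside of the stopped sets which belong to an active set of every generation. -/
def remainder (good : P → Prop) (G : Set P) : Set X :=
  {x | x ∉ ⋃ q ∈ ⋃ n, T.stopped good G n, T.carrier q} ∩
    {x | (∃ p ∈ G, x ∈ T.carrier p) ∧
      ∀ n, ∀ p ∈ T.active good G n, x ∈ T.carrier p → ∃ q ∈ T.children p, x ∈ T.carrier q}

theorem exists_child_of_mem_remainder {x : X} (hx : x ∈ T.remainder good G) {n : ℕ} {p : P}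
    (hp : p ∈ T.active good G n) (hxp : x ∈ T.carrier p) :
    ∃ q ∈ T.children p, q ∈ T.active good G (n + 1) ∧ x ∈ T.carrier q := by
  obtain ⟨q, hq, hxq⟩ := hx.2.2 n p hp hxp
  refine ⟨q, hq, ⟨⟨p, hp, hq⟩, ?_⟩, hxq⟩
  by_contra hbad
  exact hx.1 (mem_biUnion (mem_iUnion.2 ⟨n, ⟨p, hp, hq⟩, hbad⟩) hxq)

theorem exists_active_subset {x : X} (hx : x ∈ T.remainder good G) {U : Set X} (hU : IsOpen U)
    (hxU : x ∈ U) : ∃ n, ∃ p ∈ T.active good G n, x ∈ T.carrier p ∧ T.carrier p ⊆ U := by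
  obtain ⟨p₀, hp₀, hxp₀⟩ := hx.2.1
  let A : Type := {a : ℕ × P // a.2 ∈ T.active good G a.1 ∧ x ∈ T.carrier a.2}
  have hstep : ∀ a : A, ∃ b : A, b.1.1 = a.1.1 + 1 ∧ b.1.2 ∈ T.children a.1.2 := by
    intro a
    obtain ⟨q, hq, hqa, hxq⟩ := T.exists_child_of_mem_remainder hx a.2.1 a.2.2
    exact ⟨⟨(a.1.1 + 1, q), hqa, hxq⟩, rfl, hq⟩
  choose next hnext using hstep
  let s : ℕ → A := fun n => next^[n] ⟨(0, p₀), hp₀, hxp₀⟩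
  have hs : ∀ n, s (n + 1) = next (s n) := fun n => Function.iterate_succ_apply' _ _ _
  obtain ⟨n, hn⟩ := T.shrink (fun n => (s n).1.2) x
    (fun n => by simp only [hs]; exact (hnext (s n)).2) (fun n => (s n).2.2) U hU hxU
  exact ⟨(s n).1.1, (s n).1.2, (s n).2.1, (s n).2.2, hn⟩

/-- If a measure `ψ` is at most `c μ` on the good sets then it is at most `c μ` on the remainder:
an open set is exhausted there by the active sets which it contains. -/
theorem measure_inter_remainder_le {ψ : Measure X} {c : ℝ≥0∞}
    (hgood : ∀ p, good p → ψ (T.carrier p) ≤ c * μ (T.carrier p)) (hGgood : ∀ p ∈ G, good p)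
    (hGc : G.Countable) (hGd : G.PairwiseDisjoint T.carrier) {U : Set X} (hU : IsOpen U) :
    ψ (U ∩ T.remainder good G) ≤ c * μ U := by
  let S : ℕ → Set P := fun n => {p ∈ T.active good G n | T.carrier p ⊆ U}
  let W : ℕ → Set X := fun n => (⋃ p ∈ S n, T.carrier p) ∩ T.remainder good G
  have hW : Monotone W := by
    refine monotone_nat_of_le_succ fun n x hx => ⟨?_, hx.2⟩
    obtain ⟨p, hp, hxp⟩ := mem_iUnion₂.1 hx.1
    obtain ⟨q, hqp, hq, hxq⟩ := T.exists_child_of_mem_remainder hx.2 hp.1 hxp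
    exact mem_biUnion (show q ∈ S (n + 1) from ⟨hq, (T.subset_of_mem p q hqp).trans hp.2⟩) hxq
  have hUW : U ∩ T.remainder good G ⊆ ⋃ n, W n := by
    rintro x ⟨hxU, hx⟩
    obtain ⟨n, p, hp, hxp, hpU⟩ := T.exists_active_subset hx hU hxU
    exact mem_iUnion.2 ⟨n, mem_biUnion (show p ∈ S n from ⟨hp, hpU⟩) hxp, hx⟩
  have hactive : ∀ n, ∀ p ∈ T.active good G n, good p := by
    intro n
    cases n with
    | zero => exact hGgood
    | succ n => exact fun p hp => hp.2
  refine (measure_mono hUW).trans ?_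
  rw [hW.measure_iUnion]
  refine iSup_le fun n => (measure_mono inter_subset_left).trans ?_
  have hSc : (S n).Countable := (T.countable_active hGc n).mono (sep_subset _ _)
  have hSd : (S n).PairwiseDisjoint T.carrier :=
    (T.disjoint_active (good := good) hGd n).subset (sep_subset _ _)
  rw [measure_biUnion hSc hSd fun p _ => T.measurableSet p]
  calc ∑' p : S n, ψ (T.carrier p) ≤ ∑' p : S n, c * μ (T.carrier p) :=
        ENNReal.tsum_le_tsum fun p => hgood _ (hactive n p p.2.1)
    _ = c * μ (⋃ p ∈ S n, T.carrier p) := by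
        rw [ENNReal.tsum_mul_left, measure_biUnion hSc hSd fun p _ => T.measurableSet p]
    _ ≤ c * μ U := by
        gcongr
        exact iUnion₂_subset fun p hp => hp.2

theorem measure_compl_remainder (hGc : G.Countable)
    (hGn : μ (⋃ p ∈ G, T.carrier p)ᶜ = 0) :
    μ ((⋃ q ∈ ⋃ n, T.stopped good G n, T.carrier q) ∪ T.remainder good G)ᶜ = 0 := by
  have h1 : μ (⋃ n, ⋃ p ∈ T.active good G n, T.carrier p \ ⋃ q ∈ T.children p, T.carrier q) = 0 := by
    refine measure_iUnion_null fun n => ?_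
    exact (measure_biUnion_null_iff (T.countable_active hGc n)).2 fun p _ => T.measure_diff p
  refine measure_mono_null (fun x hx => ?_) (measure_union_null hGn h1)
  rw [mem_compl_iff, mem_union, not_or] at hx
  by_contra hcon
  rw [mem_union, not_or] at hcon
  refine hx.2 ⟨hx.1, ?_, fun n p hp hxp => ?_⟩
  · have := notMem_compl_iff.1 hcon.1
    simpa using this
  · by_contra! hc
    refine hcon.2 (mem_iUnion.2 ⟨n, mem_biUnion hp ⟨hxp, ?_⟩⟩)
    simpa using hc

variable [μ.OuterRegular] [SigmaFinite μ]

/-- Off the stopped sets the function is bounded by the height. By outer regularity the comparison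
of measures on open sets extends to measurable sets, so that no differentiation theorem is
needed. -/
theorem ae_le_of_notMem_stopped {φ : X → ℝ≥0∞} (hφ : AEMeasurable φ μ) {c : ℝ≥0∞} (hc₀ : c ≠ 0) (hc : c ≠ ⊤)
    (hgood : ∀ p, good p → ∫⁻ x in T.carrier p, φ x ∂μ ≤ c * μ (T.carrier p))
    (hGgood : ∀ p ∈ G, good p) (hGc : G.Countable) (hGd : G.PairwiseDisjoint T.carrier)
    (hGn : μ (⋃ p ∈ G, T.carrier p)ᶜ = 0) :
    ∀ᵐ x ∂μ, x ∉ (⋃ q ∈ ⋃ n, T.stopped good G n, T.carrier q) → φ x ≤ c := by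
  set B := ⋃ q ∈ ⋃ n, T.stopped good G n, T.carrier q with hB
  have hBm : MeasurableSet B :=
    MeasurableSet.biUnion (countable_iUnion fun n => T.countable_stopped hGc n)
      fun q _ => T.measurableSet q
  set ψ := μ.withDensity φ with hψ
  have hψμ : ψ ≪ μ := withDensity_absolutelyContinuous _ _
  have hgood' : ∀ p, good p → ψ (T.carrier p) ≤ c * μ (T.carrier p) := fun p hp => by
    rw [hψ, withDensity_apply _ (T.measurableSet p)]; exact hgood p hp
  have hopen : ∀ U, IsOpen U → ψ (U ∩ Bᶜ) ≤ c * μ U := by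
    intro U hU
    have h1 : U ∩ Bᶜ ⊆ (U ∩ T.remainder good G) ∪ (B ∪ T.remainder good G)ᶜ := by
      rintro x ⟨hxU, hxB⟩
      by_cases hx : x ∈ T.remainder good G
      · exact Or.inl ⟨hxU, hx⟩
      · exact Or.inr fun h => h.elim hxB hx
    refine (measure_mono h1).trans ((measure_union_le _ _).trans ?_)
    rw [hψμ (T.measure_compl_remainder hGc hGn), add_zero]
    exact T.measure_inter_remainder_le hgood' hGgood hGc hGd hU
  have hset : ∀ E : Set X, MeasurableSet E → ψ (E ∩ Bᶜ) ≤ c * μ E := by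
    intro E _
    rw [E.measure_eq_iInf_isOpen μ]
    simp only [ENNReal.mul_iInf_of_ne hc₀ hc]
    exact le_iInf₂ fun U hEU => le_iInf fun hU =>
      (measure_mono (inter_subset_inter_left _ hEU)).trans (hopen U hU)
  suffices h : ∀ᵐ x ∂μ.restrict Bᶜ, φ x ≤ c from (ae_restrict_iff' hBm.compl).1 h
  refine ae_le_of_forall_setLIntegral_le_of_sigmaFinite₀ (f := φ) (g := fun _ => c) hφ.restrict
    fun E hE _ => ?_
  rw [lintegral_const, Measure.restrict_restrict hE, Measure.restrict_apply_univ]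
  have h1 := hset (E ∩ Bᶜ) (hE.inter hBm.compl)
  rwa [inter_assoc, inter_self, hψ, withDensity_apply _ (hE.inter hBm.compl)] at h1

/-- Calderón–Zygmund decomposition with respect to a splitting family, whose members of measure
at least `‖f‖₁ / α` suffice to cover the space. These are split until the mean of `|f|` exceeds `α`.
The bad functions live on the sets at which this happens; there the good function is the mean of
`f`, which is at most `κ * α` because the parent was good. -/
theorem exists_decomposition (hκ : 2 ≤ κ)
    (hbig : ∀ L : ℝ≥0∞, L ≠ ⊤ → ∃ G : Set P, G.Countable ∧ G.PairwiseDisjoint T.carrier ∧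
      μ (⋃ p ∈ G, T.carrier p)ᶜ = 0 ∧ ∀ p ∈ G, L ≤ μ (T.carrier p))
    {f : X → ℂ} (hf : Integrable f μ) {α : ℝ} (hα : 0 < α) :
    ∃ (ι : Type) (_ : Countable ι) (g : X → ℂ) (b : ι → X → ℂ) (R : ι → P),
      IsCZDecomposition μ κ α f g b fun i => T.carrier (R i) := by
  have hα' : ENNReal.ofReal α ≠ 0 := by simpa using hα
  have hfin : ∫⁻ x, ‖f x‖ₑ ∂μ ≠ ⊤ := hf.hasFiniteIntegral.ne
  set c := ENNReal.ofReal α with hc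
  have hcT : c ≠ ⊤ := ENNReal.ofReal_ne_top
  obtain ⟨G, hGc, hGd, hGn, hGL⟩ := hbig ((∫⁻ x, ‖f x‖ₑ ∂μ) / c) (ENNReal.div_ne_top hfin hα')
  set good : P → Prop := fun p => ∫⁻ x in T.carrier p, ‖f x‖ₑ ∂μ ≤ c * μ (T.carrier p) with hgood
  have hGgood : ∀ p ∈ G, good p := by
    intro p hp
    refine (setLIntegral_le_lintegral _ _).trans ?_
    have := hGL p hp
    rwa [ENNReal.div_le_iff hα' hcT, mul_comm] at this
  have hae := T.ae_le_of_notMem_stopped (good := good) hf.aestronglyMeasurable.enorm hα' hcT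
    (fun p hp => hp) hGgood hGc hGd hGn
  set B : Set P := ⋃ n, T.stopped good G n with hB
  have hBc : B.Countable := countable_iUnion fun n => T.countable_stopped hGc n
  have hBd : B.PairwiseDisjoint T.carrier := T.disjoint_stopped hGd
  have hBad : ∀ q ∈ B, c * μ (T.carrier q) < ∫⁻ x in T.carrier q, ‖f x‖ₑ ∂μ := by
    intro q hq
    obtain ⟨n, hn⟩ := mem_iUnion.1 hq
    exact not_le.1 hn.2
  have hBle : ∀ q ∈ B, ∫⁻ x in T.carrier q, ‖f x‖ₑ ∂μ ≤
      ENNReal.ofReal κ * c * μ (T.carrier q) := by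
    intro q hq
    obtain ⟨n, hn⟩ := mem_iUnion.1 hq
    obtain ⟨p, hp, hqp⟩ := hn.1
    have hpgood : good p := by
      cases n with
      | zero => exact hGgood p hp
      | succ n => exact hp.2
    calc ∫⁻ x in T.carrier q, ‖f x‖ₑ ∂μ ≤ ∫⁻ x in T.carrier p, ‖f x‖ₑ ∂μ :=
          lintegral_mono_set (T.subset_of_mem p q hqp)
      _ ≤ c * μ (T.carrier p) := hpgood
      _ ≤ c * (ENNReal.ofReal κ * μ (T.carrier q)) := by
          gcongr; exact T.measure_le p q hqp
      _ = _ := by ring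
  have : Countable B := hBc.to_subtype
  let av : B → ℂ := fun q => ⨍ x in T.carrier q, f x ∂μ
  let b : B → X → ℂ := fun q => (T.carrier q).indicator fun x => f x - av q
  let g : X → ℂ := fun x => f x - ∑' q, b q x
  have hb_eq : ∀ (q : B) x, x ∈ T.carrier q → ∀ q', q' ≠ q → b q' x = 0 := by
    intro q x hx q' hne
    refine indicator_of_notMem (fun hx' => ?_) _
    exact Set.disjoint_left.1 (hBd q'.2 q.2 fun h => hne (Subtype.ext h)) hx' hx
  have hsum : ∀ x, Summable fun q => b q x := by
    intro x
    by_cases hx : ∃ q : B, x ∈ T.carrier q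
    · obtain ⟨q, hq⟩ := hx
      exact (hasSum_single q fun q' hne => hb_eq q x hq q' hne).summable
    · push Not at hx
      have : (fun q => b q x) = 0 := funext fun q => indicator_of_notMem (hx q) _
      rw [this]; exact summable_zero
  have hg_on : ∀ (q : B) x, x ∈ T.carrier q → g x = av q := by
    intro q x hx
    show f x - ∑' q, b q x = av q
    rw [tsum_eq_single q fun q' hne => hb_eq q x hx q' hne]
    show f x - (T.carrier q).indicator (fun x => f x - av q) x = av q
    rw [indicator_of_mem hx]; ring
  have hg_off : ∀ x, x ∉ (⋃ q ∈ B, T.carrier q) → g x = f x := by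
    intro x hx
    have h0 : ∀ q : B, b q x = 0 := fun q =>
      indicator_of_notMem (fun hxq => hx (mem_biUnion q.2 hxq)) _
    show f x - ∑' q, b q x = f x
    simp [h0]
  have hBm : MeasurableSet (⋃ q ∈ B, T.carrier q) :=
    MeasurableSet.biUnion hBc fun q _ => T.measurableSet q
  have hint : ∀ q : B, IntegrableOn (fun x => f x - av q) (T.carrier q) μ := fun q =>
    hf.integrableOn.sub (integrableOn_const (T.measure_ne_top q))
  have hav : ∀ q : B, μ (T.carrier q) * ‖av q‖ₑ ≤ ∫⁻ x in T.carrier q, ‖f x‖ₑ ∂μ := by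
    intro q
    have h1 : μ (T.carrier q) * ‖av q‖ₑ = ‖∫ x in T.carrier q, f x ∂μ‖ₑ := by
      have h2 := measure_smul_setAverage f (T.measure_ne_top q)
      rw [← h2, enorm_smul, Real.enorm_of_nonneg measureReal_nonneg, Measure.real,
        ENNReal.ofReal_toReal (T.measure_ne_top q)]
    rw [h1]
    exact enorm_integral_le_lintegral_enorm _
  have htsum : ∑' q : B, ∫⁻ x in T.carrier q, ‖f x‖ₑ ∂μ ≤ ∫⁻ x, ‖f x‖ₑ ∂μ := by
    rw [← lintegral_biUnion hBc (fun q _ => T.measurableSet q) hBd]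
    exact setLIntegral_le_lintegral _ _
  have hκ1 : 1 ≤ ENNReal.ofReal κ := ENNReal.one_le_ofReal.2 (by linarith)
  have hκ2 : 2 ≤ ENNReal.ofReal κ := by
    have := ENNReal.ofReal_le_ofReal hκ
    simpa using this
  refine ⟨B, inferInstance, g, b, fun q => q.1, ?_, ?_, ?_, ?_, ?_, ?_, ?_, ?_⟩
  · -- measurability of the good part, separately on each stopped set and on their complement
    have h1 : AEStronglyMeasurable g (μ.restrict (⋃ q : B, T.carrier q)) := by
      rw [aestronglyMeasurable_iUnion_iff]
      intro q
      refine (aestronglyMeasurable_const (b := av q)).congr ?_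
      filter_upwards [ae_restrict_mem (T.measurableSet q)] with x hx
      exact (hg_on q x hx).symm
    have h2 : AEStronglyMeasurable g (μ.restrict (⋃ q ∈ B, T.carrier q)ᶜ) := by
      refine hf.aestronglyMeasurable.restrict.congr ?_
      filter_upwards [ae_restrict_mem hBm.compl] with x hx
      exact (hg_off x hx).symm
    rw [← Measure.restrict_univ (μ := μ), ← union_compl_self (⋃ q ∈ B, T.carrier q),
      aestronglyMeasurable_union_iff]
    rw [biUnion_eq_iUnion] at h2 ⊢
    exact ⟨h1, h2⟩
  · exact fun q => (integrable_indicator_iff (T.measurableSet q)).2 (hint q)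
  · refine .of_forall fun x => ?_
    have h1 : f x - g x = ∑' q, b q x := sub_sub_cancel _ _
    rw [h1]
    exact (hsum x).hasSum
  · rw [eLpNorm_exponent_top]
    refine eLpNormEssSup_le_of_ae_enorm_bound ?_
    rw [ENNReal.ofReal_mul (by linarith)]
    filter_upwards [hae] with x hx
    by_cases hxB : x ∈ ⋃ q ∈ B, T.carrier q
    · obtain ⟨q, hq, hxq⟩ := mem_iUnion₂.1 hxB
      rw [hg_on ⟨q, hq⟩ x hxq]
      have h1 := (hav ⟨q, hq⟩).trans (hBle q hq)
      rw [mul_comm] at h1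
      exact (ENNReal.mul_le_mul_iff_left (T.measure_ne_zero q) (T.measure_ne_top q)).1 h1
    · rw [hg_off x hxB]
      refine (hx hxB).trans ?_
      exact le_mul_of_one_le_left' hκ1
  · exact fun q => support_indicator_subset
  · intro q
    show ∫ x, (T.carrier q).indicator (fun x => f x - av q) x ∂μ = 0
    rw [integral_indicator (T.measurableSet q),
      integral_sub hf.integrableOn (integrableOn_const (T.measure_ne_top q)), setIntegral_const,
      measure_smul_setAverage f (T.measure_ne_top q), sub_self]
  · rw [eLpNorm_one_eq_lintegral_enorm]
    refine le_trans ?_ (le_mul_of_one_le_left' hκ1)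
    rw [ENNReal.le_div_iff_mul_le (Or.inl hα') (Or.inl hcT), ← ENNReal.tsum_mul_right]
    refine (ENNReal.tsum_le_tsum fun q => ?_).trans htsum
    rw [mul_comm]
    exact (hBad q q.2).le
  · rw [eLpNorm_one_eq_lintegral_enorm]
    have h1 : ∀ q : B, eLpNorm (b q) 1 μ ≤ 2 * ∫⁻ x in T.carrier q, ‖f x‖ₑ ∂μ := by
      intro q
      rw [eLpNorm_one_eq_lintegral_enorm]
      have h2 : ∀ x, ‖b q x‖ₑ = (T.carrier q).indicator (fun x => ‖f x - av q‖ₑ) x := fun x =>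
        enorm_indicator_eq_indicator_enorm _ _
      simp only [h2]
      rw [lintegral_indicator (T.measurableSet q)]
      calc ∫⁻ x in T.carrier q, ‖f x - av q‖ₑ ∂μ
          ≤ ∫⁻ x in T.carrier q, (‖f x‖ₑ + ‖av q‖ₑ) ∂μ := lintegral_mono fun x => enorm_sub_le
        _ = ∫⁻ x in T.carrier q, ‖f x‖ₑ ∂μ + μ (T.carrier q) * ‖av q‖ₑ := by
            rw [lintegral_add_right _ measurable_const, lintegral_const, Measure.restrict_apply_univ,
              mul_comm]
        _ ≤ _ := by
            rw [two_mul]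
            exact add_le_add le_rfl (hav q)
    calc ∑' q, eLpNorm (b q) 1 μ ≤ ∑' q : B, 2 * ∫⁻ x in T.carrier q, ‖f x‖ₑ ∂μ :=
          ENNReal.tsum_le_tsum h1
      _ = 2 * ∑' q : B, ∫⁻ x in T.carrier q, ‖f x‖ₑ ∂μ := ENNReal.tsum_mul_left
      _ ≤ _ := mul_le_mul' hκ2 htsum

end SplittingFamily

end StoppingTime

/-! ### Scales of admissible sets -/

section Scales

/-- The smallest possible value of `η ^ k` for an admissible set of radius `r` and height `0`. -/
noncomputable def scaleLower (M r₀ r : ℝ) : ℝ :=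
  if r ≤ r₀ then r * Real.exp (2 * M) else Real.exp (2 * M * r)

/-- The upper bound for the values of `η ^ k` for an admissible set of radius `r` and height `0`. -/
noncomputable def scaleUpper (M r₀ r : ℝ) : ℝ :=
  if r ≤ r₀ then 4 * r * Real.exp (8 * M) else 4 * Real.exp (8 * M * r)

variable {η M r₀ : ℝ}

theorem scaleAdmissible_iff {k : ℤ} {u₀ r : ℝ} : ScaleAdmissible η M r₀ k u₀ r ↔
    scaleLower M r₀ r * Real.exp u₀ ≤ η ^ k ∧ η ^ k < scaleUpper M r₀ r * Real.exp u₀ := by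
  unfold ScaleAdmissible scaleLower scaleUpper
  split_ifs with h
  · simp [h, not_lt.2 h]
  · simp [h, not_le.1 h]

theorem scaleLower_pos {r : ℝ} (hr : 0 < r) : 0 < scaleLower M r₀ r := by
  unfold scaleLower; split_ifs <;> positivity

namespace ScaleConditions

variable (h : ScaleConditions η M r₀)
include h

/-- Halving the interval preserves the lower bound for the scale, up to the change of height. -/
theorem scaleLower_half {r : ℝ} (hr : 0 < r) :
    scaleLower M r₀ (r / 2) * Real.exp (r / 2) ≤ scaleLower M r₀ r := by
  have h1 := h.one_lt_r₀
  have hM := h.one_lt_M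
  unfold scaleLower
  by_cases hr1 : r ≤ r₀
  · rw [if_pos hr1, if_pos (by linarith)]
    have h2 : Real.exp (r / 2) ≤ 2 := by
      rw [← Real.le_log_iff_exp_le two_pos]
      linarith [h.r₀_lt]
    have h3 := Real.exp_pos (2 * M)
    nlinarith [mul_pos hr h3]
  rw [if_neg hr1]
  rw [not_le] at hr1
  by_cases hr2 : r / 2 ≤ r₀
  · rw [if_pos hr2]
    calc r / 2 * Real.exp (2 * M) * Real.exp (r / 2)
        ≤ r₀ * Real.exp (2 * M) * Real.exp r₀ := by gcongr
      _ = Real.exp r₀ * Real.exp (2 * M) * r₀ := by ring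
      _ ≤ Real.exp (2 * M * r₀) := h.cond₁
      _ ≤ _ := by gcongr
  · rw [if_neg hr2, ← Real.exp_add]
    gcongr
    nlinarith

/-- Halving the interval preserves the upper bound for the scale if the dyadic set cannot be split,
i.e. if `η ^ k` is less than `η` times its lower bound. -/
theorem mul_scaleLower_le (hη : 1 < η) {r : ℝ} (hr : 0 < r) :
    η * scaleLower M r₀ r ≤ scaleUpper M r₀ (r / 2) * Real.exp (-r / 2) := by
  have h1 := h.one_lt_r₀
  have hM := h.one_lt_M
  unfold scaleLower scaleUpper
  by_cases hr1 : r ≤ r₀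
  · rw [if_pos hr1, if_pos (by linarith)]
    have h2 : η ≤ 2 * Real.exp (6 * M - r₀ / 2) := by
      rw [← Real.log_le_log_iff (by linarith) (by positivity),
        Real.log_mul two_ne_zero (Real.exp_ne_zero _), Real.log_exp]
      linarith [h.cond₂]
    calc η * (r * Real.exp (2 * M))
        ≤ 2 * Real.exp (6 * M - r / 2) * (r * Real.exp (2 * M)) := by
          refine mul_le_mul_of_nonneg_right (h2.trans ?_) (by positivity)
          gcongr
      _ = 2 * r * (Real.exp (6 * M - r / 2) * Real.exp (2 * M)) := by ring
      _ = 2 * r * (Real.exp (8 * M) * Real.exp (-r / 2)) := by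
          rw [← Real.exp_add, ← Real.exp_add]; congr 2; ring
      _ = _ := by ring
  rw [if_neg hr1]
  rw [not_le] at hr1
  by_cases hr2 : r / 2 ≤ r₀
  · rw [if_pos hr2]
    have h3 : sInf ((fun r : ℝ => r * Real.exp (-r / 2)) '' Ioc r₀ (2 * r₀)) ≤
        r * Real.exp (-r / 2) := by
      refine csInf_le ⟨0, ?_⟩ ⟨r, ⟨hr1, by linarith⟩, rfl⟩
      rintro _ ⟨s, hs, rfl⟩
      have : 0 < s := by linarith [hs.1]
      positivity
    calc η * Real.exp (2 * M * r) ≤ η * Real.exp (4 * M * r₀) :=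
          mul_le_mul_of_nonneg_left (Real.exp_le_exp.2 (by nlinarith)) (by linarith)
      _ ≤ _ := h.cond₃.le
      _ ≤ 2 * Real.exp (8 * M) * (r * Real.exp (-r / 2)) := by gcongr
      _ = _ := by ring
  · rw [if_neg hr2]
    rw [not_le] at hr2
    calc η * Real.exp (2 * M * r) ≤ 4 * Real.exp ((4 * M - 1) * r₀) * Real.exp (2 * M * r) := by
          gcongr
          exact h.cond₄.le
      _ ≤ 4 * (Real.exp ((2 * M - 1 / 2) * r) * Real.exp (2 * M * r)) := by
          rw [mul_assoc]
          have : (4 * M - 1) * r₀ ≤ (2 * M - 1 / 2) * r := by nlinarith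
          gcongr
      _ = 4 * (Real.exp (8 * M * (r / 2)) * Real.exp (-r / 2)) := by
          rw [← Real.exp_add, ← Real.exp_add]; congr 2; ring
      _ = _ := by ring

theorem mul_scaleLower_le_scaleUpper {r : ℝ} (hr : r₀ < r) :
    η * scaleLower M r₀ r ≤ scaleUpper M r₀ r := by
  have h1 := h.one_lt_r₀
  have hM := h.one_lt_M
  unfold scaleLower scaleUpper
  rw [if_neg (not_le.2 hr), if_neg (not_le.2 hr)]
  calc η * Real.exp (2 * M * r) ≤ 4 * Real.exp ((4 * M - 1) * r₀) * Real.exp (2 * M * r) := by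
        gcongr
        exact h.cond₄.le
    _ = 4 * Real.exp ((4 * M - 1) * r₀ + 2 * M * r) := by rw [mul_assoc, ← Real.exp_add]
    _ ≤ _ := by
        gcongr
        nlinarith

omit h in
theorem scaleAdmissible_sub_one (hη : 1 < η) {k : ℤ} {u r : ℝ} (ha : ScaleAdmissible η M r₀ k u r)
    (hk : scaleLower M r₀ r * Real.exp u ≤ η ^ (k - 1)) : ScaleAdmissible η M r₀ (k - 1) u r := by
  rw [scaleAdmissible_iff] at ha ⊢
  exact ⟨hk, (zpow_lt_zpow_right₀ hη (by omega)).trans ha.2⟩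

theorem scaleAdmissible_half (hη : 1 < η) {k : ℤ} {u u' r : ℝ} (hr : 0 < r)
    (ha : ScaleAdmissible η M r₀ k u r)
    (hk : ¬ scaleLower M r₀ r * Real.exp u ≤ η ^ (k - 1)) (hu : |u' - u| ≤ r / 2) :
    ScaleAdmissible η M r₀ k u' (r / 2) := by
  rw [scaleAdmissible_iff] at ha ⊢
  rw [abs_le] at hu
  have hL := scaleLower_pos (M := M) (r₀ := r₀) (half_pos hr)
  have hU : 0 < scaleUpper M r₀ (r / 2) := by
    unfold scaleUpper; split_ifs <;> positivity
  constructor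
  · refine le_trans ?_ ha.1
    calc scaleLower M r₀ (r / 2) * Real.exp u'
        ≤ scaleLower M r₀ (r / 2) * Real.exp (r / 2 + u) := by gcongr; linarith
      _ = scaleLower M r₀ (r / 2) * Real.exp (r / 2) * Real.exp u := by rw [Real.exp_add]; ring
      _ ≤ _ := by gcongr; exact h.scaleLower_half hr
  · have hη0 : 0 < η := by linarith
    calc η ^ k = η * η ^ (k - 1) := by
          rw [← zpow_one_add₀ hη0.ne']; congr 1; ring
      _ < η * (scaleLower M r₀ r * Real.exp u) := by gcongr; exact not_le.1 hk
      _ = η * scaleLower M r₀ r * Real.exp u := by ring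
      _ ≤ scaleUpper M r₀ (r / 2) * Real.exp (-r / 2) * Real.exp u := by
          exact mul_le_mul_of_nonneg_right (h.mul_scaleLower_le hη hr) (Real.exp_pos _).le
      _ = scaleUpper M r₀ (r / 2) * Real.exp (-r / 2 + u) := by rw [Real.exp_add]; ring
      _ ≤ _ := by gcongr; linarith

/-- For a large radius the scale can be chosen in the optimal way. -/
theorem exists_scaleAdmissible (hη : 1 < η) {r : ℝ} (hr : r₀ < r) (u : ℝ) :
    ∃ k : ℤ, ScaleAdmissible η M r₀ k u r ∧ Real.exp (2 * M * r + u) ≤ η ^ k ∧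
      η ^ k < η * Real.exp (2 * M * r + u) := by
  have hη0 : 0 < η := by linarith
  obtain ⟨n, hn⟩ := exists_mem_Ioc_zpow (Real.exp_pos (2 * M * r + u)) hη
  have h1 : η ^ (n + 1) < η * Real.exp (2 * M * r + u) := by
    rw [add_comm, zpow_one_add₀ hη0.ne']
    exact mul_lt_mul_of_pos_left hn.1 hη0
  have h2 : scaleLower M r₀ r * Real.exp u = Real.exp (2 * M * r + u) := by
    rw [scaleLower, if_neg (not_le.2 hr), Real.exp_add]
  refine ⟨n + 1, scaleAdmissible_iff.2 ⟨h2 ▸ hn.2, h1.trans_le ?_⟩, hn.2, h1⟩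
  rw [← h2, ← mul_assoc]
  gcongr
  exact h.mul_scaleLower_le_scaleUpper hr

end ScaleConditions

/-- The constants `r₀ = 6 / 5` and `M = 10 + η` satisfy the conditions. -/
theorem exists_scaleConditions (hη : 1 < η) : ∃ M r₀ : ℝ, ScaleConditions η M r₀ := by
  have hlog2 := Real.log_two_gt_d9
  have hlog2' := Real.log_two_lt_d9
  have hη_exp : η < Real.exp η := by linarith [Real.add_one_le_exp η]
  have hη_log : Real.log η < η := (Real.log_lt_sub_one_of_pos (by linarith) hη.ne').trans (by linarith)
  refine ⟨10 + η, 6 / 5, ⟨by norm_num, by linarith, by linarith, ?_, by linarith, ?_, ?_⟩⟩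
  · have h1 : (6 / 5 : ℝ) ≤ Real.exp (1 / 5) := by linarith [Real.add_one_le_exp (1 / 5 : ℝ)]
    calc Real.exp (6 / 5) * Real.exp (2 * (10 + η)) * (6 / 5)
        ≤ Real.exp (6 / 5) * Real.exp (2 * (10 + η)) * Real.exp (1 / 5) := by gcongr
      _ = Real.exp (6 / 5 + 2 * (10 + η) + 1 / 5) := by rw [Real.exp_add, Real.exp_add]
      _ ≤ _ := by gcongr; linarith
  · have h1 : Real.exp (-(6 / 5)) ≤
        sInf ((fun r : ℝ => r * Real.exp (-r / 2)) '' Ioc (6 / 5) (2 * (6 / 5))) := by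
      refine le_csInf ⟨_, ⟨2 * (6 / 5), by norm_num, rfl⟩⟩ ?_
      rintro _ ⟨r, hr, rfl⟩
      calc Real.exp (-(6 / 5)) ≤ 1 * Real.exp (-r / 2) := by
            rw [one_mul]; gcongr; linarith [hr.2]
        _ ≤ r * Real.exp (-r / 2) := by gcongr; linarith [hr.1]
    calc η * Real.exp (4 * (10 + η) * (6 / 5))
        < Real.exp η * Real.exp (4 * (10 + η) * (6 / 5)) := by gcongr
      _ = Real.exp (η + 4 * (10 + η) * (6 / 5)) := by rw [Real.exp_add]
      _ ≤ Real.exp (8 * (10 + η) + -(6 / 5)) := Real.exp_le_exp.2 (by linarith)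
      _ = 1 * Real.exp (8 * (10 + η)) * Real.exp (-(6 / 5)) := by rw [Real.exp_add, one_mul]
      _ ≤ _ := by gcongr; norm_num
  · have h1 : Real.exp η ≤ Real.exp ((4 * (10 + η) - 1) * (6 / 5)) := by gcongr; linarith
    linarith [Real.exp_pos ((4 * (10 + η) - 1) * (6 / 5))]

end Scales

/-! ### The splitting of admissible sets -/

section AdmissibleIndex

/-- The intervals between consecutive points `R * (3 ^ j - 3 ^ (-j))` partition the line; they are
long, and their length grows with the distance to the origin. If `u` is the midpoint and `r` the half
length, then `3 * e (j + 1) - e j` equals `2 * (u + 2 * r)`. -/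
theorem exists_interval_partition {R : ℝ} (hR : 1 ≤ R) : ∃ e : ℤ → ℝ, Monotone e ∧
    (∀ x, ∃ j, e j ≤ x ∧ x < e (j + 1)) ∧
    ∀ j, 2 * R ≤ e (j + 1) - e j ∧ 0 ≤ 3 * e (j + 1) - e j := by
  have hpos : ∀ j : ℤ, 0 < (3 : ℝ) ^ j := fun j => by positivity
  have hsucc : ∀ j : ℤ, (3 : ℝ) ^ (j + 1) = 3 * 3 ^ j := fun j => by
    rw [zpow_add_one₀ (by norm_num)]; ring
  have hgap : ∀ j : ℤ, 2 * R ≤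
      R * (3 ^ (j + 1) - (3 ^ (j + 1))⁻¹) - R * ((3 : ℝ) ^ j - (3 ^ j)⁻¹) := by
    intro j
    rw [hsucc, mul_inv]
    have h1 : (3 : ℝ) ^ j * (3 ^ j)⁻¹ = 1 := mul_inv_cancel₀ (hpos j).ne'
    have h2 := hpos j
    have h3 := inv_pos.2 h2
    set t := (3 : ℝ) ^ j
    set s := t⁻¹
    have : 1 ≤ t + s / 3 := by nlinarith [sq_nonneg (t - s / 3)]
    nlinarith
  refine ⟨fun j => R * (3 ^ j - (3 ^ j)⁻¹), monotone_int_of_le_succ fun j => ?_, fun x => ?_,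
    fun j => ⟨hgap j, ?_⟩⟩
  · linarith [hgap j]
  · set e : ℤ → ℝ := fun j => R * (3 ^ j - (3 ^ j)⁻¹) with he
    have hmono : Monotone fun j : ℤ => e j - j := monotone_int_of_le_succ fun j => by
      have := hgap j
      simp only [he]
      push_cast
      linarith
    have h0 : e 0 = 0 := by simp [he]
    obtain ⟨j, hj, hmax⟩ := Int.exists_greatest_of_bdd (P := fun j => e j ≤ x)
      ⟨⌈|x|⌉, fun z hz => by
        by_contra! hlt
        have h1 : (|x| : ℝ) < z := (Int.le_ceil _).trans_lt (by exact_mod_cast hlt)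
        have h2 : (0 : ℤ) ≤ z := by
          have : (0 : ℝ) ≤ z := (abs_nonneg x).trans h1.le
          exact_mod_cast this
        have := hmono h2
        simp only [h0, Int.cast_zero, sub_zero] at this
        linarith [le_abs_self x]⟩
      ⟨-⌈|x|⌉, by
        have h1 := Int.le_ceil |x|
        have h2 : -⌈|x|⌉ ≤ 0 := by
          have := Int.ceil_nonneg (abs_nonneg x); omega
        have := hmono h2
        simp only [h0, Int.cast_zero, sub_zero] at this
        push_cast at this
        linarith [neg_abs_le x]⟩
    refine ⟨j, hj, ?_⟩
    by_contra! hcon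
    have := hmax _ hcon
    omega
  · simp only [hsucc, mul_inv]
    have h2 := hpos j
    have h3 : 0 < R * 3 ^ j := by positivity
    linarith

variable {V : Type*} [MeasurableSpace V] {d : V → V → ℝ≥0∞} {ν : Measure V}

/-- The data which determine an admissible set. -/
structure AdmissibleIndex (S : DyadicSystem d ν) (M r₀ : ℝ) : Type where
  /-- the scale and the index of the dyadic set -/
  cube : Σ k, S.I k
  /-- the midpoint of the interval -/
  height : ℝ
  /-- half of the length of the interval -/
  radius : ℝ
  radius_pos : 0 < radius
  admissible : ScaleAdmissible S.η M r₀ cube.1 height radius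

namespace AdmissibleIndex

variable {S : DyadicSystem d ν} {M r₀ : ℝ}

/-- The admissible set with the given data. -/
def carrier (p : AdmissibleIndex S M r₀) : Set (V × ℝ) :=
  S.Q p.cube.1 p.cube.2 ×ˢ Ioo (p.height - p.radius) (p.height + p.radius)

/-- The dyadic set may be replaced by a dyadic set of the preceding scale: the lower bound for the
scale remains valid. -/
def IsRefinable (p : AdmissibleIndex S M r₀) : Prop :=
  scaleLower M r₀ p.radius * Real.exp p.height ≤ S.η ^ (p.cube.1 - 1)

/-- Passage to one of the dyadic sets of the preceding scale. -/
def refine (p : AdmissibleIndex S M r₀) (hp : p.IsRefinable) (β : S.I (p.cube.1 - 1)) :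
    AdmissibleIndex S M r₀ :=
  ⟨⟨p.cube.1 - 1, β⟩, p.height, p.radius, p.radius_pos,
    ScaleConditions.scaleAdmissible_sub_one S.one_lt_η p.admissible hp⟩

/-- Passage to the left half or to the right half of the interval. -/
noncomputable def halve (h : ScaleConditions S.η M r₀) (p : AdmissibleIndex S M r₀) (hp : ¬ p.IsRefinable)
    (right : Bool) : AdmissibleIndex S M r₀ :=
  ⟨p.cube, p.height + (if right then p.radius / 2 else -(p.radius / 2)), p.radius / 2,
    half_pos p.radius_pos,
    h.scaleAdmissible_half S.one_lt_η p.radius_pos p.admissible hp (by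
      have := p.radius_pos
      cases right <;> simp [abs_of_pos (half_pos this)])⟩

/-- The sets into which an admissible set is split: the dyadic set is split if this gives admissible
sets, and otherwise the interval is halved. -/
def children (h : ScaleConditions S.η M r₀) (p : AdmissibleIndex S M r₀) :
    Set (AdmissibleIndex S M r₀) :=
  {q | (∃ (hp : p.IsRefinable) (β : S.I (p.cube.1 - 1)),
      S.Q _ β ⊆ S.Q p.cube.1 p.cube.2 ∧ q = p.refine hp β) ∨
    ∃ (hp : ¬ p.IsRefinable) (right : Bool), q = halve h p hp right}

theorem measurableSet_carrier (p : AdmissibleIndex S M r₀) : MeasurableSet p.carrier :=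
  (S.measurableSet _ _).prod measurableSet_Ioo

theorem measure_carrier (p : AdmissibleIndex S M r₀) :
    ν.prod volume p.carrier =
      ν (S.Q p.cube.1 p.cube.2) * ENNReal.ofReal (2 * p.radius) := by
  rw [carrier, Measure.prod_prod, Real.volume_Ioo]
  congr 2; ring

variable (h : ScaleConditions S.η M r₀)

theorem countable_children (p : AdmissibleIndex S M r₀) : (children h p).Countable := by
  have := S.countable_I (p.cube.1 - 1)
  by_cases hp : p.IsRefinable
  · refine (countable_range (p.refine hp)).mono ?_
    rintro q (⟨_, β, _, rfl⟩ | ⟨hp', _⟩)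
    · exact mem_range_self β
    · exact absurd hp hp'
  · refine (countable_range (halve h p hp)).mono ?_
    rintro q (⟨hp', _⟩ | ⟨_, b, rfl⟩)
    · exact absurd hp' hp
    · exact mem_range_self b

theorem carrier_subset (p : AdmissibleIndex S M r₀) :
    ∀ q ∈ children h p, q.carrier ⊆ p.carrier := by
  have hr := p.radius_pos
  rintro q (⟨hp, β, hβ, rfl⟩ | ⟨hp, b, rfl⟩)
  · exact prod_mono hβ subset_rfl
  · refine prod_mono subset_rfl (Ioo_subset_Ioo ?_ ?_) <;> cases b <;> simp [halve] <;> linarith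

theorem disjoint_children (p : AdmissibleIndex S M r₀) :
    (children h p).PairwiseDisjoint carrier := by
  have hr := p.radius_pos
  rintro q (⟨hp, β, hβ, rfl⟩ | ⟨hp, b, rfl⟩) q' (⟨hp', β', hβ', rfl⟩ | ⟨hp', b', rfl⟩) hne
  · refine Disjoint.set_prod_left (disjoint_iff_inter_eq_empty.2 (S.disjoint _ β β' ?_)) _ _
    rintro rfl; exact hne rfl
  · exact absurd hp hp'
  · exact absurd hp' hp
  · refine Disjoint.set_prod_right ?_ _ _
    rw [Set.disjoint_left]
    rintro x ⟨hx1, hx2⟩ ⟨hx3, hx4⟩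
    cases b <;> cases b' <;> simp [halve] at hx1 hx2 hx3 hx4 hne <;> linarith

theorem measure_diff_children (p : AdmissibleIndex S M r₀) :
    ν.prod volume (p.carrier \ ⋃ q ∈ children h p, q.carrier) = 0 := by
  by_cases hp : p.IsRefinable
  · refine measure_mono_null (t := (⋃ β, S.Q (p.cube.1 - 1) β)ᶜ ×ˢ univ) ?_ (by
      rw [Measure.prod_prod, S.cover, zero_mul])
    rintro x ⟨hx, hxq⟩
    refine ⟨fun hx1 => hxq ?_, mem_univ _⟩
    obtain ⟨β, hβ⟩ := mem_iUnion.1 hx1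
    refine mem_biUnion (x := p.refine hp β) (Or.inl ⟨hp, β, ?_, rfl⟩) ⟨hβ, hx.2⟩
    refine (S.nested (p.cube.1 - 1) p.cube.1 (by omega) p.cube.2 β).resolve_left fun he => ?_
    exact (disjoint_iff_inter_eq_empty.2 he).notMem_of_mem_left hx.1 hβ
  · refine measure_mono_null (t := univ ×ˢ {p.height}) ?_ (by
      rw [Measure.prod_prod, Real.volume_singleton, mul_zero])
    rintro x ⟨⟨hx, hx1, hx2⟩, hxq⟩
    refine ⟨mem_univ _, ?_⟩
    by_contra hne
    refine hxq ?_
    rcases lt_or_gt_of_ne hne with hlt | hgt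
    · refine mem_biUnion (x := halve h p hp false) (Or.inr ⟨hp, _, rfl⟩) ⟨hx, ?_, ?_⟩ <;>
        simp [halve] <;> linarith
    · refine mem_biUnion (x := halve h p hp true) (Or.inr ⟨hp, _, rfl⟩) ⟨hx, ?_, ?_⟩ <;>
        simp [halve] <;> linarith

theorem measure_le_of_mem_children {κ : ℝ} (hκ : 2 ≤ κ)
    (hcube : ∀ k (α : S.I k) (β : S.I (k - 1)),
      ν (S.Q k α) ≤ ENNReal.ofReal κ * ν (S.Q (k - 1) β)) (p : AdmissibleIndex S M r₀) :
    ∀ q ∈ children h p, ν.prod volume p.carrier ≤ ENNReal.ofReal κ * ν.prod volume q.carrier := by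
  rintro q (⟨hp, β, hβ, rfl⟩ | ⟨hp, b, rfl⟩)
  · rw [measure_carrier, measure_carrier, ← mul_assoc]
    exact mul_le_mul_left (hcube _ _ _) _
  · rw [measure_carrier, measure_carrier]
    have h1 : ENNReal.ofReal (2 * p.radius) =
        ENNReal.ofReal 2 * ENNReal.ofReal (2 * (p.radius / 2)) := by
      rw [← ENNReal.ofReal_mul two_pos.le]
      congr 1; ring
    rw [h1, mul_left_comm]
    exact mul_le_mul_left (ENNReal.ofReal_le_ofReal hκ) _

include h in
/-- Along a branch the radii tend to zero, since a dyadic set can be split only finitely many times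
before the interval has to be halved. -/
theorem exists_radius_lt (p : ℕ → AdmissibleIndex S M r₀)
    (hp : ∀ n, p (n + 1) ∈ children h (p n)) {ε : ℝ} (hε : 0 < ε) : ∃ n, (p n).radius < ε := by
  have hanti : Antitone fun n => (p n).radius := by
    refine antitone_nat_of_succ_le fun n => ?_
    have hr := (p n).radius_pos
    rcases hp n with ⟨_, _, _, hq⟩ | ⟨_, _, hq⟩ <;> rw [hq] <;> simp [AdmissibleIndex.refine, halve]
    exact hr.le
  have hhalf : ∀ n, ∃ m, n ≤ m ∧ ¬ (p m).IsRefinable := by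
    intro n
    by_contra! hcon
    have hk : ∀ j, (p (n + j)).cube.1 = (p n).cube.1 - j ∧ (p (n + j)).height = (p n).height ∧
        (p (n + j)).radius = (p n).radius := by
      intro j
      induction j with
      | zero => simp
      | succ j ih =>
        rcases hp (n + j) with ⟨_, _, _, hq⟩ | ⟨hnp, _⟩
        · rw [← add_assoc, hq]
          simp only [AdmissibleIndex.refine]
          refine ⟨?_, ih.2⟩
          rw [ih.1]; push_cast; ring
        · exact absurd (hcon _ (by omega)) hnp
    have hη := S.one_lt_η
    have hpos : 0 < scaleLower M r₀ (p n).radius * Real.exp (p n).height :=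
      mul_pos (scaleLower_pos (p n).radius_pos) (Real.exp_pos _)
    have hηk : 0 < S.η ^ (p n).cube.1 := zpow_pos (by linarith) _
    obtain ⟨j, hj⟩ := exists_pow_lt_of_lt_one (div_pos hpos hηk) (inv_lt_one_of_one_lt₀ hη)
    have h1 := (scaleAdmissible_iff.1 (p (n + j)).admissible).1
    rw [(hk j).1, (hk j).2.1, (hk j).2.2, zpow_sub₀ (by linarith), zpow_natCast] at h1
    rw [lt_div_iff₀ hηk, inv_pow] at hj
    rw [div_eq_inv_mul] at h1
    linarith
  have hpow : ∀ j : ℕ, ∃ n, (p n).radius ≤ (p 0).radius * (1 / 2) ^ j := by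
    intro j
    induction j with
    | zero => exact ⟨0, by simp⟩
    | succ j ih =>
      obtain ⟨n, hn⟩ := ih
      obtain ⟨m, hnm, hm⟩ := hhalf n
      refine ⟨m + 1, ?_⟩
      rcases hp m with ⟨hm', _⟩ | ⟨_, _, hq⟩
      · exact absurd hm' hm
      · rw [hq]
        have := hanti hnm
        simp only [halve] at this ⊢
        rw [pow_succ]
        linarith
  have h0 := (p 0).radius_pos
  obtain ⟨j, hj⟩ := exists_pow_lt_of_lt_one (div_pos hε h0) (show (1 / 2 : ℝ) < 1 by norm_num)
  obtain ⟨n, hn⟩ := hpow j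
  refine ⟨n, hn.trans_lt ?_⟩
  rwa [lt_div_iff₀ h0, mul_comm] at hj

theorem exists_carrier_subset [TopologicalSpace V] (hd : IsHomogeneousDist d ν)
    (p : ℕ → AdmissibleIndex S M r₀) (x : V × ℝ) (hp : ∀ n, p (n + 1) ∈ children h (p n))
    (hx : ∀ n, x ∈ (p n).carrier) (U : Set (V × ℝ)) (hU : IsOpen U) (hxU : x ∈ U) :
    ∃ n, (p n).carrier ⊆ U := by
  obtain ⟨A, B, hA, hxA, hB, hxB, hAB⟩ := (isOpen_prod_iff.1 hU) x.1 x.2 hxU |>.imp fun A hA =>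
    hA.imp fun B hB => (⟨hB.1, hB.2.2.1, hB.2.1, hB.2.2.2.1, hB.2.2.2.2⟩ :
      IsOpen A ∧ x.1 ∈ A ∧ IsOpen B ∧ x.2 ∈ B ∧ A ×ˢ B ⊆ U)
  obtain ⟨s, hs, hsA⟩ := hd.exists_ball_subset x.1 A (hA.mem_nhds hxA)
  obtain ⟨t, ht, htB⟩ := Metric.isOpen_iff.1 hB x.2 hxB
  have hC : 0 < S.C := zero_lt_one.trans S.one_lt_C
  have hr₀ := h.one_lt_r₀
  -- for `r ≤ 1` the diameter of the dyadic set is at most `K * r`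
  set K := 2 * S.C * (4 * Real.exp (8 * M) * Real.exp (x.2 + 1)) with hK
  have hKpos : 0 < K := by positivity
  obtain ⟨n, hn⟩ := exists_radius_lt h p hp
    (lt_min one_pos (lt_min (half_pos ht) (div_pos hs hKpos)))
  rw [lt_min_iff, lt_min_iff] at hn
  obtain ⟨hn1, hn2, hn3⟩ := hn
  have hr := (p n).radius_pos
  obtain ⟨hxQ, hxl, hxr⟩ := hx n
  refine ⟨n, Subset.trans (prod_mono (fun y hy => hsA ?_) fun y hy => htB ?_) hAB⟩
  · have hη : S.η ^ (p n).cube.1 < 4 * (p n).radius * Real.exp (8 * M) * Real.exp (x.2 + 1) := by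
      refine ((p n).admissible.1 (by linarith)).2.trans_le ?_
      gcongr
      linarith
    have hηk : 0 < S.η ^ (p n).cube.1 := zpow_pos (by linarith [S.one_lt_η]) _
    have h1 := S.subset_ball _ _ hxQ
    have h2 := S.subset_ball _ _ hy
    rw [distBall, mem_ofPred_eq] at h1 h2 ⊢
    rw [hd.symm] at h1
    refine (hd.triangle _ _ _).trans_lt ((ENNReal.add_lt_add h2 h1).trans_le ?_)
    rw [← ENNReal.ofReal_add (by positivity) (by positivity)]
    refine ENNReal.ofReal_le_ofReal ?_
    rw [lt_div_iff₀ hKpos] at hn3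
    calc S.C * S.η ^ (p n).cube.1 + S.C * S.η ^ (p n).cube.1
        = 2 * S.C * S.η ^ (p n).cube.1 := by ring
      _ ≤ 2 * S.C * (4 * (p n).radius * Real.exp (8 * M) * Real.exp (x.2 + 1)) := by gcongr
      _ = (p n).radius * K := by rw [hK]; ring
      _ ≤ s := hn3.le
  · rw [Metric.mem_ball, Real.dist_eq, abs_lt]
    constructor <;> linarith [hy.1, hy.2]

/-- The admissible sets form a splitting family. -/
noncomputable def splittingFamily [TopologicalSpace V] (hd : IsHomogeneousDist d ν)
    {κ : ℝ} (hκ : 2 ≤ κ) (hcube : ∀ k (α : S.I k) (β : S.I (k - 1)),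
      ν (S.Q k α) ≤ ENNReal.ofReal κ * ν (S.Q (k - 1) β)) :
    SplittingFamily (ν.prod (volume : Measure ℝ)) κ (AdmissibleIndex S M r₀) where
  carrier := carrier
  children := children h
  measurableSet := measurableSet_carrier
  measure_ne_zero p := by
    rw [measure_carrier]
    refine mul_ne_zero (fun h0 => ?_) (by simpa using p.radius_pos)
    refine hd.measure_ball_ne_zero _ _ ?_ (measure_mono_null (S.ball_subset _ _) h0)
    have := S.one_lt_C
    have := S.one_lt_η
    positivity
  measure_ne_top p := by
    rw [measure_carrier]
    exact ENNReal.mul_ne_top (ne_top_of_le_ne_top (hd.measure_ball_ne_top _ _)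
      (measure_mono (S.subset_ball _ _))) ENNReal.ofReal_ne_top
  countable_children := countable_children h
  disjoint_children := disjoint_children h
  subset_of_mem := carrier_subset h
  measure_diff := measure_diff_children h
  measure_le := measure_le_of_mem_children h hκ hcube
  shrink := exists_carrier_subset h hd

include h in
/-- `V × ℝ` is partitioned, up to a null set, into admissible sets of large measure. The intervals
of the partition become so long at large negative heights that their dyadic sets, which have the
scale `exp (2 * M * r + u₀)`, do not become small. -/
theorem exists_partition [TopologicalSpace V] (hd : IsHomogeneousDist d ν) [Nonempty V]
    {L : ℝ≥0∞} (hL : L ≠ ⊤) : ∃ G : Set (AdmissibleIndex S M r₀), G.Countable ∧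
      G.PairwiseDisjoint carrier ∧ ν.prod volume (⋃ p ∈ G, p.carrier)ᶜ = 0 ∧
      ∀ p ∈ G, L ≤ ν.prod volume p.carrier := by
  have hr₀ := h.one_lt_r₀
  have hM := h.one_lt_M
  have hC : 0 < S.C⁻¹ := inv_pos.2 (zero_lt_one.trans S.one_lt_C)
  obtain ⟨x₀⟩ := ‹Nonempty V›
  set m := ν (distBall d x₀ S.C⁻¹) with hm
  have hm0 : m ≠ 0 := hd.measure_ball_ne_zero _ _ hC
  set R := r₀ + 1 + (L / m).toReal with hR
  have hLR : L ≤ m * ENNReal.ofReal (2 * R) := by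
    have h1 : L / m ≤ ENNReal.ofReal (2 * R) := by
      have h2 : L / m ≠ ⊤ := ENNReal.div_ne_top hL hm0
      rw [← ENNReal.ofReal_toReal h2]
      refine ENNReal.ofReal_le_ofReal ?_
      have : 0 ≤ (L / m).toReal := ENNReal.toReal_nonneg
      linarith
    rwa [ENNReal.div_le_iff hm0 (hd.measure_ball_ne_top _ _), mul_comm] at h1
  have hRr : r₀ < R := by
    have : 0 ≤ (L / m).toReal := ENNReal.toReal_nonneg
    linarith
  obtain ⟨e, hmono, hcov, he⟩ := exists_interval_partition (R := R) (by linarith)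
  have hrad : ∀ j, r₀ < (e (j + 1) - e j) / 2 := fun j => by linarith [(he j).1]
  choose k hk hk1 _ using fun j : ℤ =>
    h.exists_scaleAdmissible S.one_lt_η (hrad j) ((e j + e (j + 1)) / 2)
  let T : (Σ j : ℤ, S.I (k j)) → AdmissibleIndex S M r₀ := fun a =>
    ⟨⟨k a.1, a.2⟩, (e a.1 + e (a.1 + 1)) / 2, (e (a.1 + 1) - e a.1) / 2,
      by linarith [hrad a.1], hk a.1⟩
  have hT : ∀ a, (T a).carrier = S.Q (k a.1) a.2 ×ˢ Ioo (e a.1) (e (a.1 + 1)) := fun a => by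
    simp only [carrier, T]
    congr 2 <;> ring
  have := S.countable_I
  refine ⟨range T, countable_range T, ?_, ?_, ?_⟩
  · rintro _ ⟨⟨i, α⟩, rfl⟩ _ ⟨⟨j, β⟩, rfl⟩ hne
    rw [Function.onFun, hT, hT]
    by_cases hij : i = j
    · subst hij
      refine Disjoint.set_prod_left (disjoint_iff_inter_eq_empty.2 (S.disjoint _ α β ?_)) _ _
      rintro rfl; exact hne rfl
    · refine Disjoint.set_prod_right ?_ _ _
      rw [Set.disjoint_left]
      rintro x ⟨h1, h2⟩ ⟨h3, h4⟩
      rcases lt_or_gt_of_ne hij with hlt | hlt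
      · have := hmono (show i + 1 ≤ j from hlt); simp only at *; linarith
      · have := hmono (show j + 1 ≤ i from hlt); simp only at *; linarith
  · have h1 : ν.prod volume (univ ×ˢ range e) = 0 := by
      rw [Measure.prod_prod, (countable_range e).measure_zero, mul_zero]
    have h2 : ν.prod (volume : Measure ℝ) (⋃ j, (⋃ α, S.Q (k j) α)ᶜ ×ˢ univ) = 0 := by
      refine measure_iUnion_null fun j => ?_
      rw [Measure.prod_prod, S.cover, zero_mul]
    refine measure_mono_null (fun x hx => ?_) (measure_union_null h1 h2)
    by_contra hcon
    rw [mem_union, not_or] at hcon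
    obtain ⟨j, hj1, hj2⟩ := hcov x.2
    have hj1' : e j ≠ x.2 := fun hj => hcon.1 ⟨mem_univ _, j, hj⟩
    have hxQ : x.1 ∈ ⋃ α, S.Q (k j) α := by
      by_contra hxQ
      exact hcon.2 (mem_iUnion.2 ⟨j, hxQ, mem_univ _⟩)
    obtain ⟨α, hα⟩ := mem_iUnion.1 hxQ
    refine hx (mem_biUnion (mem_range_self (f := T) ⟨j, α⟩) ?_)
    rw [hT]
    exact ⟨hα, lt_of_le_of_ne hj1 hj1', hj2⟩
  · rintro _ ⟨⟨j, α⟩, rfl⟩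
    refine hLR.trans ?_
    rw [measure_carrier]
    have h1 : (1 : ℝ) ≤ S.η ^ k j := by
      refine le_trans (Real.one_le_exp ?_) (hk1 j)
      have := hrad j
      nlinarith [(he j).2]
    refine mul_le_mul' ?_ (ENNReal.ofReal_le_ofReal ?_)
    · rw [hm, hd.measure_ball_eq _ (S.center (k j) α)]
      refine measure_mono (Subset.trans (distBall_mono ?_) (S.ball_subset _ _))
      exact le_mul_of_one_le_right hC.le h1
    · have := (he j).1
      simp only [T]
      linarith

end AdmissibleIndex

/-- Consecutive generations have comparable measures. -/
theorem DyadicSystem.exists_measure_le [TopologicalSpace V] (S : DyadicSystem d ν)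
    (hd : IsHomogeneousDist d ν) : ∃ C : ℝ≥0∞, C ≠ ⊤ ∧ ∀ k (α : S.I k) (β : S.I (k - 1)),
      ν (S.Q k α) ≤ C * ν (S.Q (k - 1) β) := by
  have hC : 0 < S.C := zero_lt_one.trans S.one_lt_C
  have hη : 0 < S.η := zero_lt_one.trans S.one_lt_η
  obtain ⟨C, hCt, hball⟩ := hd.measure_ball_mul (S.C * S.C * S.η) (by positivity)
  refine ⟨C, hCt, fun k α β => ?_⟩
  calc ν (S.Q k α) ≤ ν (distBall d (S.center k α) (S.C * S.η ^ k)) :=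
        measure_mono (S.subset_ball _ _)
    _ = ν (distBall d (S.center (k - 1) β) (S.C * S.η ^ k)) := hd.measure_ball_eq _ _ _
    _ = ν (distBall d (S.center (k - 1) β) (S.C * S.C * S.η * (S.C⁻¹ * S.η ^ (k - 1)))) := by
        congr 2
        rw [zpow_sub_one₀ hη.ne']
        field_simp
    _ = C * ν (distBall d (S.center (k - 1) β) (S.C⁻¹ * S.η ^ (k - 1))) :=
        hball _ _ (by positivity)
    _ ≤ _ := by gcongr; exact S.ball_subset _ _

/-- Condition (C): the admissible sets with large radius and height `0`, with the scale chosen in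
the optimal way, are nested, because the optimal scale is an increasing function of the radius. -/
theorem ScaleConditions.conditionC {S : DyadicSystem d ν} {M r₀ : ℝ}
    (h : ScaleConditions S.η M r₀) : ConditionC (admissibleSets S M r₀) := by
  have hη := S.one_lt_η
  have hM := h.one_lt_M
  have hr₀ := h.one_lt_r₀
  choose k hk hk1 hk2 using fun r : {r : ℝ // r₀ < r} => h.exists_scaleAdmissible hη r.2 0
  have hmono : Monotone k := by
    intro r s hrs
    have h1 : S.η ^ k r < S.η ^ (k s + 1) := by
      rw [zpow_add_one₀ (by linarith), mul_comm]
      refine (hk2 r).trans_le ?_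
      have : Real.exp (2 * M * r + 0) ≤ Real.exp (2 * M * s + 0) := by
        have : (r : ℝ) ≤ s := hrs
        gcongr
      gcongr
      exact this.trans (hk1 s)
    have := (zpow_lt_zpow_iff_right₀ hη).1 h1
    omega
  refine ⟨{R | ∃ (r : {r : ℝ // r₀ < r}) (α : S.I (k r)), R = S.Q (k r) α ×ˢ Ioo (0 - r.1) (0 + r.1)},
    ?_, ?_, ?_⟩
  · rintro _ ⟨r, α, rfl⟩
    exact ⟨k r, α, 0, r, by linarith [r.2], hk r, rfl⟩
  · have key : ∀ (r s : {r : ℝ // r₀ < r}) (α : S.I (k r)) (β : S.I (k s)), r ≤ s →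
        (S.Q (k s) β ∩ S.Q (k r) α).Nonempty →
        S.Q (k r) α ×ˢ Ioo (0 - r.1) (0 + r.1) ⊆ S.Q (k s) β ×ˢ Ioo (0 - s.1) (0 + s.1) := by
      intro r s α β hrs hne
      have hrs' : (r : ℝ) ≤ s := hrs
      exact prod_mono ((S.nested _ _ (hmono hrs) β α).resolve_left hne.ne_empty)
        (Ioo_subset_Ioo (by linarith) (by linarith))
    rintro _ ⟨r, α, rfl⟩ _ ⟨s, β, rfl⟩ ⟨x, hx2, hx1⟩
    rcases le_total r s with hrs | hrs
    · exact Or.inl (key r s α β hrs ⟨x.1, hx2.1, hx1.1⟩)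
    · exact Or.inr (key s r β α hrs ⟨x.1, hx1.1, hx2.1⟩)
  · rintro _ ⟨l, β, u, r, hr, _, rfl⟩
    have hηl : 0 < S.η ^ l := zpow_pos (by linarith) _
    let s : {r : ℝ // r₀ < r} := ⟨r₀ + |u| + r + S.η ^ l, by linarith [abs_nonneg u]⟩
    have hs : (s : ℝ) = r₀ + |u| + r + S.η ^ l := rfl
    have hls : l ≤ k s := by
      rw [← zpow_le_zpow_iff_right₀ hη]
      refine le_trans ?_ (hk1 s)
      refine le_trans ?_ (Real.add_one_le_exp _)
      have := abs_nonneg u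
      nlinarith
    obtain ⟨α, hα, _⟩ := S.existsUnique_ancestor l (k s) hls β
    refine ⟨_, ⟨s, α, rfl⟩, prod_mono hα (Ioo_subset_Ioo ?_ ?_)⟩
    · linarith [neg_abs_le u, abs_nonneg u]
    · linarith [le_abs_self u]

end AdmissibleIndex

/-! ### The distance on the semidirect product -/

section SemidirectProduct

variable {V : Type*} [NormedAddCommGroup V] [NormedSpace ℝ V] {n : ℕ}

/-- The frame `∂_u, e^u Y_1, …, e^u Y_n` on `V × ℝ`. -/
noncomputable def semidirectFrame (Y : Fin n → V → V) : Fin (n + 1) → V × ℝ → V × ℝ :=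
  Fin.cons (fun _ => (0, 1)) (fun j p => (Real.exp p.2 • Y j p.1, 0))

theorem sum_smul_semidirectFrame (Y : Fin n → V → V) (c : EuclideanSpace ℝ (Fin (n + 1)))
    (p : V × ℝ) : ∑ j, c j • semidirectFrame Y j p =
      (∑ j : Fin n, (c j.succ * Real.exp p.2) • Y j p.1, c 0) := by
  rw [Fin.sum_univ_succ]
  ext
  · simp [semidirectFrame, Prod.fst_sum, smul_smul]
  · simp [semidirectFrame, Prod.snd_sum]

theorem ccDist_semidirectFrame_horizontal_le (Y : Fin n → V → V) (z z' : V) (u : ℝ) :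
    ccDist (semidirectFrame Y) (z, u) (z', u) ≤ ENNReal.ofReal (Real.exp (-u)) * ccDist Y z z' := by
  have hm : ENNReal.ofReal (Real.exp (-u)) ≠ 0 := by simpa using Real.exp_pos _
  rw [mul_comm, ← ENNReal.div_le_iff hm ENNReal.ofReal_ne_top]
  refine le_of_forall_gt fun L hL => ?_
  obtain ⟨a, b, γ, c, h, rfl, rfl, hlen⟩ := exists_curve_of_ccDist_lt hL
  let c' : ℝ → EuclideanSpace ℝ (Fin (n + 1)) := fun t =>
    WithLp.toLp 2 (Fin.cons 0 fun j => Real.exp (-u) * c t j)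
  have hc' : ∀ t, ‖c' t‖ₑ = ENNReal.ofReal (Real.exp (-u)) * ‖c t‖ₑ := by
    intro t
    rw [← Real.enorm_of_nonneg (Real.exp_pos _).le, ← enorm_smul]
    rw [← ofReal_norm, ← ofReal_norm, EuclideanSpace.norm_eq, EuclideanSpace.norm_eq,
      Fin.sum_univ_succ]
    simp [c']
  have h1 : IsHorizontalCurve (semidirectFrame Y) a b (fun t => (γ t, u)) c' :=
    { le := h.le
      absolutelyContinuous := h.absolutelyContinuous.lipschitz_comp (K := 1) (s := univ)
        (Φ := fun x : V => (x, u))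
        (LipschitzWith.lipschitzOnWith (LipschitzWith.prodMk_right u)) fun _ _ => mem_univ _
      deriv := by
        filter_upwards [h.deriv] with t ht hmem
        rw [sum_smul_semidirectFrame]
        refine ((ht hmem).prodMk (hasDerivAt_const t u)).congr_deriv ?_
        have : Real.exp (-u) * Real.exp u = 1 := by rw [← Real.exp_add]; simp
        simp [c', mul_right_comm, this] }
  refine lt_of_le_of_lt ?_ hlen
  rw [ENNReal.div_le_iff hm ENNReal.ofReal_ne_top, mul_comm]
  refine h1.ccDist_le.trans_eq ?_
  simp only [hc']
  exact lintegral_const_mul' _ _ ENNReal.ofReal_ne_top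

theorem ccDist_semidirectFrame_vertical_le (Y : Fin n → V → V) (z : V) (u u' : ℝ) :
    ccDist (semidirectFrame Y) (z, u) (z, u') ≤ ENNReal.ofReal |u - u'| := by
  wlog huu : u ≤ u' generalizing u u'
  · rw [ccDist_comm, abs_sub_comm]
    exact this u' u (le_of_not_ge huu)
  have h : IsHorizontalCurve (semidirectFrame Y) u u' (fun t => (z, t))
      (fun _ => EuclideanSpace.single 0 1) :=
    { le := huu
      absolutelyContinuous := (LipschitzWith.prodMk_left z).lipschitzOnWith
        |>.absolutelyContinuousOnInterval
      deriv := .of_forall fun t _ => by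
        rw [sum_smul_semidirectFrame]
        refine ((hasDerivAt_const t z).prodMk (hasDerivAt_id t)).congr_deriv ?_
        simp }
  refine h.ccDist_le.trans_eq ?_
  have h1 : ‖(EuclideanSpace.single 0 1 : EuclideanSpace ℝ (Fin (n + 1)))‖ₑ = 1 := by
    rw [← ofReal_norm]; simp
  rw [h1, lintegral_const, Measure.restrict_apply_univ, Real.volume_Icc, one_mul, abs_sub_comm,
    abs_of_nonneg (by linarith)]

/-- A curve of length less than `L` from height `u` stays below the height `u + L`, so that the
length of its projection to `V` is at most `exp (u + L)` times its own length. -/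
theorem lt_of_ccDist_semidirectFrame_lt [FiniteDimensional ℝ V] (Y : Fin n → V → V) {z z' : V}
    {u u' L : ℝ} (hL : ccDist (semidirectFrame Y) (z, u) (z', u') < ENNReal.ofReal L) :
    |u - u'| < L ∧ ccDist Y z z' ≤ ENNReal.ofReal (Real.exp (u + L) * L) := by
  have hLpos : 0 < L := ENNReal.ofReal_pos.1 (pos_of_gt hL)
  obtain ⟨a, b, γ, c, h, ha, hb, hlen⟩ := exists_curve_of_ccDist_lt hL
  have hab := h.le
  have hderiv : ∀ᵐ t : ℝ, t ∈ Icc a b → HasDerivAt (fun t => (γ t).1)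
      (∑ j : Fin n, (c t j.succ * Real.exp (γ t).2) • Y j (γ t).1) t ∧
      HasDerivAt (fun t => (γ t).2) (c t 0) t := by
    filter_upwards [h.deriv] with t ht hmem
    have h1 := ht hmem
    rw [sum_smul_semidirectFrame] at h1
    exact ⟨h1.fst, h1.snd⟩
  have hac1 : AbsolutelyContinuousOnInterval (fun t => (γ t).1) a b :=
    h.absolutelyContinuous.contDiff_comp contDiff_fst
  have hac2 : AbsolutelyContinuousOnInterval (fun t => (γ t).2) a b :=
    h.absolutelyContinuous.contDiff_comp contDiff_snd
  have hheight : ∀ s ∈ Icc a b, |(γ s).2 - u| < L := by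
    intro s hs
    have h1 := AbsolutelyContinuousOnInterval.enorm_sub_le_lintegral hs.1
      (f := fun t => (γ t).2) (f' := fun t => c t 0)
      (hac2.mono (by
        rw [uIcc_of_le hs.1, uIcc_of_le hab]; exact Icc_subset_Icc_right hs.2))
      (hderiv.mono fun t ht hmem => (ht ⟨hmem.1, hmem.2.trans hs.2⟩).2)
    have h2 : ‖(γ s).2 - (γ a).2‖ₑ < ENNReal.ofReal L := by
      refine h1.trans_lt (lt_of_le_of_lt ?_ hlen)
      refine (lintegral_mono_set (Icc_subset_Icc_right hs.2)).trans (lintegral_mono fun t => ?_)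
      rw [enorm_le_iff_norm_le]
      exact PiLp.norm_apply_le _ _
    rw [ha, ← ofReal_norm, Real.norm_eq_abs] at h2
    exact (ENNReal.ofReal_lt_ofReal_iff hLpos).1 h2
  constructor
  · have := hheight b ⟨hab, le_rfl⟩
    rwa [hb, abs_sub_comm] at this
  have h1 : IsHorizontalCurve Y a b (fun t => (γ t).1)
      (fun t => WithLp.toLp 2 fun j => c t j.succ * Real.exp (γ t).2) :=
    { le := hab
      absolutelyContinuous := hac1
      deriv := hderiv.mono fun t ht hmem => (ht hmem).1 }
  have h2 := h1.ccDist_le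
  simp only [ha, hb] at h2
  refine h2.trans ?_
  rw [ENNReal.ofReal_mul (Real.exp_pos _).le]
  calc _ ≤ ∫⁻ t in Icc a b, ENNReal.ofReal (Real.exp (u + L)) * ‖c t‖ₑ := by
        refine setLIntegral_mono' measurableSet_Icc fun t ht => ?_
        rw [← Real.enorm_of_nonneg (Real.exp_pos _).le, ← enorm_smul, enorm_le_iff_norm_le,
          norm_smul, Real.norm_of_nonneg (Real.exp_pos _).le, EuclideanSpace.norm_eq]
        have hexp : Real.exp (γ t).2 ≤ Real.exp (u + L) := by
          have := abs_lt.1 (hheight t ht)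
          gcongr; linarith
        rw [Real.sqrt_le_left (by positivity), mul_pow, EuclideanSpace.norm_sq_eq, Fin.sum_univ_succ,
          mul_add, Finset.mul_sum]
        refine le_add_of_nonneg_of_le (by positivity) (Finset.sum_le_sum fun j _ => ?_)
        simp only [norm_mul, mul_pow, Real.norm_eq_abs, Real.abs_exp]
        rw [mul_comm]
        gcongr
    _ = ENNReal.ofReal (Real.exp (u + L)) * ∫⁻ t in Icc a b, ‖c t‖ₑ :=
        lintegral_const_mul' _ _ ENNReal.ofReal_ne_top
    _ ≤ _ := by gcongr

end SemidirectProduct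

/-! ### Balls of the semidirect product -/

section SemidirectProductBalls

variable {V : Type*} [NormedAddCommGroup V] [NormedSpace ℝ V] [FiniteDimensional ℝ V]
  [MeasurableSpace V] [BorelSpace V] {n : ℕ} {Y : Fin n → V → V} {ν : Measure V}

omit [FiniteDimensional ℝ V] [MeasurableSpace V] [BorelSpace V] in
/-- The distance of two points is at most the length of the path which joins them by way of the
height `t`. -/
theorem ccDist_semidirectFrame_le (Y : Fin n → V → V) (z z' : V) (u u' t : ℝ) :
    ccDist (semidirectFrame Y) (z, u) (z', u') ≤ ENNReal.ofReal |u - t| +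
      ENNReal.ofReal (Real.exp (-t)) * ccDist Y z z' + ENNReal.ofReal |t - u'| :=
  (ccDist_triangle _ (z', t) _).trans (add_le_add ((ccDist_triangle _ (z, t) _).trans
    (add_le_add (ccDist_semidirectFrame_vertical_le Y z u t)
      (ccDist_semidirectFrame_horizontal_le Y z z' t)))
    (ccDist_semidirectFrame_vertical_le Y z' t u'))

theorem IsHomogeneousDist.isMetricMeasurable (hd : IsHomogeneousDist (ccDist Y) ν) :
    IsMetricMeasurable (ccDist (semidirectFrame Y)) where
  ne_top p q := ne_top_of_le_ne_top
    (ENNReal.add_ne_top.2 ⟨ENNReal.add_ne_top.2 ⟨ENNReal.ofReal_ne_top,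
      ENNReal.mul_ne_top ENNReal.ofReal_ne_top (hd.ne_top _ _)⟩, ENNReal.ofReal_ne_top⟩)
    (ccDist_semidirectFrame_le Y p.1 q.1 p.2 q.2 0)
  eq_zero_iff p q := by
    refine ⟨fun h0 => ?_, fun h => h ▸ ccDist_self p⟩
    have key : ∀ L : ℝ, 0 < L → |p.2 - q.2| < L ∧
        ccDist Y p.1 q.1 ≤ ENNReal.ofReal (Real.exp (p.2 + L) * L) := fun L hL =>
      lt_of_ccDist_semidirectFrame_lt Y (z := p.1) (z' := q.1) (u := p.2) (u' := q.2)
        (by rw [Prod.mk.eta, Prod.mk.eta, h0]; exact ENNReal.ofReal_pos.2 hL)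
    refine Prod.ext ((hd.eq_zero_iff _ _).1 (le_antisymm ?_ bot_le)) ?_
    · have hlim : Filter.Tendsto (fun L : ℝ => ENNReal.ofReal (Real.exp (p.2 + L) * L))
          (nhdsWithin 0 (Ioi 0)) (nhds 0) := by
        have : Continuous fun L : ℝ => ENNReal.ofReal (Real.exp (p.2 + L) * L) :=
          ENNReal.continuous_ofReal.comp (by fun_prop)
        have h1 := this.tendsto 0
        simp only [mul_zero, ENNReal.ofReal_zero] at h1
        exact h1.mono_left nhdsWithin_le_nhds
      exact ge_of_tendsto hlim (by filter_upwards [self_mem_nhdsWithin] with L hL using (key L hL).2)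
    · by_contra hne
      exact lt_irrefl _ (key _ (abs_pos.2 (sub_ne_zero.2 hne))).1
  symm := ccDist_comm
  triangle := ccDist_triangle
  measurableSet_of_open U hU := by
    refine IsOpen.measurableSet (isOpen_iff_mem_nhds.2 fun p hp => ?_)
    obtain ⟨r, hr, hrU⟩ := hU p hp
    have h1 := hd.ball_mem_nhds p.1 (Real.exp p.2 * (r / 2)) (by positivity)
    have h2 := Metric.ball_mem_nhds p.2 (half_pos hr)
    refine Filter.mem_of_superset (prod_mem_nhds h1 h2) fun q hq => hrU ?_
    obtain ⟨hq1, hq2⟩ := hq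
    rw [Metric.mem_ball, Real.dist_eq] at hq2
    rw [distBall, mem_ofPred_eq] at hq1 ⊢
    refine (ccDist_semidirectFrame_le Y q.1 p.1 q.2 p.2 p.2).trans_lt ?_
    rw [sub_self, abs_zero, ENNReal.ofReal_zero, add_zero, ← add_halves r,
      ENNReal.ofReal_add (by positivity) (by positivity)]
    refine ENNReal.add_lt_add ((ENNReal.ofReal_lt_ofReal_iff (by positivity)).2 hq2) ?_
    have h3 : ENNReal.ofReal (r / 2) =
        ENNReal.ofReal (Real.exp (-p.2)) * ENNReal.ofReal (Real.exp p.2 * (r / 2)) := by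
      rw [← ENNReal.ofReal_mul (Real.exp_pos _).le, ← mul_assoc, ← Real.exp_add, neg_add_cancel,
        Real.exp_zero, one_mul]
    rw [h3]
    exact (ENNReal.mul_lt_mul_iff_right (by simpa using Real.exp_pos _) ENNReal.ofReal_ne_top).2 hq1

variable {M r₀ : ℝ} {S : DyadicSystem (ccDist Y) ν}

omit [FiniteDimensional ℝ V] [BorelSpace V] in
/-- An admissible set is contained in a ball whose radius is comparable to the length of the
interval. If the radius is large, two points of the set are joined by a path which goes up to the
height `u₀ + 8 * M * r`, where the dyadic set has bounded diameter. -/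
theorem AdmissibleIndex.carrier_subset_distBall (h : ScaleConditions S.η M r₀)
    (p : AdmissibleIndex S M r₀) : p.carrier ⊆ distBall (ccDist (semidirectFrame Y))
      (S.center p.cube.1 p.cube.2, p.height)
      ((1 + 16 * M + 4 * S.C * Real.exp (8 * M)) * p.radius) := by
  have hr := p.radius_pos
  have hM := h.one_lt_M
  have hC := S.one_lt_C
  have hr₀ := h.one_lt_r₀
  have hexp1 : 1 ≤ Real.exp (8 * M) := Real.one_le_exp (by linarith)
  have hη : 0 < S.η ^ p.cube.1 := zpow_pos (by linarith [S.one_lt_η]) _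
  rintro ⟨z, u⟩ ⟨hz, hu1, hu2⟩
  simp only at hu1 hu2
  have hz' := S.subset_ball _ _ hz
  rw [distBall, mem_ofPred_eq] at hz' ⊢
  obtain ⟨t, ht1, ht2, ht3⟩ : ∃ t, p.height ≤ t ∧ t ≤ p.height + 8 * M * p.radius ∧
      Real.exp (-t) * S.η ^ p.cube.1 ≤ 4 * Real.exp (8 * M) * p.radius := by
    have hcancel : ∀ s : ℝ, Real.exp (-s) * Real.exp s = 1 := fun s => by
      rw [← Real.exp_add]; simp
    by_cases hle : p.radius ≤ r₀
    · refine ⟨p.height, le_rfl, le_add_of_nonneg_right (by positivity), ?_⟩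
      calc Real.exp (-p.height) * S.η ^ p.cube.1
          ≤ Real.exp (-p.height) * (4 * p.radius * Real.exp (8 * M) * Real.exp p.height) := by
            gcongr; exact (p.admissible.1 hle).2.le
        _ = Real.exp (-p.height) * Real.exp p.height * (4 * Real.exp (8 * M) * p.radius) := by ring
        _ = _ := by rw [hcancel, one_mul]
    · rw [not_le] at hle
      refine ⟨p.height + 8 * M * p.radius, le_add_of_nonneg_right (by positivity), le_rfl, ?_⟩
      calc Real.exp (-(p.height + 8 * M * p.radius)) * S.η ^ p.cube.1
          ≤ Real.exp (-(p.height + 8 * M * p.radius)) *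
              (4 * Real.exp (8 * M * p.radius) * Real.exp p.height) := by
            gcongr; exact (p.admissible.2 hle).2.le
        _ = 4 * (Real.exp (-(p.height + 8 * M * p.radius)) *
              Real.exp (p.height + 8 * M * p.radius)) := by
            rw [Real.exp_add p.height]; ring
        _ = 4 * 1 * 1 := by rw [hcancel, mul_one, mul_one]
        _ ≤ 4 * Real.exp (8 * M) * p.radius := by
            have : 1 ≤ p.radius := by linarith
            gcongr
  have hut : |u - t| < p.radius + 8 * M * p.radius := by
    rw [abs_lt]; constructor <;> linarith
  have htu : |t - p.height| ≤ 8 * M * p.radius := by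
    rw [abs_of_nonneg (by linarith)]; linarith
  refine (ccDist_semidirectFrame_le Y z _ u _ t).trans_lt ?_
  have e : (1 + 16 * M + 4 * S.C * Real.exp (8 * M)) * p.radius =
      (p.radius + 8 * M * p.radius) + S.C * (4 * Real.exp (8 * M) * p.radius) +
        8 * M * p.radius := by ring
  rw [e, ENNReal.ofReal_add (by positivity) (by positivity),
    ENNReal.ofReal_add (by positivity) (by positivity)]
  refine ENNReal.add_lt_add_of_lt_of_le (ne_top_of_le_ne_top ENNReal.ofReal_ne_top
    (ENNReal.ofReal_le_ofReal htu)) ?_ (ENNReal.ofReal_le_ofReal htu)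
  have hhor : ENNReal.ofReal (Real.exp (-t)) * ccDist Y z (S.center p.cube.1 p.cube.2) ≤
      ENNReal.ofReal (S.C * (4 * Real.exp (8 * M) * p.radius)) := by
    calc _ ≤ ENNReal.ofReal (Real.exp (-t)) * ENNReal.ofReal (S.C * S.η ^ p.cube.1) := by gcongr
      _ = ENNReal.ofReal (S.C * (Real.exp (-t) * S.η ^ p.cube.1)) := by
          rw [← ENNReal.ofReal_mul (Real.exp_pos _).le]; congr 1; ring
      _ ≤ _ := by gcongr
  exact ENNReal.add_lt_add_of_lt_of_le (ne_top_of_le_ne_top ENNReal.ofReal_ne_top hhor)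
    ((ENNReal.ofReal_lt_ofReal_iff (by positivity)).2 hut) hhor

omit [BorelSpace V] in
/-- The neighbourhoods of radius `r / 2`. The horizontal displacement is less than
`exp (u₀ + 3 * r / 2) * (r / 2)`, which is bounded by a multiple of the scale; for large `r` the
radius `r / 2` leaves room to absorb the factor `r / 2` into `exp (2 * M * r + u₀)`, whatever
`M > 1` is. -/
theorem AdmissibleIndex.distThickening_subset (h : ScaleConditions S.η M r₀)
    (p : AdmissibleIndex S M r₀) :
    distThickening (ccDist (semidirectFrame Y)) (p.radius / 2) p.carrier ⊆
      distBall (ccDist Y) (S.center p.cube.1 p.cube.2) ((S.C + Real.exp 3) * S.η ^ p.cube.1) ×ˢ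
        Ioo (p.height - 2 * p.radius) (p.height + 2 * p.radius) := by
  have hr := p.radius_pos
  have hM := h.one_lt_M
  have hC := S.one_lt_C
  have hr₀ := h.one_lt_r₀
  have hη : 0 < S.η ^ p.cube.1 := zpow_pos (by linarith [S.one_lt_η]) _
  have hbound : Real.exp (p.height + p.radius + p.radius / 2) * (p.radius / 2) ≤
      Real.exp 3 * S.η ^ p.cube.1 := by
    by_cases hle : p.radius ≤ r₀
    · have hr2 : p.radius ≤ 2 := by linarith [h.r₀_lt, Real.log_two_lt_d9]
      have h1 := (p.admissible.1 hle).1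
      have h2 : 1 ≤ Real.exp (2 * M) := Real.one_le_exp (by linarith)
      calc Real.exp (p.height + p.radius + p.radius / 2) * (p.radius / 2)
          ≤ Real.exp (p.height + 3) * (p.radius * Real.exp (2 * M)) :=
            mul_le_mul (Real.exp_le_exp.2 (by linarith)) (by nlinarith) (by positivity)
              (by positivity)
        _ = Real.exp 3 * (p.radius * Real.exp (2 * M) * Real.exp p.height) := by
            rw [Real.exp_add]; ring
        _ ≤ _ := by gcongr
    · rw [not_le] at hle
      have h1 := (p.admissible.2 hle).1
      have h2 : p.radius / 2 ≤ Real.exp (p.radius / 2) := by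
        linarith [Real.add_one_le_exp (p.radius / 2)]
      calc Real.exp (p.height + p.radius + p.radius / 2) * (p.radius / 2)
          ≤ Real.exp (p.height + p.radius + p.radius / 2) * Real.exp (p.radius / 2) := by gcongr
        _ = Real.exp (2 * 1 * p.radius + p.height) := by rw [← Real.exp_add]; congr 1; ring
        _ ≤ Real.exp (2 * M * p.radius + p.height) := by gcongr
        _ = 1 * (Real.exp (2 * M * p.radius) * Real.exp p.height) := by rw [Real.exp_add, one_mul]
        _ ≤ _ := by
            gcongr
            exact Real.one_le_exp (by norm_num)
  rintro ⟨z, u⟩ hzu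
  simp only [distThickening, mem_ofPred_eq, iInf_lt_iff] at hzu
  obtain ⟨⟨z', u'⟩, ⟨hz', hu1, hu2⟩, hlt⟩ := hzu
  simp only at hu1 hu2 hz'
  rw [ccDist_comm] at hlt
  obtain ⟨h1, h2⟩ := lt_of_ccDist_semidirectFrame_lt Y hlt
  rw [abs_lt] at h1
  refine ⟨?_, ?_, ?_⟩
  · have h3 := S.subset_ball _ _ hz'
    rw [distBall, mem_ofPred_eq] at h3 ⊢
    have h4 : ccDist Y z z' ≤ ENNReal.ofReal (Real.exp 3 * S.η ^ p.cube.1) := by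
      rw [ccDist_comm]
      refine h2.trans (ENNReal.ofReal_le_ofReal (le_trans ?_ hbound))
      gcongr
    rw [add_mul, add_comm, ENNReal.ofReal_add (by positivity) (by positivity)]
    exact (ccDist_triangle z z' _).trans_lt (ENNReal.add_lt_add_of_le_of_lt
      (ne_top_of_le_ne_top ENNReal.ofReal_ne_top h4) h4 h3)
  · simp only; linarith [h1.2]
  · simp only; linarith [h1.1]

omit [BorelSpace V] in
theorem AdmissibleIndex.exists_measure_distThickening_le
    (hd : IsHomogeneousDist (ccDist Y) ν) (h : ScaleConditions S.η M r₀) :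
    ∃ C : ℝ≥0∞, C ≠ ⊤ ∧ ∀ p : AdmissibleIndex S M r₀,
      ν.prod volume (distThickening (ccDist (semidirectFrame Y)) (p.radius / 2) p.carrier) ≤
        C * ν.prod volume p.carrier := by
  have hC : 0 < S.C := zero_lt_one.trans S.one_lt_C
  obtain ⟨C, hCt, hball⟩ := hd.measure_ball_mul ((S.C + Real.exp 3) * S.C) (by positivity)
  refine ⟨C * 2, ENNReal.mul_ne_top hCt (by simp), fun p => ?_⟩
  have hη : 0 < S.η ^ p.cube.1 := zpow_pos (by linarith [S.one_lt_η]) _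
  refine (measure_mono (p.distThickening_subset h)).trans ?_
  rw [Measure.prod_prod, Real.volume_Ioo, p.measure_carrier]
  have e1 : (S.C + Real.exp 3) * S.η ^ p.cube.1 =
      (S.C + Real.exp 3) * S.C * (S.C⁻¹ * S.η ^ p.cube.1) := by field_simp
  have e2 : ENNReal.ofReal (p.height + 2 * p.radius - (p.height - 2 * p.radius)) =
      2 * ENNReal.ofReal (2 * p.radius) := by
    rw [← ENNReal.ofReal_ofNat 2, ← ENNReal.ofReal_mul two_pos.le]; congr 1; ring
  rw [e1, hball _ _ (by positivity), e2, mul_mul_mul_comm]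
  gcongr
  exact S.ball_subset _ _

/-- The Calderón–Zygmund property of the semidirect product. -/
theorem IsHomogeneousDist.isCZSpace [ν.IsAddHaarMeasure] (hd : IsHomogeneousDist (ccDist Y) ν)
    (h : ScaleConditions S.η M r₀) : IsCZSpace (ccDist (semidirectFrame Y))
      (ν.prod (volume : Measure ℝ)) (admissibleSets S M r₀) := by
  obtain ⟨C₁, hC₁, hcube⟩ := S.exists_measure_le hd
  obtain ⟨C₂, hC₂, hthick⟩ := AdmissibleIndex.exists_measure_distThickening_le (S := S) hd h
  set K := 1 + 16 * M + 4 * S.C * Real.exp (8 * M) with hK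
  have hKpos : 0 < K := by
    have := h.one_lt_M
    have := S.one_lt_C
    positivity
  set κ := 2 + 2 * K + C₁.toReal + C₂.toReal with hκ
  have hκ1 : C₁ ≤ ENNReal.ofReal κ := by
    rw [← ENNReal.ofReal_toReal hC₁]
    refine ENNReal.ofReal_le_ofReal ?_
    have := C₂.toReal_nonneg
    linarith
  have hκ2 : C₂ ≤ ENNReal.ofReal κ := by
    rw [← ENNReal.ofReal_toReal hC₂]
    refine ENNReal.ofReal_le_ofReal ?_
    have := C₁.toReal_nonneg
    linarith
  have hκ3 : 2 + 2 * K ≤ κ := by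
    have := C₁.toReal_nonneg
    have := C₂.toReal_nonneg
    linarith
  have hmem : ∀ p : AdmissibleIndex S M r₀, p.carrier ∈ admissibleSets S M r₀ := fun p =>
    ⟨_, _, _, _, p.radius_pos, p.admissible, rfl⟩
  have hexists : ∀ R ∈ admissibleSets S M r₀, ∃ p : AdmissibleIndex S M r₀, R = p.carrier := by
    rintro _ ⟨k, α, u, r, hr, ha, rfl⟩
    exact ⟨⟨⟨k, α⟩, u, r, hr, ha⟩, rfl⟩
  refine ⟨hd.isMetricMeasurable, κ, by linarith, fun R hR => ?_, fun R hR => ?_, fun f hf α hα => ?_⟩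
  · obtain ⟨p, rfl⟩ := hexists R hR
    exact p.measurableSet_carrier
  · obtain ⟨p, rfl⟩ := hexists R hR
    have hr := p.radius_pos
    refine ⟨_, p.radius / 2, half_pos hr,
      (p.carrier_subset_distBall h).trans (distBall_mono ?_), ?_⟩
    · rw [← hK]
      nlinarith
    · exact (hthick p).trans (by gcongr)
  · have hα' : 0 < α := ENNReal.ofReal_pos.1 (pos_of_gt hα)
    obtain ⟨ι, hι, g, b, R, hR⟩ := (AdmissibleIndex.splittingFamily h hd (κ := κ) (by linarith)
      fun k α β => (hcube k α β).trans (by gcongr)).exists_decomposition (by linarith)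
      (fun L hL => AdmissibleIndex.exists_partition h hd hL) hf hα'
    exact ⟨ι, hι, g, b, fun i => (R i).carrier, fun i => hmem _, hR⟩

end SemidirectProductBalls

/-! ### Calderón–Zygmund theory on `N ⋊ ℝ` -/

/-- `V` with the product `*` is a stratified group `N` in exponential coordinates (`hexp` says that
`t ↦ t • x` is a one-parameter subgroup for every `x`, so that the exponential map is the
identity), `D` is the derivation of its Lie algebra, `X` is a basis of the first layer, `ν` is a
Lebesgue measure, `G = N ⋊ ℝ` is `V × ℝ` as a manifold and its right Haar measure is
`ν.prod volume`. -/
theorem theorem3p13 {V : Type*} [NormedAddCommGroup V] [NormedSpace ℝ V] [FiniteDimensional ℝ V]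
    [CompleteSpace V] [MeasurableSpace V] [BorelSpace V] [Group V] [LieGroup 𝓘(ℝ, V) ∞ V]
    (hexp : ∀ (s t : ℝ) (x : V), (s • x) * (t • x) = (s + t) • x)
    (D : LieDerivation ℝ (GroupLieAlgebra 𝓘(ℝ, V) V) (GroupLieAlgebra 𝓘(ℝ, V) V))
    (hgen : LieSubalgebra.lieSpan ℝ (GroupLieAlgebra 𝓘(ℝ, V) V)
      (Module.End.eigenspace D.toLinearMap (1 : ℝ) : Set (GroupLieAlgebra 𝓘(ℝ, V) V)) = ⊤)
    (hQ : 2 ≤ LinearMap.trace ℝ (GroupLieAlgebra 𝓘(ℝ, V) V) D.toLinearMap)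
    {n : ℕ} (X : Module.Basis (Fin n) ℝ (Module.End.eigenspace D.toLinearMap (1 : ℝ)))
    (ν : Measure V) [ν.IsAddHaarMeasure] :
    Nonempty (DyadicSystem (ccDist (frameN fun j => (X j : GroupLieAlgebra 𝓘(ℝ, V) V))) ν) ∧
    ∀ S : DyadicSystem (ccDist (frameN fun j => (X j : GroupLieAlgebra 𝓘(ℝ, V) V))) ν,
      (∃ M r₀ : ℝ, ScaleConditions S.η M r₀) ∧
      ∀ M r₀ : ℝ, ScaleConditions S.η M r₀ →
        IsCZSpace (ccDist (frameG fun j => (X j : GroupLieAlgebra 𝓘(ℝ, V) V)))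
          (ν.prod (volume : Measure ℝ)) (admissibleSets S M r₀) ∧
        ConditionC (admissibleSets S M r₀) := by
  have h := isExpGroup_of_lieGroup hexp
  have hbr := isInvariantBracket_bracketMap h
  let X' : Fin n → V := fun j => (X j : GroupLieAlgebra 𝓘(ℝ, V) V)
  have hX' : ∀ j, D (X j) = X j := fun j => by
    simpa using Module.End.mem_eigenspace_iff.1 (X j).2
  let D' : V →L[ℝ] V :=
    LinearMap.toContinuousLinearMap (E := V) (F' := V) (D.toLinearMap : V →ₗ[ℝ] V)
  have hD' : ∀ v w, D' (bracketMap V v w) = bracketMap V (D' v) w + bracketMap V v (D' w) :=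
    fun v w => (LieDerivation.apply_lie_eq_add (L := GroupLieAlgebra 𝓘(ℝ, V) V) D v w).trans
      (add_comm _ _)
  have hδ : IsDilation X' fun s => NormedSpace.exp (s • D') :=
    isDilation_exp h hbr hD' hX'
      (span_eigenvectors_eq_top (L := GroupLieAlgebra 𝓘(ℝ, V) V) hgen)
  -- stability under the brackets with the basis `X` gives stability under those with the first layer
  have hgenU : ∀ U : Submodule ℝ V, (∀ j, X' j ∈ U) →
      (∀ j, ∀ u ∈ U, bracketMap V (X' j) u ∈ U) → U = ⊤ := by
    intro U hXU hbrU
    have hspan : ∀ s ∈ Module.End.eigenspace D.toLinearMap (1 : ℝ),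
        s ∈ Submodule.span ℝ (range fun j => (X j : GroupLieAlgebra 𝓘(ℝ, V) V)) := by
      intro s hs
      have h1 := X.mem_span ⟨s, hs⟩
      have h2 := Submodule.mem_map_of_mem (f := Submodule.subtype _) h1
      rw [Submodule.map_span, ← range_comp] at h2
      exact h2
    refine eq_top_of_lieSpan_eq_top (L := GroupLieAlgebra 𝓘(ℝ, V) V) hgen U (fun s hs => ?_)
      fun s hs u hu => ?_
    · exact Submodule.span_le.2 (range_subset_iff.2 hXU) (hspan s hs)
    · refine Submodule.span_induction (p := fun s _ => ⁅s, u⁆ ∈ U) ?_ ?_ ?_ ?_ (hspan s hs)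
      · rintro _ ⟨j, rfl⟩
        exact hbrU j u hu
      · rw [zero_lie]; exact U.zero_mem
      · intro x y _ _ hx hy
        rw [add_lie]; exact U.add_mem hx hy
      · intro a x _ hx
        rw [smul_lie]; exact U.smul_mem a hx
  have hframe : frameN (fun j => (X j : GroupLieAlgebra 𝓘(ℝ, V) V)) = leftFrame X' :=
    funext fun j => funext fun p => mulInvariantVectorField_eq_leftDeriv h _ p
  have hd : IsHomogeneousDist
      (ccDist (frameN fun j => (X j : GroupLieAlgebra 𝓘(ℝ, V) V))) ν := by
    rw [hframe]
    exact hδ.isHomogeneousDist ν h hbr hgenU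
  exact ⟨hd.nonempty_dyadicSystem 0, fun S => ⟨exists_scaleConditions S.one_lt_η,
    fun M r₀ hMr => ⟨hd.isCZSpace hMr, hMr.conditionC⟩⟩⟩
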